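/- **Theorem 3.** An *energy game* consists of a finite directed graph $G=(V,E)$, $E\subseteq V\times V$, in which every node has at least one out-going edge, a partition $V=V_{\mathrm{Max}}\sqcup V_{\mathrm{Min}}$, and a weight function $w\colon E\to\mathbb{R}$. A *positional strategy* of Max is a map $\sigma$ that chooses for every $a\in V_{\mathrm{Max}}$ an edge of $G$ starting in $a$; $G^\sigma$ is the graph obtained from $G$ by deleting all edges that start in a node $a\in V_{\mathrm{Max}}$ and differ from $\sigma(a)$. A node $v$ is *winning for Max* if there is a positional strategy $\sigma$ of Max such that every cycle reachable from $v$ in $G^\sigma$ has non-negative weight (the weight of a cycle is the sum of $w$ over its edges). There is a deterministic algorithm (a single program of a random access machine) which, given an energy game with $n$ nodes and arbitrary real edge weights, finds the set of all nodes that are winning for Max in at most $n^{O(1)}\cdot 2^{n/2}$ elementary steps and in $n^{O(1)}$ space. Real numbers are stored in registers of their own, and additions, subtractions and comparisons of real numbers, and the constant $1$, are carried out by an oracle, one step each; the only other data are non-negative integers bounded by $n^{O(1)}$. The space is the number of memory cells, of both kinds. Moreover, if the edge weights are rational, then the bit-length of every number that occurs in a real register during the computation is polynomial in the bit-length of the input.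 -/

import Mathlib

/-! ## Energy games -/

/-- An energy game with node set `V`: a directed graph in which every node has an out-going edge,
the set of the nodes that belong to Max (all other nodes belong to Min), and real edge weights.
The values of `weight` off `edges` are never used. -/
structure EnergyGame (V : Type*) where
  edges : Finset (V × V)
  exists_out : ∀ a, ∃ b, (a, b) ∈ edges
  maxNodes : Finset V
  weight : V × V → ℝ

namespace EnergyGame

variable {V : Type*}

/-- A positional strategy of Max: it picks an out-going edge at every node of Max
(its values at nodes of Min are never used). -/
def IsMaxStrategy (G : EnergyGame V) (σ : V → V) : Prop :=
  ∀ a ∈ G.maxNodes, (a, σ a) ∈ G.edges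

/-- The edge relation of the graph `G^σ` of the edges that are consistent with `σ`. -/
def Consistent (G : EnergyGame V) (σ : V → V) (a b : V) : Prop :=
  (a, b) ∈ G.edges ∧ (a ∈ G.maxNodes → b = σ a)

/-- `c 0, c 1, …, c k = c 0` is a cycle of length `k ≥ 1` in the graph with edge relation `R`. -/
def IsCycle (R : V → V → Prop) (k : ℕ) (c : ℕ → V) : Prop :=
  0 < k ∧ c k = c 0 ∧ ∀ i < k, R (c i) (c (i + 1))

/-- The weight of the cycle `c 0, c 1, …, c k`. -/
noncomputable def cycleWeight (G : EnergyGame V) (k : ℕ) (c : ℕ → V) : ℝ :=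
  ∑ i ∈ Finset.range k, G.weight (c i, c (i + 1))

/-- The node `v` is winning for Max: Max has a positional strategy `σ` such that only non-negative
cycles are reachable from `v` in `G^σ`. -/
def WinsMax (G : EnergyGame V) (v : V) : Prop :=
  ∃ σ : V → V, G.IsMaxStrategy σ ∧
    ∀ (k : ℕ) (c : ℕ → V), IsCycle (G.Consistent σ) k c →
      Relation.ReflTransGen (G.Consistent σ) v (c 0) → 0 ≤ G.cycleWeight k c

end EnergyGame

/-! ## Random access machines with exact additive real arithmetic -/

namespace RealRAM

/-- The memory: integer variables, integer arrays, and arrays of real numbers.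
Variables and arrays are named by numbers. -/
@[ext] structure Mem where
  var : ℕ → ℕ
  nat : ℕ → ℕ → ℕ
  real : ℕ → ℕ → ℝ

/-- The elementary instructions. Names of variables and arrays are constants of the program;
array cells are addressed by the contents of integer variables. -/
inductive Instr where
  /-- `x := k` -/
  | const (x k : ℕ)
  /-- `x := y + z` -/
  | add (x y z : ℕ)
  /-- `x := max (y - z) 0` -/
  | sub (x y z : ℕ)
  /-- `x := y * z` -/
  | mul (x y z : ℕ)
  /-- `x := a[i]`, integer array -/
  | load (x a i : ℕ)
  /-- `a[i] := x`, integer array -/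
  | store (a i x : ℕ)
  /-- `a[i] := 1`, real array -/
  | rone (a i : ℕ)
  /-- `a[i] := b[j]`, real arrays -/
  | rcopy (a i b j : ℕ)
  /-- `a[i] := b[j] + c[k]`, real arrays -/
  | radd (a i b j c k : ℕ)
  /-- `a[i] := b[j] - c[k]`, real arrays -/
  | rsub (a i b j c k : ℕ)

namespace Mem

/-- Assign to an integer variable. -/
def setVar (m : Mem) (x v : ℕ) : Mem :=
  { m with var := Function.update m.var x v }

/-- Assign to a cell of an integer array. -/
def setNat (m : Mem) (a i v : ℕ) : Mem :=
  { m with nat := Function.update m.nat a (Function.update (m.nat a) i v) }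

/-- Assign to a cell of a real array. -/
def setReal (m : Mem) (a i : ℕ) (r : ℝ) : Mem :=
  { m with real := Function.update m.real a (Function.update (m.real a) i r) }

/-- All that the memory holds lies in variables and arrays with names below `S`, in array cells
with addresses below `S`, and all integers that it holds are at most `S`. -/
def FitsIn (m : Mem) (S : ℕ) : Prop :=
  (∀ x, m.var x ≤ S) ∧ (∀ a i, m.nat a i ≤ S) ∧
  (∀ x, S ≤ x → m.var x = 0) ∧
  (∀ a i, S ≤ a ∨ S ≤ i → m.nat a i = 0 ∧ m.real a i = 0)

end Mem

/-- The effect of an elementary instruction. -/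
noncomputable def Instr.exec : Instr → Mem → Mem
  | .const x k, m => m.setVar x k
  | .add x y z, m => m.setVar x (m.var y + m.var z)
  | .sub x y z, m => m.setVar x (m.var y - m.var z)
  | .mul x y z, m => m.setVar x (m.var y * m.var z)
  | .load x a i, m => m.setVar x (m.nat a (m.var i))
  | .store a i x, m => m.setNat a (m.var i) (m.var x)
  | .rone a i, m => m.setReal a (m.var i) 1
  | .rcopy a i b j, m => m.setReal a (m.var i) (m.real b (m.var j))
  | .radd a i b j c k, m =>
      m.setReal a (m.var i) (m.real b (m.var j) + m.real c (m.var k))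
  | .rsub a i b j c k, m =>
      m.setReal a (m.var i) (m.real b (m.var j) - m.real c (m.var k))

/-- The elementary tests. -/
inductive Test where
  /-- `x ≤ y`, integer variables -/
  | le (x y : ℕ)
  /-- `a[i] ≤ b[j]`, real arrays -/
  | rle (a i b j : ℕ)

/-- The outcome of a test. -/
def Test.Holds : Test → Mem → Prop
  | .le x y, m => m.var x ≤ m.var y
  | .rle a i b j, m => m.real a (m.var i) ≤ m.real b (m.var j)

/-- Programs: instructions, sequences, case distinctions and while loops. -/
inductive Prog where
  | skip
  | op (i : Instr)
  | seq (p q : Prog)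
  | ite (t : Test) (p q : Prog)
  | loop (t : Test) (p : Prog)

/-- A configuration: what remains to be executed, and the memory. The machine has halted if
nothing remains. -/
structure Config where
  todo : List Prog
  mem : Mem

open Classical in
/-- One step: a single instruction, a single test, or the unfolding of a sequence. -/
noncomputable def step : Config → Config
  | ⟨[], m⟩ => ⟨[], m⟩
  | ⟨.skip :: K, m⟩ => ⟨K, m⟩
  | ⟨.op i :: K, m⟩ => ⟨K, i.exec m⟩
  | ⟨.seq p q :: K, m⟩ => ⟨p :: q :: K, m⟩
  | ⟨.ite t p q :: K, m⟩ => ⟨(if t.Holds m then p else q) :: K, m⟩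
  | ⟨.loop t p :: K, m⟩ => if t.Holds m then ⟨p :: .loop t p :: K, m⟩ else ⟨K, m⟩

/-- The configuration of the program `P` after `s` steps from the memory `m`. -/
noncomputable def run (P : Prog) (m : Mem) (s : ℕ) : Config :=
  step^[s] ⟨[P], m⟩

/-- The bit-length of a rational number (numerator and denominator in lowest terms). -/
def ratBits (q : ℚ) : ℕ :=
  q.num.natAbs.size + q.den.size

end RealRAM

/-- The input of the machine: variable `0` holds the number `n` of nodes, integer array `0` the
indicator vector of the nodes of Max, integer array `1` the adjacency matrix and real array `0` the
weights of the edges (matrices row by row: the entry of `(a, b)` is in cell `n * a + b`).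
All the rest of the memory is zero. -/
noncomputable def EnergyGame.input {n : ℕ} (G : EnergyGame (Fin n)) : RealRAM.Mem where
  var x := if x = 0 then n else 0
  nat a j :=
    if a = 0 then
      if h : j < n then (if (⟨j, h⟩ : Fin n) ∈ G.maxNodes then 1 else 0) else 0
    else if a = 1 then
      if h : j < n * n then (if finProdFinEquiv.symm ⟨j, h⟩ ∈ G.edges then 1 else 0) else 0
    else 0
  real a j :=
    if a = 0 then
      if h : j < n * n then
        (if finProdFinEquiv.symm ⟨j, h⟩ ∈ G.edges then
          G.weight (finProdFinEquiv.symm ⟨j, h⟩) else 0)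
      else 0
    else 0

/-! Fix potentials `p`, `q` and give every edge `(a, b)` the pair `(w + p b - p a, 1 + q b - q a)`,
ordered lexicographically. Potentials cancel along cycles, so the first components of a cycle add up
to its weight and the second ones to its length. Hence no cycle consists of zero pairs, and a cycle
of weight zero counts as positive, which is the right way to break ties for Max. Let `low` be the
set of nodes from which Min can force the first non-zero edge to be negative. Without zero cycles,
Max can force a positive one from all other nodes (`dual_low`). If no negative edge leads from `low`
to its complement and no positive edge leads back (`app` is empty), each player can stay on the own
side without meeting an edge of the wrong sign, and the complement of `low` is the answer
(`winsMax_iff`). Otherwise the potentials of the complement are raised by the size of the smallest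
such edge. This turns that edge to zero, and all other signs change only as `Tr` allows (`Step.tr`).

The number of rounds is bounded by looking at signs alone. The set `low` is built in layers: layer 0
is `neg`, the nodes whose best edge for their owner is negative, and the next layers arise by
closing alternately at nodes of Min and at nodes of Max. In a round neither `neg` nor its dual can
grow. If both stay the same, the first layer that changes grows if it was closed at Min's nodes and
shrinks if it was closed at Max's nodes. If no layer changes, `app` loses an edge. So the
lexicographic quantity `key` increases in every round (`Tr.key_lt`).

From layer 1 on, the layers grow strictly until they stop for good. Their sizes can therefore be
recovered from the mere set of these sizes, a subset of `{0, ..., |low|}`, and there are at most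
`n^O(1) * 2^|low|` values of `key`. The same applies to the game with exchanged players, whose set
`low` is the complement. One of the two sets has at most `n / 2` nodes, which gives `n^O(1) *
2^(n/2)` rounds in all (`length_le`).

To keep numbers small, each round ends by cutting the gaps between consecutive potentials down to a
bound that exceeds all weights (down to 2 in the second component, where all weights are 1). This
changes no sign, since an edge across so large a gap has the sign of the gap (`pattern_s_eq`). All
numbers then stay below `limit` and lie in the group generated by 1 and the weights, so rational
weights give a common denominator (`exists_rat`). The machine program consists of counting loops
inside one while loop; the former are verified by weakest preconditions (`exec_of_wp`), the latter
terminates by the bound on rounds (`mainLoop_exec`). -/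

/-! ## Games on sign patterns -/

/-- A finite directed graph with two kinds of nodes, whose edges are labelled by integers of which
only the sign matters. -/
structure SignGame (V : Type*) where
  E : V → V → Prop
  mx : V → Prop
  s : V → V → ℤ

namespace SignGame

variable {V : Type*}

/-- The game with the roles of the players exchanged. -/
def dual (g : SignGame V) : SignGame V := ⟨g.E, fun a => ¬ g.mx a, fun a b => -g.s a b⟩

/-- Starting from `X`, add nodes of `T` from which Min can force a negative edge, or a zero edge
into the set constructed so far. -/
inductive Cl (g : SignGame V) (T : V → Prop) (X : Set V) : V → Prop
  | base {a} : a ∈ X → Cl g T X a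
  | mx {a} : T a → g.mx a → (∀ b, g.E a b → g.s a b ≤ 0) →
      (∀ b, g.E a b → g.s a b = 0 → Cl g T X b) → Cl g T X a
  | neg {a b} : T a → ¬ g.mx a → g.E a b → g.s a b < 0 → Cl g T X a
  | zero {a b} : T a → ¬ g.mx a → g.E a b → g.s a b = 0 → Cl g T X b → Cl g T X a

/-- The closure as a set. -/
def cl (g : SignGame V) (T : V → Prop) (X : Set V) : Set V := {a | g.Cl T X a}

/-- The nodes from which Min forces the first non-zero edge to be negative. -/
def low (g : SignGame V) : Set V := g.cl (fun _ => True) ∅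

/-- The nodes whose extremal edge is negative. -/
def neg (g : SignGame V) : Set V :=
  {a | (g.mx a → ∀ b, g.E a b → g.s a b < 0) ∧ (¬ g.mx a → ∃ b, g.E a b ∧ g.s a b < 0)}

/-- The alternating closures that exhaust `low`. -/
def layer (g : SignGame V) : ℕ → Set V
  | 0 => g.neg
  | k + 1 => g.cl (fun a => (g.mx a ↔ Odd k)) (layer g k)

/-- There are no cycles of edges with sign zero. -/
def NoZeroCycle (g : SignGame V) : Prop :=
  ∀ (k : ℕ) (c : ℕ → V), 0 < k → c k = c 0 →
    ¬ ∀ i < k, g.E (c i) (c (i + 1)) ∧ g.s (c i) (c (i + 1)) = 0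

/-- The pattern `s'` arises from `g` by raising the edges from `low` to its complement and lowering
those back, none of them past zero. -/
structure Tr (g : SignGame V) (s' : V → V → ℤ) : Prop where
  same : ∀ a b, g.E a b → (a ∈ g.low ↔ b ∈ g.low) → s' a b = g.s a b
  up_neg : ∀ a b, g.E a b → a ∈ g.low → b ∉ g.low → g.s a b < 0 → s' a b ≤ 0
  up_pos : ∀ a b, g.E a b → a ∈ g.low → b ∉ g.low → 0 ≤ g.s a b → 0 < s' a b
  down_pos : ∀ a b, g.E a b → a ∉ g.low → b ∈ g.low → 0 < g.s a b → 0 ≤ s' a b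
  down_neg : ∀ a b, g.E a b → a ∉ g.low → b ∈ g.low → g.s a b ≤ 0 → s' a b < 0

/-- The edges between `low` and its complement that approach zero. -/
def app (g : SignGame V) : Set (V × V) :=
  {e | g.E e.1 e.2 ∧ ((e.1 ∈ g.low ∧ e.2 ∉ g.low ∧ g.s e.1 e.2 < 0) ∨
    (e.1 ∉ g.low ∧ e.2 ∈ g.low ∧ 0 < g.s e.1 e.2))}

/-- The same game with another pattern. -/
def withS (g : SignGame V) (s' : V → V → ℤ) : SignGame V := { g with s := s' }

theorem low_mx {g : SignGame V} {a : V} (ha : a ∈ g.low) (hm : g.mx a) (b : V) (hb : g.E a b) :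
    g.s a b < 0 ∨ (g.s a b = 0 ∧ b ∈ g.low) := by
  cases ha with
  | base h => exact h.elim
  | mx _ _ h1 h2 =>
    rcases (h1 b hb).lt_or_eq with h | h
    · exact .inl h
    · exact .inr ⟨h, h2 b hb h⟩
  | neg _ h => exact absurd hm h
  | zero _ h => exact absurd hm h

theorem low_mn {g : SignGame V} {a : V} (ha : a ∈ g.low) (hm : ¬ g.mx a) :
    ∃ b, g.E a b ∧ (g.s a b < 0 ∨ (g.s a b = 0 ∧ b ∈ g.low)) := by
  cases ha with
  | base h => exact h.elim
  | mx _ h => exact absurd h hm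
  | neg _ _ h1 h2 => exact ⟨_, h1, .inl h2⟩
  | zero _ _ h1 h2 h3 => exact ⟨_, h1, .inr ⟨h2, h3⟩⟩

theorem mem_low_mx {g : SignGame V} {a : V} (hm : g.mx a)
    (h : ∀ b, g.E a b → g.s a b < 0 ∨ (g.s a b = 0 ∧ b ∈ g.low)) : a ∈ g.low :=
  .mx trivial hm (fun b hb => by rcases h b hb with h | h <;> omega)
    (fun b hb h0 => by
      rcases h b hb with h | h
      · omega
      · exact h.2)

theorem mem_low_mn {g : SignGame V} {a b : V} (hm : ¬ g.mx a) (hb : g.E a b)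
    (h : g.s a b < 0 ∨ (g.s a b = 0 ∧ b ∈ g.low)) : a ∈ g.low := by
  rcases h with h | h
  · exact .neg trivial hm hb h
  · exact .zero trivial hm hb h.1 h.2

theorem neg_subset_low (g : SignGame V) : g.neg ⊆ g.low := by
  intro a ha
  by_cases hm : g.mx a
  · exact mem_low_mx hm fun b hb => .inl (ha.1 hm b hb)
  · obtain ⟨b, hb, h⟩ := ha.2 hm
    exact mem_low_mn hm hb (.inl h)

theorem subset_cl (g : SignGame V) (T : V → Prop) (X : Set V) : X ⊆ g.cl T X :=
  fun _ h => .base h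

theorem cl_subset_low {g : SignGame V} {T : V → Prop} {X : Set V} (h : X ⊆ g.low) :
    g.cl T X ⊆ g.low := by
  intro a ha
  induction ha with
  | base h' => exact h h'
  | mx _ hm h1 _ ih => exact .mx trivial hm h1 ih
  | neg _ hm h1 h2 => exact .neg trivial hm h1 h2
  | zero _ hm h1 h2 _ ih => exact .zero trivial hm h1 h2 ih

theorem layer_subset_low (g : SignGame V) (k : ℕ) : g.layer k ⊆ g.low := by
  induction k with
  | zero => exact g.neg_subset_low
  | succ k ih => exact cl_subset_low ih

theorem layer_subset_succ (g : SignGame V) (k : ℕ) : g.layer k ⊆ g.layer (k + 1) :=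
  g.subset_cl _ _

theorem layer_mono (g : SignGame V) : Monotone g.layer :=
  monotone_nat_of_le_succ g.layer_subset_succ

theorem cl_cl (g : SignGame V) (T : V → Prop) (X : Set V) : g.cl T (g.cl T X) = g.cl T X := by
  apply Set.Subset.antisymm _ (g.subset_cl _ _)
  intro a ha
  induction ha with
  | base h' => exact h'
  | mx ht hm h1 _ ih => exact .mx ht hm h1 ih
  | neg ht hm h1 h2 => exact .neg ht hm h1 h2
  | zero ht hm h1 h2 _ ih => exact .zero ht hm h1 h2 ih

theorem cl_congr {g : SignGame V} {T T' : V → Prop} (h : ∀ a, T a ↔ T' a) (X : Set V) :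
    g.cl T X = g.cl T' X := by
  rw [show T = T' from funext fun a => propext (h a)]

/-- The closures alternate between two kinds of nodes, and each is idempotent. Layer `k + 1` is
closed at one kind by construction and at the other by hypothesis, so nothing can be added any more.
-/
theorem layer_stable {g : SignGame V} {k : ℕ} (h : g.layer (k + 2) = g.layer (k + 1)) (j : ℕ) :
    g.layer (k + 1 + j) = g.layer (k + 1) := by
  have key : ∀ j, g.layer (k + 1 + j) = g.layer (k + 1) ∧
      g.layer (k + 1 + (j + 1)) = g.layer (k + 1) := by
    intro j
    induction j with
    | zero => exact ⟨rfl, h⟩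
    | succ j ih =>
      refine ⟨ih.2, ?_⟩
      have : g.layer (k + 1 + (j + 1 + 1)) =
          g.cl (fun a => (g.mx a ↔ Odd (k + 1 + (j + 1)))) (g.layer (k + 1 + (j + 1))) := rfl
      rw [this, ih.2]
      have h1 : g.layer (k + 1 + 1) =
          g.cl (fun a => (g.mx a ↔ Odd (k + 1))) (g.layer (k + 1)) := rfl
      have h0 : g.layer (k + 1) = g.cl (fun a => (g.mx a ↔ Odd k)) (g.layer k) := rfl
      rcases Nat.even_or_odd (j + 1) with he | ho
      · rw [cl_congr (T' := fun a => (g.mx a ↔ Odd (k + 1))), ← h1, h]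
        intro a
        rw [Nat.odd_add' (m := k + 1) (n := j + 1)]
        simp [Nat.not_odd_iff_even.2 he]
      · rw [cl_congr (T' := fun a => (g.mx a ↔ Odd k)), h0, cl_cl]
        intro a
        rw [Nat.odd_add' (m := k + 1) (n := j + 1)]
        simp [ho, Nat.even_add_one]
  exact (key j).1

/-- A stable layer contains `neg` and is closed at both kinds of nodes, so the inductive
construction of `low` never leaves it. -/
theorem low_eq_layer {g : SignGame V} {k : ℕ} (h : g.layer (k + 2) = g.layer (k + 1)) :
    g.low = g.layer (k + 1) := by
  apply Set.Subset.antisymm _ (g.layer_subset_low _)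
  have hneg : g.neg ⊆ g.layer (k + 1) := g.layer_mono (Nat.zero_le (k + 1))
  have h3 : g.layer (k + 3) = g.layer (k + 1) := layer_stable h 2
  have mem : ∀ a, (g.mx a ↔ Odd (k + 1)) ∨ (g.mx a ↔ Odd (k + 2)) := by
    intro a
    have : Odd (k + 2) ↔ ¬ Odd (k + 1) := Nat.odd_add_one
    tauto
  have e2 : g.layer (k + 2) = g.cl (fun a => (g.mx a ↔ Odd (k + 1))) (g.layer (k + 1)) := rfl
  have e3 : g.layer (k + 3) = g.cl (fun a => (g.mx a ↔ Odd (k + 2))) (g.layer (k + 2)) := rfl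
  rw [h3, h] at e3
  rw [h] at e2
  intro a ha
  induction ha with
  | base h' => exact h'.elim
  | mx _ hm h1 _ ih =>
    rcases mem _ with ht | ht
    · rw [e2]; exact .mx ht hm h1 fun b hb h0 => .base (ih b hb h0)
    · rw [e3]; exact .mx ht hm h1 fun b hb h0 => .base (ih b hb h0)
  | neg _ hm h1 h2 => exact hneg ⟨fun h => absurd h hm, fun _ => ⟨_, h1, h2⟩⟩
  | zero _ hm h1 h2 _ ih =>
    rcases mem _ with ht | ht
    · rw [e2]; exact .zero ht hm h1 h2 (.base ih)
    · rw [e3]; exact .zero ht hm h1 h2 (.base ih)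

theorem exists_layer_stable [Finite V] (g : SignGame V) :
    ∃ k, g.layer (k + 2) = g.layer (k + 1) := by
  by_contra! hne
  have hlt : ∀ k, k ≤ (g.layer (k + 1)).ncard := by
    intro k
    induction k with
    | zero => exact Nat.zero_le _
    | succ k ih =>
      refine Nat.succ_le_of_lt (ih.trans_lt (Set.ncard_lt_ncard ?_ (Set.toFinite _)))
      exact (g.layer_subset_succ (k + 1)).ssubset_of_ne (hne k).symm
  have h1 := hlt (Nat.card V + 1)
  have h2 := Set.ncard_le_card (g.layer (Nat.card V + 1 + 1))
  omega

theorem low_ncard_mem [Finite V] (g : SignGame V) (k : ℕ) :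
    (g.layer k).ncard ≤ g.low.ncard :=
  Set.ncard_le_ncard (g.layer_subset_low k) (Set.toFinite _)

/-! ### Duality -/

/-- By induction on the construction of `low`: at each node one of the two sets asks for some edge
and the other for all edges, and the common edge has contradictory signs or is a zero edge to an
earlier node. -/
theorem disjoint_low_dual {g : SignGame V} {a : V} (ha : a ∈ g.low) : a ∉ g.dual.low := by
  induction ha with
  | base h => exact h.elim
  | mx _ hm h1 _ ih =>
    intro hd
    obtain ⟨b, hb, h⟩ := low_mn hd (not_not.2 hm)
    have hb' : g.E _ b := hb
    simp only [dual] at h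
    have := h1 b hb'
    rcases h with h | h
    · omega
    · exact ih b hb' (by omega) h.2
  | neg _ hm h1 h2 =>
    intro hd
    have := low_mx hd hm _ h1
    simp only [dual] at this
    rcases this with h | h <;> omega
  | zero _ hm h1 h2 _ ih =>
    intro hd
    have := low_mx hd hm _ h1
    simp only [dual] at this
    rcases this with h | h
    · omega
    · exact ih h.2

/-- A node in neither set has a zero edge to another node in neither set. Following such edges in a
finite graph closes a zero cycle. -/
theorem dual_low [Finite V] {g : SignGame V} (hz : g.NoZeroCycle) :
    g.dual.low = g.lowᶜ := by
  apply Set.Subset.antisymm (fun a ha h => disjoint_low_dual h ha)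
  by_contra hne
  obtain ⟨a0, ha0, ha0'⟩ := Set.not_subset.1 hne
  let R := {a // a ∉ g.low ∧ a ∉ g.dual.low}
  have next : ∀ a : R, ∃ b : R, g.E a b ∧ g.s a b = 0 := by
    rintro ⟨a, h1, h2⟩
    by_cases hm : g.mx a
    · by_contra! hc
      refine h1 (mem_low_mx hm fun b hb => ?_)
      by_contra! hb'
      have h3 : ¬ (0 < g.s a b) := fun h => h2 (mem_low_mn (not_not.2 hm) (show g.dual.E a b from hb)
        (.inl (by simp only [dual]; omega)))
      have h4 : g.s a b = 0 := by omega
      have h5 : b ∉ g.dual.low := fun h => h2 (mem_low_mn (not_not.2 hm) (show g.dual.E a b from hb)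
        (.inr ⟨by simp only [dual]; omega, h⟩))
      exact hc ⟨b, hb'.2 h4, h5⟩ hb h4
    · by_contra! hc
      refine h2 (mem_low_mx (g := g.dual) hm fun b hb => ?_)
      have hb0 : g.E a b := hb
      by_contra! hb'
      simp only [dual] at hb'
      have h3 : ¬ (g.s a b < 0) := fun h => h1 (mem_low_mn hm hb (.inl h))
      have h4 : g.s a b = 0 := by omega
      have h5 : b ∉ g.low := fun h => h1 (mem_low_mn hm hb (.inr ⟨h4, h⟩))
      exact hc ⟨b, h5, hb'.2 (by omega)⟩ hb h4
  choose f hf using next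
  have : Finite R := Subtype.finite
  obtain ⟨i, j, hij, he⟩ := Finite.exists_ne_map_eq_of_infinite
    (fun i : ℕ => f^[i] ⟨a0, ha0, ha0'⟩)
  wlog hlt : i < j generalizing i j
  · exact this j i hij.symm he.symm (lt_of_le_of_ne (not_lt.1 hlt) hij.symm)
  refine hz (j - i) (fun t => (f^[i + t] ⟨a0, ha0, ha0'⟩ : R)) (by omega) ?_ ?_
  · have he' : f^[i] ⟨a0, ha0, ha0'⟩ = f^[j] ⟨a0, ha0, ha0'⟩ := he
    rw [Nat.add_sub_cancel' hlt.le, ← he']; rfl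
  · intro t _
    have := hf (f^[i + t] ⟨a0, ha0, ha0'⟩)
    rw [← Function.iterate_succ_apply' f] at this
    exact this

theorem NoZeroCycle.dual {g : SignGame V} (h : g.NoZeroCycle) : g.dual.NoZeroCycle := by
  intro k c hk hc hall
  refine h k c hk hc fun i hi => ⟨(hall i hi).1, ?_⟩
  have := (hall i hi).2
  simp only [SignGame.dual] at this
  omega

/-- Negating signs and complementing `low` swaps the two conditions on raised edges with the two on
lowered ones. -/
theorem Tr.dual [Finite V] {g : SignGame V} {s' : V → V → ℤ} (hz : g.NoZeroCycle) (h : g.Tr s') :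
    g.dual.Tr (fun a b => -s' a b) := by
  have hl := dual_low hz
  constructor
  · intro a b hb hs
    rw [hl] at hs
    have := h.same a b hb (by simpa [not_iff_not] using hs)
    simp [SignGame.dual, this]
  all_goals
    intro a b hb h1 h2 h3
    rw [hl] at h1 h2
    simp only [SignGame.dual, Set.mem_compl_iff, not_not] at h1 h2 h3 ⊢
  · have := h.down_pos a b hb h1 h2 (by omega); omega
  · have := h.down_neg a b hb h1 h2 (by omega); omega
  · have := h.up_neg a b hb h1 h2 (by omega); omega
  · have := h.up_pos a b hb h1 h2 (by omega); omega

theorem dual_app [Finite V] {g : SignGame V} (hz : g.NoZeroCycle) : g.dual.app = g.app := by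
  ext ⟨a, b⟩
  simp only [app, dual_low hz, Set.mem_ofPred_eq, Set.mem_compl_iff, not_not]
  simp only [dual, Left.neg_neg_iff, Left.neg_pos_iff]
  tauto

/-! ### Progress -/

/-- An edge can turn negative only if it was zero and runs from the complement into `low`. At a node
of Min such an edge would have put its start into `low`; at a node of Max all of whose edges are now
negative, so would the edges together. -/
theorem Tr.neg_subset {g : SignGame V} {s' : V → V → ℤ} (h : g.Tr s') :
    (g.withS s').neg ⊆ g.neg := by
  rintro a ⟨h1, h2⟩
  have h1' : g.mx a → ∀ b, g.E a b → s' a b < 0 := h1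
  have h2' : ¬ g.mx a → ∃ b, g.E a b ∧ s' a b < 0 := h2
  refine ⟨fun hm => ?_, fun hm => ?_⟩
  · by_cases ha : a ∈ g.low
    · intro b hb
      rcases low_mx ha hm b hb with h3 | h3
      · exact h3
      · rw [← h.same a b hb (by simp [ha, h3.2])]
        exact h1' hm b hb
    · exfalso
      apply ha
      refine mem_low_mx hm fun b hb => ?_
      have h4 := h1' hm b hb
      by_cases hbl : b ∈ g.low
      · by_contra! hc
        have hne : g.s a b ≠ 0 := fun h => hc.2 h hbl
        have := h.down_pos a b hb ha hbl (by omega)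
        omega
      · rw [h.same a b hb (by simp [ha, hbl])] at h4
        exact .inl h4
  · obtain ⟨b, hb, h4⟩ := h2' hm
    refine ⟨b, hb, ?_⟩
    by_cases ha : a ∈ g.low <;> by_cases hbl : b ∈ g.low
    · rwa [← h.same a b hb (by simp [ha, hbl])]
    · by_contra hc
      have := h.up_pos a b hb ha hbl (by omega)
      omega
    · by_contra hc
      by_cases h0 : g.s a b = 0
      · exact ha (mem_low_mn hm hb (.inr ⟨h0, hbl⟩))
      · have := h.down_pos a b hb ha hbl (by omega)
        omega
    · rwa [← h.same a b hb (by simp [ha, hbl])]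

/-- For even `k` the closure acts at Min's nodes. The zero edges it uses run inside `low`, where
signs are unchanged, and the negative edges it uses start in `neg`. -/
theorem Tr.layer_odd {g : SignGame V} {s' : V → V → ℤ} (h : g.Tr s') {k : ℕ} (hk : Even k)
    (hneg : (g.withS s').neg = g.neg) (hl : g.layer k = (g.withS s').layer k) :
    g.layer (k + 1) ⊆ (g.withS s').layer (k + 1) := by
  intro a ha
  have hlow := g.layer_subset_low (k + 1) ha
  have hko : ¬ Odd k := Nat.not_odd_iff_even.2 hk
  have hsub : (g.withS s').neg ⊆ (g.withS s').layer (k + 1) :=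
    (g.withS s').layer_mono (Nat.zero_le (k + 1))
  induction ha with
  | base h' => exact .base (hl ▸ h')
  | mx ht hm => exact absurd (ht.1 hm) hko
  | neg ht hm h1 h2 =>
    apply hsub
    rw [hneg]
    exact ⟨fun h => absurd h hm, fun _ => ⟨_, h1, h2⟩⟩
  | zero ht hm h1 h2 hb ih =>
    have hbl := g.layer_subset_low (k + 1) hb
    exact .zero (g := g.withS s') ht hm h1 ((h.same _ _ h1 (by simp [hlow, hbl])).trans h2)
      (ih hbl)

/-- For odd `k` the closure acts at Max's nodes. The point is that a node which joins in the new
pattern was already in `low`; after that, its old zero edges run inside `low` and are unchanged. -/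
theorem Tr.layer_even {g : SignGame V} {s' : V → V → ℤ} (h : g.Tr s') {k : ℕ} (hk : Odd k)
    (hpos : g.dual.neg ⊆ (g.withS s').dual.neg) (hl : g.layer k = (g.withS s').layer k) :
    (g.withS s').layer (k + 1) ⊆ g.layer (k + 1) := by
  intro a ha
  induction ha with
  | base h' => exact .base (hl ▸ h')
  | neg ht hm => exact absurd (ht.2 hk) hm
  | zero ht hm => exact absurd (ht.2 hk) hm
  | @mx a ht hm h1 _ ih =>
    have hm' : g.mx a := hm
    have h1' : ∀ b, g.E a b → s' a b ≤ 0 := h1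
    have ih' : ∀ b, g.E a b → s' a b = 0 → b ∈ g.layer (k + 1) := ih
    have hal : a ∈ g.low := by
      refine mem_low_mx hm' fun b hb => ?_
      -- A positive edge puts this node of Max into `g.dual.neg`, which by `hpos` gives it a
      -- positive edge in the new pattern too.
      have hp : ¬ 0 < g.s a b := by
        intro hp
        have h5 : a ∈ g.dual.neg :=
          ⟨fun h => absurd hm' h, fun _ => ⟨b, hb, by simp only [SignGame.dual]; omega⟩⟩
        obtain ⟨b', hb', h6⟩ := (hpos h5).2 (not_not.2 hm')
        have h7 := h1' b' hb'
        simp only [SignGame.dual, withS] at h6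
        omega
      by_contra! hc
      have h0 : g.s a b = 0 := by omega
      have hbl := hc.2 h0
      by_cases ha : a ∈ g.low
      · have h2 := h.up_pos a b hb ha hbl (by omega)
        have h3 := h1' b hb
        omega
      · have := h.same a b hb (by simp [ha, hbl])
        exact hbl (g.layer_subset_low _ (ih' b hb (by omega)))
    refine .mx ht hm' (fun b hb => ?_) fun b hb h0 => ?_
    · rcases low_mx hal hm' b hb with h3 | h3 <;> omega
    · rcases low_mx hal hm' b hb with h3 | h3
      · omega
      · exact ih' b hb ((h.same a b hb (by simp [hal, h3.2])).trans h0)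

end SignGame

/-- Two sequences that increase strictly until they become constant agree if they have the same
values. -/
theorem eq_of_range_eq_of_increasing {f g : ℕ → ℕ}
    (hf : ∀ k, f k < f (k + 1) ∨ ∀ j, f (k + j) = f k)
    (hg : ∀ k, g k < g (k + 1) ∨ ∀ j, g (k + j) = g k) (h : Set.range f = Set.range g) : f = g := by
  have mono : ∀ {f : ℕ → ℕ}, (∀ k, f k < f (k + 1) ∨ ∀ j, f (k + j) = f k) → Monotone f := by
    intro f hf
    refine monotone_nat_of_le_succ fun k => ?_
    rcases hf k with h | h
    · exact h.le
    · exact (h 1).ge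
  have key : ∀ {f g : ℕ → ℕ}, (∀ k, f k < f (k + 1) ∨ ∀ j, f (k + j) = f k) →
      (∀ k, g k < g (k + 1) ∨ ∀ j, g (k + j) = g k) → Set.range f = Set.range g →
      ∀ k, (∀ j < k, f j = g j) → ¬ f k < g k := by
    intro f g hf hg h k hk hlt
    -- At a first difference with `f k < g k`, the value `f k` is taken by `g` before `k`, where
    -- both sequences agree. So `f` repeats a value and is constant from there on, and can never
    -- reach `g k`.
    obtain ⟨i, hi⟩ : f k ∈ Set.range g := h ▸ Set.mem_range_self k
    have hik : i < k := by
      by_contra hc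
      have := mono hg (not_lt.1 hc)
      omega
    have hconst : ∀ j, f (i + j) = f i := by
      rcases hf i with h1 | h1
      · have h2 := mono hf (show i + 1 ≤ k by omega)
        have h3 := hk i hik
        omega
      · exact h1
    obtain ⟨l, hl⟩ : g k ∈ Set.range f := h ▸ Set.mem_range_self k
    have hkl : k < l := by
      by_contra hc
      have := mono hf (not_lt.1 hc)
      omega
    have h4 := hconst (l - i)
    rw [Nat.add_sub_cancel' (by omega)] at h4
    have h5 := hk i hik
    omega
  funext k
  induction k using Nat.strong_induction_on with
  | _ k ih =>
    have h1 := key hf hg h k ih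
    have h2 := key hg hf h.symm k fun j hj => (ih j hj).symm
    omega

/-! ### Monotone progress and the number of sign patterns -/

namespace SignGame

variable {V : Type*}

/-- The sizes of the layers, with alternating signs. -/
noncomputable def vec (g : SignGame V) (k : ℕ) : ℤ :=
  if Odd k then ((g.layer k).ncard : ℤ) else -((g.layer k).ncard : ℤ)

theorem layer_ncard_increasing [Finite V] (g : SignGame V) (k : ℕ) :
    (g.layer (k + 1)).ncard < (g.layer (k + 1 + 1)).ncard ∨
      ∀ j, (g.layer (k + j + 1)).ncard = (g.layer (k + 1)).ncard := by
  by_cases h : g.layer (k + 2) = g.layer (k + 1)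
  · right
    intro j
    rw [show k + j + 1 = k + 1 + j by ring, layer_stable h]
  · left
    exact Set.ncard_lt_ncard ((g.layer_subset_succ (k + 1)).ssubset_of_ne (Ne.symm h))
      (Set.toFinite _)

/-- Layer 0 is treated apart because layers 0 and 1 may coincide although later layers still grow.
-/
theorem vec_eq [Finite V] {g g' : SignGame V} (h0 : g.neg.ncard = g'.neg.ncard)
    (h : Set.range (fun k => (g.layer (k + 1)).ncard) =
      Set.range (fun k => (g'.layer (k + 1)).ncard)) : g.vec = g'.vec := by
  have h1 := eq_of_range_eq_of_increasing g.layer_ncard_increasing g'.layer_ncard_increasing h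
  funext k
  cases k with
  | zero => simp [vec, layer, h0]
  | succ k => simp only [vec, congrFun h1 k]

/-- The first layer that differs decides the lexicographic comparison, and the alternating signs in
`vec` turn both its growth at odd index and its loss at even index into an increase. -/
theorem Tr.layer_eq_or_lt [Finite V] {g : SignGame V} {s' : V → V → ℤ} (h : g.Tr s')
    (hn : (g.withS s').neg = g.neg) (hp : g.dual.neg = (g.withS s').dual.neg) :
    (∀ k, g.layer k = (g.withS s').layer k) ∨ toLex g.vec < toLex (g.withS s').vec := by
  by_cases hall : ∀ k, g.layer k = (g.withS s').layer k
  · exact .inl hall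
  right
  classical
  push Not at hall
  have hk := Nat.find_spec hall
  have hmin : ∀ j < Nat.find hall, g.layer j = (g.withS s').layer j :=
    fun j hj => not_not.1 (Nat.find_min hall hj)
  generalize Nat.find hall = k at hk hmin
  refine ⟨k, fun j hj => by simp [vec, hmin j hj], ?_⟩
  cases k with
  | zero => exact absurd hn.symm hk
  | succ k =>
    have hl := hmin k (Nat.lt_succ_self k)
    rcases Nat.even_or_odd k with he | ho
    · have := Set.ncard_lt_ncard ((h.layer_odd he hn hl).ssubset_of_ne hk) (Set.toFinite _)
      simp [vec, he, this]
    · have := Set.ncard_lt_ncard ((h.layer_even ho hp.le hl).ssubset_of_ne hk.symm) (Set.toFinite _)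
      have hne : ¬ Even k := Nat.not_even_iff_odd.2 ho
      simp [vec, Nat.odd_add_one, ho, this]

/-- With `low` unchanged, a raised edge that is still negative was negative before, and a lowered
edge that is still positive was positive before. The edge that became zero drops out. -/
theorem Tr.app_ssubset [Finite V] {g : SignGame V} {s' : V → V → ℤ} (h : g.Tr s')
    (hev : ∃ e ∈ g.app, s' e.1 e.2 = 0) (hl : g.low = (g.withS s').low) :
    (g.withS s').app ⊂ g.app := by
  refine ⟨?_, fun hs => ?_⟩
  · rintro ⟨a, b⟩ ⟨hE, hab⟩
    rw [← hl] at hab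
    refine ⟨hE, ?_⟩
    have hE' : g.E a b := hE
    simp only [withS] at hab
    rcases hab with ⟨h1, h2, h3⟩ | ⟨h1, h2, h3⟩
    · refine .inl ⟨h1, h2, ?_⟩
      by_contra hc
      have := h.up_pos a b hE' h1 h2 (by simpa using hc)
      omega
    · refine .inr ⟨h1, h2, ?_⟩
      by_contra hc
      have := h.down_neg a b hE' h1 h2 (by simpa using hc)
      omega
  · obtain ⟨e, he, h0⟩ := hev
    have := (hs he).2
    simp only [withS] at this
    omega

/-- A quantity that increases in each step. -/
noncomputable def key (g : SignGame V) : ℤ ×ₗ (Lex (ℕ → ℤ) ×ₗ ℤ) :=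
  toLex (-((g.neg.ncard : ℤ) + g.dual.neg.ncard), toLex (toLex g.vec, -(g.app.ncard : ℤ)))

/-- The components of `key` are tried in turn: `neg` and its dual shrink, or the layers move, or all
layers and with them `low` stay and `app` shrinks. -/
theorem Tr.key_lt [Finite V] {g : SignGame V} {s' : V → V → ℤ} (hz : g.NoZeroCycle)
    (h : g.Tr s') (hev : ∃ e ∈ g.app, s' e.1 e.2 = 0) : g.key < (g.withS s').key := by
  have h1 := h.neg_subset
  have h2 : (g.withS s').dual.neg ⊆ g.dual.neg := (h.dual hz).neg_subset
  have c1 := Set.ncard_le_ncard h1 (Set.toFinite _)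
  have c2 := Set.ncard_le_ncard h2 (Set.toFinite _)
  rw [key, key, Prod.Lex.toLex_lt_toLex]
  by_cases hlt : (g.withS s').neg.ncard + (g.withS s').dual.neg.ncard <
      g.neg.ncard + g.dual.neg.ncard
  · left; simp only; omega
  right
  have e1 : (g.withS s').neg = g.neg := Set.eq_of_subset_of_ncard_le h1 (by omega) (Set.toFinite _)
  have e2 : (g.withS s').dual.neg = g.dual.neg :=
    Set.eq_of_subset_of_ncard_le h2 (by omega) (Set.toFinite _)
  refine ⟨by simp only [e1, e2], ?_⟩
  rw [Prod.Lex.toLex_lt_toLex]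
  rcases h.layer_eq_or_lt e1 e2.symm with hall | hlt
  · right
    refine ⟨congrArg toLex (funext fun k => by simp only [vec, hall]), ?_⟩
    obtain ⟨k, hk⟩ := g.exists_layer_stable
    have hk' : (g.withS s').layer (k + 2) = (g.withS s').layer (k + 1) := by
      rw [← hall, ← hall, hk]
    have hl : g.low = (g.withS s').low := by
      rw [low_eq_layer hk, low_eq_layer hk', hall]
    have := Set.ncard_lt_ncard (h.app_ssubset hev hl) (Set.toFinite _)
    simp only
    omega
  · exact .inl hlt

/-- The number of patterns with a small set `low` in a sequence of steps. -/
theorem card_small_le [Fintype V] (g : ℕ → SignGame V) (k m : ℕ)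
    (hkey : ∀ i < k, (g i).key < (g (i + 1)).key) (I : Finset ℕ)
    (hI : ∀ i ∈ I, i ≤ k ∧ (g i).low.ncard ≤ m) :
    I.card ≤ (Fintype.card V + 1) ^ 2 * 2 ^ (m + 1) * (Fintype.card V ^ 2 + 1) := by
  classical
  have hlt : ∀ i j, i < j → j ≤ k → (g i).key < (g j).key := by
    intro i j hij
    induction j, hij using Nat.le_induction with
    | base => exact fun h => hkey i h
    | succ j hj ih => exact fun h => (ih (by omega)).trans (hkey j h)
  let R : ℕ → Set ℕ := fun i => Set.range fun k => ((g i).layer (k + 1)).ncard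
  let code : ℕ → (ℕ × ℕ) × Finset ℕ × ℕ := fun i =>
    (((g i).neg.ncard, (g i).dual.neg.ncard),
      (Finset.range (m + 1)).filter (· ∈ R i), (g i).app.ncard)
  let target : Finset ((ℕ × ℕ) × Finset ℕ × ℕ) :=
    (Finset.range (Fintype.card V + 1) ×ˢ Finset.range (Fintype.card V + 1)) ×ˢ
      (Finset.range (m + 1)).powerset ×ˢ Finset.range (Fintype.card V ^ 2 + 1)
  have hcount : ∀ s : Set V, s.ncard < Fintype.card V + 1 := fun s => by
    rw [← Nat.card_eq_fintype_card, Nat.lt_succ_iff]; exact Set.ncard_le_card s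
  have happ : ∀ s : Set (V × V), s.ncard < Fintype.card V ^ 2 + 1 := fun s => by
    rw [sq, ← Fintype.card_prod, ← Nat.card_eq_fintype_card, Nat.lt_succ_iff]
    exact Set.ncard_le_card s
  -- Nothing is lost by cutting the set of layer sizes at `m`, as every layer lies in `low`.
  have hR : ∀ i ∈ I, (((Finset.range (m + 1)).filter (· ∈ R i) : Finset ℕ) : Set ℕ) = R i := by
    intro i hi
    ext x
    simp only [Finset.coe_filter, Finset.mem_range, Set.mem_ofPred_eq, and_iff_right_iff_imp]
    rintro ⟨j, rfl⟩
    have := (g i).low_ncard_mem (j + 1)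
    have := (hI i hi).2
    simp only
    omega
  have hcard : target.card = (Fintype.card V + 1) ^ 2 * 2 ^ (m + 1) * (Fintype.card V ^ 2 + 1) := by
    simp only [target, Finset.card_product, Finset.card_range, Finset.card_powerset]
    ring
  rw [← hcard]
  -- The code determines `key`, and keys strictly increase along the sequence, so distinct indices
  -- have distinct codes.
  refine Finset.card_le_card_of_injOn code (fun i _ => ?_) fun i hi j hj hij => ?_
  · simp only [target, code, Finset.coe_product, Set.mem_prod, Finset.mem_coe, Finset.mem_range,
      Finset.mem_powerset]
    exact ⟨⟨hcount _, hcount _⟩, Finset.filter_subset _ _, happ _⟩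
  · simp only [code, Prod.mk.injEq] at hij
    obtain ⟨⟨h1, h2⟩, h3, h4⟩ := hij
    have h5 : R i = R j := by rw [← hR i hi, ← hR j hj, h3]
    have h6 : (g i).key = (g j).key := by
      simp only [key, h1, h2, h4, vec_eq h1 h5]
    rcases lt_trichotomy i j with h | h | h
    · exact absurd h6 (hlt i j h (hI j hj).1).ne
    · exact h
    · exact absurd h6.symm (hlt j i h (hI i hi).1).ne

/-- The number of patterns in a sequence of steps. -/
theorem length_le [Fintype V] (g : ℕ → SignGame V) (k : ℕ)
    (hz : ∀ i ≤ k, (g i).NoZeroCycle)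
    (hstep : ∀ i < k, ∃ s', g (i + 1) = (g i).withS s' ∧ (g i).Tr s' ∧
      ∃ e ∈ (g i).app, s' e.1 e.2 = 0) :
    k + 1 ≤ 2 * ((Fintype.card V + 1) ^ 2 * 2 ^ (Fintype.card V / 2 + 1) *
      (Fintype.card V ^ 2 + 1)) := by
  classical
  have h1 : ∀ i < k, (g i).key < (g (i + 1)).key := by
    intro i hi
    obtain ⟨s', hs, htr, hev⟩ := hstep i hi
    rw [hs]
    exact htr.key_lt (hz i hi.le) hev
  -- The step is a legal step of the dual game as well, with the same approaching edges.
  have h2 : ∀ i < k, (g i).dual.key < (g (i + 1)).dual.key := by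
    intro i hi
    obtain ⟨s', hs, htr, e, he, h0⟩ := hstep i hi
    rw [hs]
    exact (htr.dual (hz i hi.le)).key_lt (hz i hi.le).dual
      ⟨e, by rwa [dual_app (hz i hi.le)], neg_eq_zero.2 h0⟩
  let m := Fintype.card V / 2
  let I := (Finset.range (k + 1)).filter fun i => (g i).low.ncard ≤ m
  let J := (Finset.range (k + 1)).filter fun i => (g i).dual.low.ncard ≤ m
  have hI := card_small_le g k m h1 I fun i hi => by
    simp only [I, Finset.mem_filter, Finset.mem_range] at hi; exact ⟨by omega, hi.2⟩
  have hJ := card_small_le (fun i => (g i).dual) k m h2 J fun i hi => by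
    simp only [J, Finset.mem_filter, Finset.mem_range] at hi; exact ⟨by omega, hi.2⟩
  -- `low` and the dual `low` are complementary, so one of them has at most half of the nodes.
  have hsub : Finset.range (k + 1) ⊆ I ∪ J := by
    intro i hi
    simp only [I, J, Finset.mem_union, Finset.mem_filter, hi, true_and]
    have hi' : i ≤ k := by simpa [Nat.lt_succ_iff] using hi
    have := Set.ncard_add_ncard_compl (g i).low
    rw [← dual_low (hz i hi'), Nat.card_eq_fintype_card] at this
    simp only [m]
    omega
  have h3 := Finset.card_le_card hsub
  have h4 := Finset.card_union_le I J
  rw [Finset.card_range] at h3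
  rw [show m = Fintype.card V / 2 from rfl] at hI hJ
  omega

end SignGame

/-! ## Potentials -/

/-- The sign of the pair `(x, y)` in the lexicographic order. -/
noncomputable def lexSign (x y : ℝ) : ℤ :=
  if x < 0 then -1 else if 0 < x then 1 else if y < 0 then -1 else if 0 < y then 1 else 0

theorem lexSign_neg {x y : ℝ} : lexSign x y < 0 ↔ x < 0 ∨ (x = 0 ∧ y < 0) := by
  unfold lexSign
  split_ifs <;> simp <;> grind

theorem lexSign_pos {x y : ℝ} : 0 < lexSign x y ↔ 0 < x ∨ (x = 0 ∧ 0 < y) := by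
  unfold lexSign
  split_ifs <;> simp <;> grind

theorem lexSign_zero {x y : ℝ} : lexSign x y = 0 ↔ x = 0 ∧ y = 0 := by
  unfold lexSign
  split_ifs <;> simp <;> grind

/-- Differences agree or lie beyond the threshold `B` on the same side. -/
def Compat {V : Type*} (B : ℝ) (p q : V → ℝ) : Prop :=
  ∀ a b, p b - p a = q b - q a ∨ (B ≤ p b - p a ∧ B ≤ q b - q a) ∨
    (p b - p a ≤ -B ∧ q b - q a ≤ -B)

theorem Compat.refl {V : Type*} (B : ℝ) (p : V → ℝ) : Compat B p p := fun _ _ => .inl rfl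

theorem Compat.trans {V : Type*} {B : ℝ} (hB : 0 < B) {p q r : V → ℝ} (h1 : Compat B p q)
    (h2 : Compat B q r) : Compat B p r := by
  intro a b
  rcases h1 a b with h | h | h <;> rcases h2 a b with h' | h' | h'
  · exact .inl (h.trans h')
  · exact .inr (.inl ⟨h ▸ h'.1, h'.2⟩)
  · exact .inr (.inr ⟨h ▸ h'.1, h'.2⟩)
  · exact .inr (.inl ⟨h.1, h' ▸ h.2⟩)
  · exact .inr (.inl ⟨h.1, h'.2⟩)
  · linarith [h.2, h'.1]
  · exact .inr (.inr ⟨h.1, h' ▸ h.2⟩)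
  · linarith [h.2, h'.1]
  · exact .inr (.inr ⟨h.1, h'.2⟩)

/-! ### Sign patterns from potentials: correctness and steps -/

namespace EnergyGame

open SignGame

variable {V : Type*} (G : EnergyGame V)

/-- The signs of the edges after the weights, extended by `1` in a second component, have been
modified by potentials. -/
noncomputable def pattern (p q : V → ℝ) : SignGame V where
  E a b := (a, b) ∈ G.edges
  mx a := a ∈ G.maxNodes
  s a b := lexSign (G.weight (a, b) + p b - p a) (1 + q b - q a)

variable {G} {p q : V → ℝ}

theorem sum_telescope (f : V → V → ℝ) (p : V → ℝ) (k : ℕ) (c : ℕ → V) (hc : c k = c 0) :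
    ∑ i ∈ Finset.range k, (f (c i) (c (i + 1)) + p (c (i + 1)) - p (c i)) =
      ∑ i ∈ Finset.range k, f (c i) (c (i + 1)) := by
  have h := Finset.sum_range_sub (fun i => p (c i)) k
  simp only [hc, sub_self] at h
  have : ∀ i, f (c i) (c (i + 1)) + p (c (i + 1)) - p (c i) =
      f (c i) (c (i + 1)) + (p (c (i + 1)) - p (c i)) := fun i => by ring
  simp only [this, Finset.sum_add_distrib, h, add_zero]

/-- The second components along a cycle add up to its length, which is not zero. -/
theorem pattern_noZeroCycle : (G.pattern p q).NoZeroCycle := by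
  intro k c hk hc hall
  have h := sum_telescope (fun _ _ => 1) q k c hc
  rw [Finset.sum_eq_zero] at h
  · rw [Finset.sum_const, Finset.card_range, nsmul_one] at h
    exact hk.ne' (by exact_mod_cast h.symm)
  · intro i hi
    exact (lexSign_zero.1 (hall i (Finset.mem_range.1 hi)).2).2

/-- Outside `low`, Max always has an edge of sign at least 0 that stays outside, and all edges of
Min are of this kind. The first components on any reachable cycle are then non-negative and
telescope to its weight. -/
theorem winsMax_of_not_mem_low (happ : (G.pattern p q).app = ∅) {v : V}
    (hv : v ∉ (G.pattern p q).low) : G.WinsMax v := by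
  classical
  have hno : ∀ a b, (a, b) ∈ G.edges → a ∉ (G.pattern p q).low → b ∈ (G.pattern p q).low →
      (G.pattern p q).s a b ≤ 0 := fun a b h1 h2 h3 => by
    by_contra hc
    have : (a, b) ∈ (G.pattern p q).app := ⟨h1, .inr ⟨h2, h3, not_le.1 hc⟩⟩
    simp [happ] at this
  have h1 : ∀ a ∈ G.maxNodes, a ∉ (G.pattern p q).low → ∃ b, (a, b) ∈ G.edges ∧
      b ∉ (G.pattern p q).low ∧ 0 ≤ (G.pattern p q).s a b := by
    intro a hm ha
    by_contra! hc
    refine ha (mem_low_mx hm fun b hb => ?_)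
    by_cases hbl : b ∈ (G.pattern p q).low
    · have := hno a b hb ha hbl
      rcases this.lt_or_eq with h | h
      · exact .inl h
      · exact .inr ⟨h, hbl⟩
    · exact .inl (hc b hb hbl)
  have h2 : ∀ a b, a ∉ G.maxNodes → a ∉ (G.pattern p q).low → (a, b) ∈ G.edges →
      b ∉ (G.pattern p q).low ∧ 0 ≤ (G.pattern p q).s a b := by
    intro a b hm ha hb
    have h0 : 0 ≤ (G.pattern p q).s a b := by
      by_contra hc
      exact ha (mem_low_mn hm hb (.inl (not_le.1 hc)))
    refine ⟨fun hbl => ha (mem_low_mn hm hb (.inr ⟨?_, hbl⟩)), h0⟩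
    exact le_antisymm (hno a b hb ha hbl) h0
  let σ : V → V := fun a =>
    if h : a ∈ G.maxNodes ∧ a ∉ (G.pattern p q).low then (h1 a h.1 h.2).choose
    else (G.exists_out a).choose
  have hσ : ∀ a b, G.Consistent σ a b → a ∉ (G.pattern p q).low →
      b ∉ (G.pattern p q).low ∧ 0 ≤ (G.pattern p q).s a b := by
    intro a b hab ha
    by_cases hm : a ∈ G.maxNodes
    · have h3 := (h1 a hm ha).choose_spec
      have h4 : b = (h1 a hm ha).choose := by
        rw [hab.2 hm]; simp only [σ]; rw [dif_pos ⟨hm, ha⟩]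
      rw [h4]; exact h3.2
    · exact h2 a b hm ha hab.1
  refine ⟨σ, fun a ha => ?_, fun k c hc hr => ?_⟩
  · by_cases h : a ∉ (G.pattern p q).low
    · simp only [σ]; rw [dif_pos ⟨ha, h⟩]; exact (h1 a ha h).choose_spec.1
    · simp only [σ]; rw [dif_neg fun h' => h h'.2]; exact (G.exists_out a).choose_spec
  · have h0 : c 0 ∉ (G.pattern p q).low := by
      generalize c 0 = x at hr
      induction hr with
      | refl => exact hv
      | tail _ h ih => exact (hσ _ _ h ih).1
    have hi : ∀ i ≤ k, c i ∉ (G.pattern p q).low := by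
      intro i
      induction i with
      | zero => exact fun _ => h0
      | succ i ih => exact fun h => (hσ _ _ (hc.2.2 i (by omega)) (ih (by omega))).1
    have hs := sum_telescope (fun a b => G.weight (a, b)) p k c hc.2.1
    rw [cycleWeight, ← hs]
    refine Finset.sum_nonneg fun i hik => ?_
    have hik' := Finset.mem_range.1 hik
    have := (hσ _ _ (hc.2.2 i hik') (hi i hik'.le)).2
    by_contra hlt
    exact absurd (lexSign_neg.2 (.inl (not_le.1 hlt))) (not_lt.2 this)

/-- Against any fixed strategy of Max, Min can stay in `low` on edges of sign at most 0 and thus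
closes a cycle there. It remains to exclude that this cycle has weight zero. -/
theorem not_winsMax_of_mem_low [Finite V] (happ : (G.pattern p q).app = ∅) {v : V}
    (hv : v ∈ (G.pattern p q).low) : ¬ G.WinsMax v := by
  rintro ⟨σ, hσ, hcyc⟩
  have hno : ∀ a b, (a, b) ∈ G.edges → a ∈ (G.pattern p q).low → b ∉ (G.pattern p q).low →
      0 ≤ (G.pattern p q).s a b := fun a b h1 h2 h3 => by
    by_contra hc
    have : (a, b) ∈ (G.pattern p q).app := ⟨h1, .inl ⟨h2, h3, not_le.1 hc⟩⟩
    simp [happ] at this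
  have next : ∀ a : {a // a ∈ (G.pattern p q).low}, ∃ b : {a // a ∈ (G.pattern p q).low},
      G.Consistent σ a b ∧ (G.pattern p q).s a b ≤ 0 := by
    rintro ⟨a, ha⟩
    have fin : ∀ b, (a, b) ∈ G.edges →
        ((G.pattern p q).s a b < 0 ∨ ((G.pattern p q).s a b = 0 ∧ b ∈ (G.pattern p q).low)) →
        b ∈ (G.pattern p q).low ∧ (G.pattern p q).s a b ≤ 0 := by
      intro b hb h
      rcases h with h | h
      · refine ⟨?_, h.le⟩
        by_contra hc
        exact absurd (hno a b hb ha hc) (not_le.2 h)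
      · exact ⟨h.2, h.1.le⟩
    by_cases hm : a ∈ G.maxNodes
    · have h3 := fin _ (hσ a hm) (low_mx ha hm _ (hσ a hm))
      exact ⟨⟨σ a, h3.1⟩, ⟨hσ a hm, fun _ => rfl⟩, h3.2⟩
    · obtain ⟨b, hb, h⟩ := low_mn ha hm
      have h3 := fin b hb h
      exact ⟨⟨b, h3.1⟩, ⟨hb, fun h => absurd h hm⟩, h3.2⟩
  choose f hf using next
  have hreach : ∀ i, Relation.ReflTransGen (G.Consistent σ) v (f^[i] ⟨v, hv⟩).1 := by
    intro i
    induction i with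
    | zero => exact .refl
    | succ i ih =>
      rw [Function.iterate_succ_apply']
      exact ih.tail (hf _).1
  obtain ⟨i, j, hij, he⟩ := Finite.exists_ne_map_eq_of_infinite (fun i : ℕ => f^[i] ⟨v, hv⟩)
  wlog hlt : i < j generalizing i j
  · exact this j i hij.symm he.symm (lt_of_le_of_ne (not_lt.1 hlt) hij.symm)
  have he' : f^[i] ⟨v, hv⟩ = f^[j] ⟨v, hv⟩ := he
  let c : ℕ → V := fun t => (f^[i + t] ⟨v, hv⟩).1
  have hstep : ∀ t, G.Consistent σ (c t) (c (t + 1)) ∧ (G.pattern p q).s (c t) (c (t + 1)) ≤ 0 := by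
    intro t
    have := hf (f^[i + t] ⟨v, hv⟩)
    rwa [← Function.iterate_succ_apply' f] at this
  have hc0 : c (j - i) = c 0 := by
    simp only [c]
    rw [Nat.add_sub_cancel' hlt.le, ← he']; rfl
  have hw := hcyc (j - i) c ⟨by omega, hc0, fun t _ => (hstep t).1⟩ (hreach i)
  have hs1 := sum_telescope (fun a b => G.weight (a, b)) p (j - i) c hc0
  have hs2 := sum_telescope (fun _ _ => 1) q (j - i) c hc0
  rw [cycleWeight, ← hs1] at hw
  have hle : ∀ t ∈ Finset.range (j - i),
      G.weight (c t, c (t + 1)) + p (c (t + 1)) - p (c t) ≤ 0 := by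
    intro t _
    by_contra hlt
    exact absurd (lexSign_pos.2 (.inl (not_le.1 hlt))) (not_lt.2 (hstep t).2)
  -- The sum of non-positive first components is non-negative, so all of them vanish. Then all
  -- second components are non-positive, but they add up to the length of the cycle.
  have h0 := (Finset.sum_eq_zero_iff_of_nonpos hle).1 (le_antisymm (Finset.sum_nonpos hle) hw)
  have hle2 : ∀ t ∈ Finset.range (j - i), 1 + q (c (t + 1)) - q (c t) ≤ 0 := by
    intro t ht
    by_contra hlt
    exact absurd (lexSign_pos.2 (.inr ⟨h0 t ht, not_le.1 hlt⟩)) (not_lt.2 (hstep t).2)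
  have := Finset.sum_nonpos hle2
  rw [hs2] at this
  simp at this
  omega

theorem winsMax_iff [Finite V] (happ : (G.pattern p q).app = ∅) (v : V) :
    G.WinsMax v ↔ v ∉ (G.pattern p q).low :=
  ⟨fun h hl => not_winsMax_of_mem_low happ hl h, winsMax_of_not_mem_low happ⟩

/-- `p'` arises from `p` by raising the complement of `S` by `d` relative to `S`. -/
def Shift (S : Set V) (d : ℝ) (p p' : V → ℝ) : Prop :=
  (∀ a b, (a ∈ S ↔ b ∈ S) → p' b - p' a = p b - p a) ∧
  ∀ a b, a ∈ S → b ∉ S → p' b - p' a = p b - p a + d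

/-- Where the potential differences do not agree, they lie beyond the threshold on the same side and
outweigh the weight of the edge. The threshold 2 for `q` outweighs the constant weight 1. -/
theorem pattern_s_eq {B : ℝ} {p' q' : V → ℝ} (hp : Compat B p p') (hq : Compat 2 q q') {a b : V}
    (hw : |G.weight (a, b)| < B) : (G.pattern p' q').s a b = (G.pattern p q).s a b := by
  have hw' := abs_lt.1 hw
  simp only [pattern, lexSign]
  rcases hp a b with h | ⟨h1, h2⟩ | ⟨h1, h2⟩
  · have e1 : G.weight (a, b) + p' b - p' a = G.weight (a, b) + p b - p a := by linarith
    rw [e1]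
    rcases hq a b with h | ⟨h1, h2⟩ | ⟨h1, h2⟩
    · rw [show 1 + q' b - q' a = 1 + q b - q a by linarith]
    · rw [if_neg (show ¬ 1 + q' b - q' a < 0 by linarith), if_pos (show 0 < 1 + q' b - q' a by linarith),
        if_neg (show ¬ 1 + q b - q a < 0 by linarith), if_pos (show 0 < 1 + q b - q a by linarith)]
    · rw [if_pos (show 1 + q' b - q' a < 0 by linarith), if_pos (show 1 + q b - q a < 0 by linarith)]
  · rw [if_neg (by linarith), if_pos (by linarith), if_neg (by linarith), if_pos (by linarith)]
  · rw [if_pos (by linarith), if_pos (by linarith)]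

/-- The size of the modified weight of an edge, with respect to the lexicographic order. -/
noncomputable def absCost (G : EnergyGame V) (p q : V → ℝ) (a b : V) : ℝ × ℝ :=
  if (G.pattern p q).s a b < 0 then
    (-(G.weight (a, b) + p b - p a), -(1 + q b - q a))
  else (G.weight (a, b) + p b - p a, 1 + q b - q a)

/-- One step: the potentials of the complement of `low` are raised by the size of the smallest
approaching edge, and then changed without an effect on signs. -/
structure Step (G : EnergyGame V) (p q p' q' : V → ℝ) : Prop where
  exists_shift : ∃ (B : ℝ) (e : V × V) (p₁ q₁ : V → ℝ), e ∈ (G.pattern p q).app ∧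
    (∀ e' ∈ (G.pattern p q).app, (G.absCost p q e.1 e.2).1 < (G.absCost p q e'.1 e'.2).1 ∨
      ((G.absCost p q e.1 e.2).1 = (G.absCost p q e'.1 e'.2).1 ∧
        (G.absCost p q e.1 e.2).2 ≤ (G.absCost p q e'.1 e'.2).2)) ∧
    Shift (G.pattern p q).low (G.absCost p q e.1 e.2).1 p p₁ ∧
    Shift (G.pattern p q).low (G.absCost p q e.1 e.2).2 q q₁ ∧
    Compat B p₁ p' ∧ Compat 2 q₁ q' ∧ ∀ e ∈ G.edges, |G.weight e| < B

theorem absCost_pos {a b : V} (h : (G.pattern p q).s a b ≠ 0) :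
    0 < (G.absCost p q a b).1 ∨ ((G.absCost p q a b).1 = 0 ∧ 0 < (G.absCost p q a b).2) := by
  unfold absCost
  split_ifs with h1
  · rcases lexSign_neg.1 h1 with h | h
    · left; simp only; linarith
    · right; simp only; constructor <;> linarith
  · exact lexSign_pos.1 (lt_of_le_of_ne (not_lt.1 h1) h.symm)

/-- The shift adds the size of `e` to edges from `low` to the complement and subtracts it from edges
back. By minimality of `e` no approaching edge is carried past zero, and `e` itself lands on zero.
The later change of potentials is invisible to signs. -/
theorem Step.tr {p' q' : V → ℝ} (h : G.Step p q p' q') :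
    (G.pattern p q).Tr (G.pattern p' q').s ∧
      ∃ e ∈ (G.pattern p q).app, (G.pattern p' q').s e.1 e.2 = 0 := by
  obtain ⟨B, e, p₁, q₁, he, hmin, hp1, hq1, hp, hq, hB⟩ := h.exists_shift
  have hs : ∀ a b, (a, b) ∈ G.edges → (G.pattern p' q').s a b = (G.pattern p₁ q₁).s a b :=
    fun a b hab => pattern_s_eq hp hq (hB _ hab)
  have hpos := absCost_pos (G := G) (p := p) (q := q) (a := e.1) (b := e.2) (by
    rcases he.2 with h | h <;> omega)
  generalize hd1 : (G.absCost p q e.1 e.2).1 = d1 at *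
  generalize hd2 : (G.absCost p q e.1 e.2).2 = d2 at *
  have up : ∀ a b, a ∈ (G.pattern p q).low → b ∉ (G.pattern p q).low →
      (G.pattern p₁ q₁).s a b = lexSign (G.weight (a, b) + p b - p a + d1) (1 + q b - q a + d2) := by
    intro a b ha hb
    have h1 := hp1.2 a b ha hb
    have h2 := hq1.2 a b ha hb
    simp only [pattern]
    congr 1 <;> linarith
  have down : ∀ a b, a ∉ (G.pattern p q).low → b ∈ (G.pattern p q).low →
      (G.pattern p₁ q₁).s a b = lexSign (G.weight (a, b) + p b - p a - d1) (1 + q b - q a - d2) := by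
    intro a b ha hb
    have h1 := hp1.2 b a hb ha
    have h2 := hq1.2 b a hb ha
    simp only [pattern]
    congr 1 <;> linarith
  refine ⟨⟨?_, ?_, ?_, ?_, ?_⟩, e, he, ?_⟩
  · intro a b hab hiff
    rw [hs a b hab]
    have h1 := hp1.1 a b hiff
    have h2 := hq1.1 a b hiff
    simp only [pattern]
    congr 1 <;> linarith
  · intro a b hab ha hb hneg
    rw [hs a b hab, up a b ha hb]
    have h1 := hmin (a, b) ⟨hab, .inl ⟨ha, hb, hneg⟩⟩
    simp only [absCost, if_pos hneg] at h1
    by_contra hc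
    rcases lexSign_pos.1 (not_le.1 hc) with h | h <;> rcases h1 with h1 | h1 <;> linarith
  · intro a b hab ha hb hnn
    rw [hs a b hab, up a b ha hb, lexSign_pos]
    have h1 : ¬ _ := fun h => absurd (lexSign_neg.2 h) (not_lt.2 hnn)
    push Not at h1
    rcases hpos with h | h
    · left; linarith
    · rcases h1.1.lt_or_eq with h2 | h2
      · left; linarith
      · right; constructor
        · linarith
        · linarith [h1.2 h2.symm]
  · intro a b hab ha hb hps
    rw [hs a b hab, down a b ha hb]
    have h1 := hmin (a, b) ⟨hab, .inr ⟨ha, hb, hps⟩⟩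
    simp only [absCost, if_neg (not_lt.2 hps.le)] at h1
    by_contra hc
    rcases lexSign_neg.1 (not_le.1 hc) with h | h <;> rcases h1 with h1 | h1 <;> linarith
  · intro a b hab ha hb hnp
    rw [hs a b hab, down a b ha hb, lexSign_neg]
    have h1 : ¬ _ := fun h => absurd (lexSign_pos.2 h) (not_lt.2 hnp)
    push Not at h1
    rcases hpos with h | h
    · left; linarith
    · rcases h1.1.lt_or_eq with h2 | h2
      · left; linarith
      · right; constructor
        · linarith
        · linarith [h1.2 h2]
  · rw [hs _ _ he.1]
    rcases he.2 with ⟨ha, hb, h⟩ | ⟨ha, hb, h⟩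
    · rw [up _ _ ha hb, lexSign_zero]
      simp only [absCost, if_pos h] at hd1 hd2
      constructor <;> linarith
    · rw [down _ _ ha hb, lexSign_zero]
      simp only [absCost, if_neg (not_lt.2 h.le)] at hd1 hd2
      constructor <;> linarith

/-- The number of steps. -/
theorem step_length_le [Fintype V] (p q : ℕ → V → ℝ) (k : ℕ)
    (h : ∀ i < k, G.Step (p i) (q i) (p (i + 1)) (q (i + 1))) :
    k + 1 ≤ 2 * ((Fintype.card V + 1) ^ 2 * 2 ^ (Fintype.card V / 2 + 1) *
      (Fintype.card V ^ 2 + 1)) :=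
  SignGame.length_le (fun i => G.pattern (p i) (q i)) k (fun _ _ => pattern_noZeroCycle)
    fun i hi => ⟨_, rfl, (h i hi).tr.1, (h i hi).tr.2⟩

end EnergyGame

/-! ## Structured programs -/

namespace RealRAM

@[simp] theorem Mem.setVar_var (m : Mem) (x v y : ℕ) :
    (m.setVar x v).var y = if y = x then v else m.var y := by
  simp [Mem.setVar, Function.update_apply]

@[simp] theorem Mem.setVar_nat (m : Mem) (x v : ℕ) : (m.setVar x v).nat = m.nat := rfl

@[simp] theorem Mem.setVar_real (m : Mem) (x v : ℕ) : (m.setVar x v).real = m.real := rfl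

@[simp] theorem Mem.setNat_var (m : Mem) (a i v : ℕ) : (m.setNat a i v).var = m.var := rfl

@[simp] theorem Mem.setNat_real (m : Mem) (a i v : ℕ) : (m.setNat a i v).real = m.real := rfl

@[simp] theorem Mem.setNat_nat (m : Mem) (a i v b j : ℕ) :
    (m.setNat a i v).nat b j = if b = a then (if j = i then v else m.nat b j) else m.nat b j := by
  simp only [Mem.setNat, Function.update_apply]
  split_ifs with h1 h2
  · simp [h2]
  · subst h1; simp [h2]
  · rfl

@[simp] theorem Mem.setReal_var (m : Mem) (a i : ℕ) (r : ℝ) : (m.setReal a i r).var = m.var := rfl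

@[simp] theorem Mem.setReal_nat (m : Mem) (a i : ℕ) (r : ℝ) : (m.setReal a i r).nat = m.nat := rfl

@[simp] theorem Mem.setReal_real (m : Mem) (a i : ℕ) (r : ℝ) (b j : ℕ) :
    (m.setReal a i r).real b j =
      if b = a then (if j = i then r else m.real b j) else m.real b j := by
  simp only [Mem.setReal, Function.update_apply]
  split_ifs with h1 h2
  · simp [h2]
  · subst h1; simp [h2]
  · rfl

/-- Timed executions of a program from a memory to another one, in which all memories after the
first one satisfy `I`. -/
inductive Exec (I : Mem → Prop) : Prog → Mem → Mem → ℕ → Prop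
  | skip (m) : Exec I .skip m m 1
  | op (i m) : I (i.exec m) → Exec I (.op i) m (i.exec m) 1
  | seq {p q m m₁ m₂ s t} : Exec I p m m₁ s → Exec I q m₁ m₂ t →
      Exec I (.seq p q) m m₂ (1 + (s + t))
  | ite_true {c p q m m₁ t} : c.Holds m → Exec I p m m₁ t → Exec I (.ite c p q) m m₁ (1 + t)
  | ite_false {c p q m m₁ t} : ¬ c.Holds m → Exec I q m m₁ t → Exec I (.ite c p q) m m₁ (1 + t)
  | loop_done {c p m} : ¬ c.Holds m → Exec I (.loop c p) m m 1
  | loop_step {c p m m₁ m₂ s t} : c.Holds m → Exec I p m m₁ s → Exec I (.loop c p) m₁ m₂ t →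
      Exec I (.loop c p) m m₂ (1 + (s + t))

theorem steps_add {I : Mem → Prop} {c c₁ c₂ : Config} {s t : ℕ}
    (h1 : step^[s] c = c₁ ∧ ∀ u ≤ s, I (step^[u] c).mem)
    (h2 : step^[t] c₁ = c₂ ∧ ∀ u ≤ t, I (step^[u] c₁).mem) :
    step^[s + t] c = c₂ ∧ ∀ u ≤ s + t, I (step^[u] c).mem := by
  refine ⟨by rw [Nat.add_comm, Function.iterate_add_apply, h1.1, h2.1], fun u hu => ?_⟩
  rcases le_total u s with h | h
  · exact h1.2 u h
  · obtain ⟨v, rfl⟩ := Nat.exists_eq_add_of_le h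
    rw [Nat.add_comm, Function.iterate_add_apply, h1.1]
    exact h2.2 v (by omega)

theorem steps_one {I : Mem → Prop} {c c₁ : Config} (h : step c = c₁) (h0 : I c.mem)
    (h1 : I c₁.mem) : step^[1] c = c₁ ∧ ∀ u ≤ 1, I (step^[u] c).mem := by
  refine ⟨h, fun u hu => ?_⟩
  interval_cases u
  · exact h0
  · simpa [h] using h1

theorem Exec.safe {I : Mem → Prop} {p : Prog} {m m' : Mem} {t : ℕ} (h : Exec I p m m' t)
    (hm : I m) : I m' := by
  induction h with
  | skip => exact hm
  | op _ _ h => exact h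
  | seq _ _ ih1 ih2 => exact ih2 (ih1 hm)
  | ite_true _ _ ih => exact ih hm
  | ite_false _ _ ih => exact ih hm
  | loop_done => exact hm
  | loop_step _ _ _ ih1 ih2 => exact ih2 (ih1 hm)

/-- Only instructions change the memory, so the invariant that `Exec` records after each of them
holds after every single machine step. -/
theorem Exec.steps {I : Mem → Prop} {p : Prog} {m m' : Mem} {t : ℕ} (h : Exec I p m m' t)
    (hm : I m) (K : List Prog) : step^[t] ⟨p :: K, m⟩ = ⟨K, m'⟩ ∧
      ∀ u ≤ t, I (step^[u] ⟨p :: K, m⟩).mem := by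
  induction h generalizing K with
  | skip m => exact steps_one (by simp [step]) hm hm
  | op i m h => exact steps_one (by simp [step]) hm h
  | @seq p q m _ _ _ _ h1 h2 ih1 ih2 =>
    exact steps_add (steps_one (c₁ := ⟨p :: q :: K, m⟩) (by simp [step]) hm hm)
      (steps_add (ih1 hm _) (ih2 (h1.safe hm) _))
  | @ite_true c p q m _ _ hc h1 ih =>
    exact steps_add (steps_one (c₁ := ⟨p :: K, m⟩) (by simp [step, hc]) hm hm) (ih hm _)
  | @ite_false c p q m _ _ hc h1 ih =>
    exact steps_add (steps_one (c₁ := ⟨q :: K, m⟩) (by simp [step, hc]) hm hm) (ih hm _)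
  | loop_done hc => exact steps_one (by simp [step, hc]) hm hm
  | @loop_step c p m _ _ _ _ hc h1 h2 ih1 ih2 =>
    exact steps_add (steps_one (c₁ := ⟨p :: .loop c p :: K, m⟩) (by simp [step, hc]) hm hm)
      (steps_add (ih1 hm _) (ih2 (h1.safe hm) _))

/-- Programs whose only loops are counting loops up to variable `0`; variable `1` holds the
constant `1`. -/
inductive Code where
  | skip
  | op (i : Instr)
  | seq (p q : Code)
  | ite (t : Test) (p q : Code)
  | rep (i : ℕ) (p : Code)

namespace Code

/-- The program of the machine. -/
def toProg : Code → Prog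
  | skip => .skip
  | op i => .op i
  | seq p q => .seq p.toProg q.toProg
  | ite t p q => .ite t p.toProg q.toProg
  -- Only the test `≤` exists, so the loop has an extra round at count `n` in which the body is
  -- skipped. The counter ends at `n + 1`.
  | rep i p => .seq (.op (.const i 0))
      (.loop (.le i 0) (.seq (.ite (.le 0 i) .skip p.toProg) (.op (.add i i 1))))

/-- A bound on the running time if variable `0` is `n`. -/
def cost (n : ℕ) : Code → ℕ
  | skip => 1
  | op _ => 1
  | seq p q => 1 + (p.cost n + q.cost n)
  | ite _ p q => 1 + (p.cost n + q.cost n)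
  | rep _ p => (n + 2) * (p.cost n + 6)

end Code

/-- The instruction may write the variable `x`. -/
def Instr.wv (x : ℕ) : Instr → Bool
  | .const y _ => y == x
  | .add y _ _ => y == x
  | .sub y _ _ => y == x
  | .mul y _ _ => y == x
  | .load y _ _ => y == x
  | _ => false

/-- The instruction may write the integer array `a`. -/
def Instr.wn (a : ℕ) : Instr → Bool
  | .store b _ _ => b == a
  | _ => false

/-- The instruction may write the real array `a`. -/
def Instr.wr (a : ℕ) : Instr → Bool
  | .rone b _ => b == a
  | .rcopy b _ _ _ => b == a
  | .radd b _ _ _ _ _ => b == a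
  | .rsub b _ _ _ _ _ => b == a
  | _ => false

/-- All written names and constants are small. -/
def Instr.small : Instr → Bool
  | .const y k => decide (y < 50) && decide (k < 50)
  | .add y _ _ => decide (y < 50)
  | .sub y _ _ => decide (y < 50)
  | .mul y _ _ => decide (y < 50)
  | .load y _ _ => decide (y < 50)
  | .store b _ _ => decide (b < 50)
  | .rone b _ => decide (b < 50)
  | .rcopy b _ _ _ => decide (b < 50)
  | .radd b _ _ _ _ _ => decide (b < 50)
  | .rsub b _ _ _ _ _ => decide (b < 50)

namespace Code

/-- The program may write the variable `x`. -/
def wv (x : ℕ) : Code → Bool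
  | skip => false
  | op i => i.wv x
  | seq p q => p.wv x || q.wv x
  | ite _ p q => p.wv x || q.wv x
  | rep i p => i == x || p.wv x

/-- The program may write the integer array `a`. -/
def wn (a : ℕ) : Code → Bool
  | skip => false
  | op i => i.wn a
  | seq p q => p.wn a || q.wn a
  | ite _ p q => p.wn a || q.wn a
  | rep _ p => p.wn a

/-- The program may write the real array `a`. -/
def wr (a : ℕ) : Code → Bool
  | skip => false
  | op i => i.wr a
  | seq p q => p.wr a || q.wr a
  | ite _ p q => p.wr a || q.wr a
  | rep _ p => p.wr a

/-- Written names and constants are small, loop variables are not written in the loop, and the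
variables `0` and `1` are not written. -/
def wf : Code → Bool
  | skip => true
  | op i => i.small && !i.wv 0 && !i.wv 1
  | seq p q => p.wf && q.wf
  | ite _ p q => p.wf && q.wf
  | rep i p => p.wf && !p.wv i && decide (i < 50) && decide (1 < i)

/-- The memory has changed only where the program may write. -/
structure Frame (p : Code) (m m' : Mem) : Prop where
  var : ∀ x, p.wv x = false → m'.var x = m.var x
  nat : ∀ a, p.wn a = false → m'.nat a = m.nat a
  real : ∀ a, p.wr a = false → m'.real a = m.real a

theorem Frame.refl (p : Code) (m : Mem) : p.Frame m m := ⟨fun _ _ => rfl, fun _ _ => rfl,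
  fun _ _ => rfl⟩

theorem Frame.trans {p : Code} {m m₁ m₂ : Mem} (h1 : p.Frame m m₁) (h2 : p.Frame m₁ m₂) :
    p.Frame m m₂ :=
  ⟨fun x h => (h2.var x h).trans (h1.var x h), fun x h => (h2.nat x h).trans (h1.nat x h),
    fun x h => (h2.real x h).trans (h1.real x h)⟩

theorem Frame.mono {p q : Code} {m m' : Mem} (h : p.Frame m m')
    (hv : ∀ x, q.wv x = false → p.wv x = false) (hn : ∀ x, q.wn x = false → p.wn x = false)
    (hr : ∀ x, q.wr x = false → p.wr x = false) : q.Frame m m' :=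
  ⟨fun x hx => h.var x (hv x hx), fun x hx => h.nat x (hn x hx), fun x hx => h.real x (hr x hx)⟩

theorem Frame.op (i : Instr) (m : Mem) : (op i).Frame m (i.exec m) := by
  constructor
  · intro x hx
    cases i <;> simp_all [wv, Instr.wv, Instr.exec] <;> exact fun h => absurd h.symm hx
  · intro a ha
    funext j
    cases i <;> simp_all [wn, Instr.wn, Instr.exec]
    exact fun h => absurd h.symm ha
  · intro a ha
    funext j
    cases i <;> simp_all [wr, Instr.wr, Instr.exec] <;> exact fun h => absurd h.symm ha

end Code

/-- The limits on the contents of the memory: integers are bounded by `S`, real numbers lie in `H`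
and are bounded by `M`. -/
structure Safe (S : ℕ) (H : AddSubgroup ℝ) (M : ℝ) (m : Mem) : Prop where
  var_le : ∀ x, m.var x ≤ S
  nat_le : ∀ a i, m.nat a i ≤ S
  var_zero : ∀ x, S < x → m.var x = 0
  nat_zero : ∀ a i, S < a ∨ S < i → m.nat a i = 0
  real_zero : ∀ a i, S < a ∨ S < i → m.real a i = 0
  real_mem : ∀ a i, m.real a i ∈ H
  real_le : ∀ a i, |m.real a i| ≤ M

/-- The values that an instruction computes respect the limits. -/
def Instr.ok (S : ℕ) (M : ℝ) (m : Mem) : Instr → Prop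
  | .add _ y z => m.var y + m.var z ≤ S
  | .mul _ y z => m.var y * m.var z ≤ S
  | .radd _ _ b j c k => |m.real b (m.var j) + m.real c (m.var k)| ≤ M
  | .rsub _ _ b j c k => |m.real b (m.var j) - m.real c (m.var k)| ≤ M
  | _ => True

section Safety

variable {S : ℕ} {H : AddSubgroup ℝ} {M : ℝ} {m : Mem}

theorem Safe.setVar (h : Safe S H M m) {x v : ℕ} (hx : x ≤ S) (hv : v ≤ S) :
    Safe S H M (m.setVar x v) where
  var_le y := by simp only [Mem.setVar_var]; split_ifs; exacts [hv, h.var_le y]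
  nat_le := h.nat_le
  var_zero y hy := by
    simp only [Mem.setVar_var]; rw [if_neg (by omega)]; exact h.var_zero y hy
  nat_zero := h.nat_zero
  real_zero := h.real_zero
  real_mem := h.real_mem
  real_le := h.real_le

theorem Safe.setNat (h : Safe S H M m) {a i v : ℕ} (ha : a ≤ S) (hi : i ≤ S) (hv : v ≤ S) :
    Safe S H M (m.setNat a i v) where
  var_le := h.var_le
  nat_le b j := by simp only [Mem.setNat_nat]; split_ifs; exacts [hv, h.nat_le b j, h.nat_le b j]
  var_zero := h.var_zero
  nat_zero b j hb := by
    simp only [Mem.setNat_nat]; split_ifs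
    · omega
    · exact h.nat_zero b j hb
    · exact h.nat_zero b j hb
  real_zero := h.real_zero
  real_mem := h.real_mem
  real_le := h.real_le

theorem Safe.setReal (h : Safe S H M m) {a i : ℕ} {r : ℝ} (ha : a ≤ S) (hi : i ≤ S) (hr : r ∈ H)
    (hr' : |r| ≤ M) : Safe S H M (m.setReal a i r) where
  var_le := h.var_le
  nat_le := h.nat_le
  var_zero := h.var_zero
  nat_zero := h.nat_zero
  real_zero b j hb := by
    simp only [Mem.setReal_real]; split_ifs
    · omega
    · exact h.real_zero b j hb
    · exact h.real_zero b j hb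
  real_mem b j := by
    simp only [Mem.setReal_real]; split_ifs; exacts [hr, h.real_mem b j, h.real_mem b j]
  real_le b j := by
    simp only [Mem.setReal_real]; split_ifs; exacts [hr', h.real_le b j, h.real_le b j]

theorem Safe.exec (h : Safe S H M m) (hS : 50 ≤ S) (h1 : 1 ∈ H) (hM : 1 ≤ M) {i : Instr}
    (hi : i.small = true) (hok : i.ok S M m) : Safe S H M (i.exec m) := by
  cases i <;> simp only [Instr.small, Bool.and_eq_true, decide_eq_true_eq] at hi <;>
    simp only [Instr.ok] at hok <;> simp only [Instr.exec]
  · exact h.setVar (by omega) (by omega)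
  · exact h.setVar (by omega) hok
  · exact h.setVar (by omega) ((Nat.sub_le _ _).trans (h.var_le _))
  · exact h.setVar (by omega) hok
  · exact h.setVar (by omega) (h.nat_le _ _)
  · exact h.setNat (by omega) (h.var_le _) (h.var_le _)
  · exact h.setReal (by omega) (h.var_le _) h1 (by simpa using hM)
  · exact h.setReal (by omega) (h.var_le _) (h.real_mem _ _) (h.real_le _ _)
  · exact h.setReal (by omega) (h.var_le _) (H.add_mem (h.real_mem _ _) (h.real_mem _ _)) hok
  · exact h.setReal (by omega) (h.var_le _) (H.sub_mem (h.real_mem _ _) (h.real_mem _ _)) hok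

end Safety

/-! ### Weakest preconditions for programs with counting loops -/

namespace Code

/-- The weakest precondition of `r` more rounds of a counting loop with body `f` that has arrived
at the count `k`. -/
def wpIter (f : (Mem → Prop) → Mem → Prop) (i : ℕ) (Q : Mem → Prop) : ℕ → ℕ → Mem → Prop
  | 0, k => fun m => Q (m.setVar i (k + 1))
  | r + 1, k => f fun m => wpIter f i Q r (k + 1) (m.setVar i (k + 1))

/-- The weakest precondition for the program, started with variable `0` equal to `n`, to respect
the limits and to end in `Q`. -/
def wp (n S : ℕ) (M : ℝ) : Code → (Mem → Prop) → Mem → Prop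
  | skip, Q, m => Q m
  | op i, Q, m => i.ok S M m ∧ Q (i.exec m)
  | seq p q, Q, m => p.wp n S M (q.wp n S M Q) m
  | ite t p q, Q, m => (t.Holds m → p.wp n S M Q m) ∧ (¬ t.Holds m → q.wp n S M Q m)
  | rep i p, Q, m => wpIter (p.wp n S M) i Q n 0 (m.setVar i 0)

variable {n S : ℕ} {M : ℝ} {H : AddSubgroup ℝ}

theorem wpIter_mono {f : (Mem → Prop) → Mem → Prop} {i : ℕ}
    (hf : ∀ Q Q' : Mem → Prop, (∀ m, Q m → Q' m) → ∀ m, f Q m → f Q' m) {Q Q' : Mem → Prop}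
    (h : ∀ m, Q m → Q' m) (r k : ℕ) (m : Mem) (hm : wpIter f i Q r k m) :
    wpIter f i Q' r k m := by
  induction r generalizing k m with
  | zero => exact h _ hm
  | succ r ih => exact hf _ _ (fun m' hm' => ih _ _ hm') _ hm

theorem wp_mono (p : Code) {Q Q' : Mem → Prop} (h : ∀ m, Q m → Q' m) (m : Mem)
    (hm : p.wp n S M Q m) : p.wp n S M Q' m := by
  induction p generalizing Q Q' m with
  | skip => exact h _ hm
  | op i => exact ⟨hm.1, h _ hm.2⟩
  | seq p q ihp ihq => exact ihp (fun m' hm' => ihq h m' hm') m hm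
  | ite t p q ihp ihq => exact ⟨fun ht => ihp h m (hm.1 ht), fun ht => ihq h m (hm.2 ht)⟩
  | rep i p ih => exact wpIter_mono (fun _ _ h' m' => ih h' m') h _ _ _ hm

theorem Frame.setVar_rep {i v : ℕ} {p : Code} {m m' : Mem} (h : (rep i p).Frame m m') :
    (rep i p).Frame m (m'.setVar i v) := by
  refine ⟨fun x hx => ?_, h.nat, h.real⟩
  have : x ≠ i := by rintro rfl; simp [wv] at hx
  simp [this, h.var x hx]

theorem Frame.body {i : ℕ} {p : Code} {m m' : Mem} (h : p.Frame m m') : (rep i p).Frame m m' :=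
  h.mono (fun x hx => by simp [wv] at hx; exact hx.2) (fun _ hx => hx) (fun _ hx => hx)

theorem Frame.seq_left {p q : Code} {m m' : Mem} (h : p.Frame m m') : (seq p q).Frame m m' :=
  h.mono (by simp +contextual [wv]) (by simp +contextual [wn]) (by simp +contextual [wr])

theorem Frame.seq_right {p q : Code} {m m' : Mem} (h : q.Frame m m') : (seq p q).Frame m m' :=
  h.mono (by simp +contextual [wv]) (by simp +contextual [wn]) (by simp +contextual [wr])

theorem Frame.ite_left {t : Test} {p q : Code} {m m' : Mem} (h : p.Frame m m') :
    (ite t p q).Frame m m' :=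
  h.mono (by simp +contextual [wv]) (by simp +contextual [wn]) (by simp +contextual [wr])

theorem Frame.ite_right {t : Test} {p q : Code} {m m' : Mem} (h : q.Frame m m') :
    (ite t p q).Frame m m' :=
  h.mono (by simp +contextual [wv]) (by simp +contextual [wn]) (by simp +contextual [wr])

theorem wp_frame (p : Code) {Q : Mem → Prop} (m : Mem) (hm : p.wp n S M Q m) :
    p.wp n S M (fun m' => p.Frame m m' ∧ Q m') m := by
  induction p generalizing Q m with
  | skip => exact ⟨.refl _ _, hm⟩
  | op i => exact ⟨hm.1, .op i m, hm.2⟩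
  | seq p q ihp ihq =>
    refine wp_mono p (fun m₁ h1 => ?_) m (ihp m hm)
    exact wp_mono q (fun m₂ h2 => ⟨h1.1.seq_left.trans h2.1.seq_right, h2.2⟩) m₁ (ihq m₁ h1.2)
  | ite t p q ihp ihq =>
    exact ⟨fun ht => wp_mono p (fun m₁ h1 => ⟨h1.1.ite_left, h1.2⟩) m (ihp m (hm.1 ht)),
      fun ht => wp_mono q (fun m₁ h1 => ⟨h1.1.ite_right, h1.2⟩) m (ihq m (hm.2 ht))⟩
  | rep i p ih =>
    have key : ∀ r k m', (rep i p).Frame m m' → wpIter (p.wp n S M) i Q r k m' →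
        wpIter (p.wp n S M) i (fun m' => (rep i p).Frame m m' ∧ Q m') r k m' := by
      intro r
      induction r with
      | zero => exact fun k m' hf h => ⟨hf.setVar_rep, h⟩
      | succ r ihr =>
        intro k m' hf h
        exact wp_mono p (fun m₁ h1 => ihr _ _ (hf.trans h1.1.body).setVar_rep h1.2) m' (ih m' h)
    exact key _ _ _ (Frame.refl _ _).setVar_rep hm

/-- The rule of consequence, with what is known about unchanged memory. -/
theorem wp_conseq {p : Code} {Q Q' : Mem → Prop} {m : Mem} (hm : p.wp n S M Q m)
    (h : ∀ m', p.Frame m m' → Q m' → Q' m') : p.wp n S M Q' m :=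
  wp_mono p (fun m' h' => h m' h'.1 h'.2) m (wp_frame p m hm)

theorem wp_seq {p q : Code} {Q : Mem → Prop} {m : Mem} (P : Mem → Prop) (hp : p.wp n S M P m)
    (hq : ∀ m', p.Frame m m' → P m' → q.wp n S M Q m') : (seq p q).wp n S M Q m :=
  wp_conseq (p := p) hp hq

/-- The rule for counting loops. -/
theorem wp_rep {i : ℕ} {p : Code} {Q : Mem → Prop} {m : Mem} (Inv : ℕ → Mem → Prop)
    (h0 : Inv 0 (m.setVar i 0))
    (hstep : ∀ k < n, ∀ m', (rep i p).Frame m m' → m'.var i = k → Inv k m' →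
      p.wp n S M (fun m'' => Inv (k + 1) (m''.setVar i (k + 1))) m')
    (hend : ∀ m', (rep i p).Frame m m' → Inv n m' → Q (m'.setVar i (n + 1))) :
    (rep i p).wp n S M Q m := by
  have key : ∀ r k m', k + r = n → (rep i p).Frame m m' → m'.var i = k → Inv k m' →
      wpIter (p.wp n S M) i Q r k m' := by
    intro r
    induction r with
    | zero =>
      intro k m' hk hf _ hi
      obtain rfl : k = n := by omega
      exact hend m' hf hi
    | succ r ih =>
      intro k m' hk hf hv hi
      refine wp_conseq (hstep k (by omega) m' hf hv hi) fun m'' hf' hi' => ?_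
      exact ih _ _ (by omega) (hf.trans hf'.body).setVar_rep (by simp) hi'
  exact key n 0 _ (by omega) (Frame.refl _ _).setVar_rep (by simp) h0

theorem wf_wv {p : Code} (h : p.wf = true) : p.wv 0 = false ∧ p.wv 1 = false := by
  induction p with
  | skip => exact ⟨rfl, rfl⟩
  | op i => simp_all [wf, wv]
  | seq p q ihp ihq => simp_all [wf, wv]
  | ite t p q ihp ihq => simp_all [wf, wv]
  | rep i p ih =>
    simp only [wf, Bool.and_eq_true, decide_eq_true_eq] at h
    have := ih h.1.1.1
    simp only [wv, this.1, this.2, Bool.or_false, beq_eq_false_iff_ne]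
    omega

/-- A program that meets its weakest precondition runs as claimed. -/
theorem exec_of_wp (hS : 50 ≤ S) (hn : n < S) (h1 : 1 ∈ H) (hM : 1 ≤ M) (p : Code)
    (hwf : p.wf = true) {Q : Mem → Prop} {m : Mem} (hs : Safe S H M m) (hv0 : m.var 0 = n)
    (hv1 : m.var 1 = 1) (hm : p.wp n S M Q m) :
    ∃ m' t, t ≤ p.cost n ∧ Exec (Safe S H M) p.toProg m m' t ∧ Q m' := by
  induction p generalizing Q m with
  | skip => exact ⟨m, 1, le_rfl, .skip m, hm⟩
  | op i =>
    simp only [wf, Bool.and_eq_true] at hwf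
    exact ⟨_, 1, le_rfl, .op i m (hs.exec hS h1 hM hwf.1.1 hm.1), hm.2⟩
  | seq p q ihp ihq =>
    simp only [wf, Bool.and_eq_true] at hwf
    obtain ⟨m₁, t₁, ht₁, he₁, hf₁, hq⟩ := ihp hwf.1 hs hv0 hv1 (wp_frame p m hm)
    have hw := wf_wv hwf.1
    obtain ⟨m₂, t₂, ht₂, he₂, hq₂⟩ := ihq hwf.2 (he₁.safe hs) ((hf₁.var 0 hw.1).trans hv0)
      ((hf₁.var 1 hw.2).trans hv1) hq
    exact ⟨m₂, _, by simp only [cost]; omega, .seq he₁ he₂, hq₂⟩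
  | ite t p q ihp ihq =>
    simp only [wf, Bool.and_eq_true] at hwf
    by_cases ht : t.Holds m
    · obtain ⟨m₁, t₁, ht₁, he₁, hq⟩ := ihp hwf.1 hs hv0 hv1 (hm.1 ht)
      exact ⟨m₁, _, by simp only [cost]; omega, .ite_true ht he₁, hq⟩
    · obtain ⟨m₁, t₁, ht₁, he₁, hq⟩ := ihq hwf.2 hs hv0 hv1 (hm.2 ht)
      exact ⟨m₁, _, by simp only [cost]; omega, .ite_false ht he₁, hq⟩
  | rep i p ih =>
    simp only [wf, Bool.and_eq_true, decide_eq_true_eq, Bool.not_eq_true'] at hwf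
    obtain ⟨⟨⟨hwf, hi⟩, hi50⟩, hi1⟩ := hwf
    have hw := wf_wv hwf
    have key : ∀ r k m, k + r = n → Safe S H M m → m.var 0 = n → m.var 1 = 1 → m.var i = k →
        wpIter (p.wp n S M) i Q r k m → ∃ m' t, t ≤ (r + 1) * (p.cost n + 5) + 1 ∧
          Exec (Safe S H M) (.loop (.le i 0)
            (.seq (.ite (.le 0 i) .skip p.toProg) (.op (.add i i 1)))) m m' t ∧ Q m' := by
      intro r
      induction r with
      -- This is the round at count `n`: the guard still holds, the body is skipped, and the counter
      -- leaves the range.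
      | zero =>
        intro k m hk hs hv0 hv1 hvi hm
        have hs' : Safe S H M ((Instr.add i i 1).exec m) :=
          hs.setVar (by omega) (by rw [hvi, hv1]; omega)
        have hop := Exec.op (Instr.add i i 1) m hs'
        simp only [Instr.exec, hvi, hv1] at hop
        refine ⟨m.setVar i (k + 1), _, ?_, .loop_step (by simp only [Test.Holds]; omega)
          (.seq (.ite_true (by simp only [Test.Holds]; omega) (.skip m)) hop)
          (.loop_done (by simp [Test.Holds, hv0, show (0 : ℕ) ≠ i by omega]; omega)), hm⟩
        omega
      | succ r ihr =>
        intro k m hk hs hv0 hv1 hvi hm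
        obtain ⟨m₁, t₁, ht₁, he₁, hf₁, hq⟩ := ih hwf hs hv0 hv1 (wp_frame p m hm)
        have hvi₁ : m₁.var i = k := (hf₁.var i hi).trans hvi
        have hv1₁ : m₁.var 1 = 1 := (hf₁.var 1 hw.2).trans hv1
        have hv0₁ : m₁.var 0 = n := (hf₁.var 0 hw.1).trans hv0
        have hs' : Safe S H M ((Instr.add i i 1).exec m₁) :=
          (he₁.safe hs).setVar (by omega) (by rw [hvi₁, hv1₁]; omega)
        have hop := Exec.op (Instr.add i i 1) m₁ hs'
        simp only [Instr.exec, hvi₁, hv1₁] at hop hs'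
        obtain ⟨m₂, t₂, ht₂, he₂, hq₂⟩ := ihr (k + 1) (m₁.setVar i (k + 1)) (by omega) hs'
          (by simp [show (0 : ℕ) ≠ i by omega, hv0₁]) (by simp [show (1 : ℕ) ≠ i by omega, hv1₁])
          (by simp) hq
        refine ⟨m₂, _, ?_, .loop_step (by simp only [Test.Holds]; omega)
          (.seq (.ite_false (by simp only [Test.Holds]; omega) he₁) hop) he₂, hq₂⟩
        have : (r + 1 + 1) * (p.cost n + 5) = (r + 1) * (p.cost n + 5) + (p.cost n + 5) := by ring
        omega
    have hs0 : Safe S H M ((Instr.const i 0).exec m) := hs.setVar (by omega) (by omega)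
    obtain ⟨m', t, ht, he, hq⟩ := key n 0 (m.setVar i 0) (by omega) hs0
      (by simp [show (0 : ℕ) ≠ i by omega, hv0]) (by simp [show (1 : ℕ) ≠ i by omega, hv1])
      (by simp) hm
    refine ⟨m', _, ?_, .seq (.op _ _ hs0) he, hq⟩
    have e1 : cost n (rep i p) = (n + 1) * (p.cost n + 5) + (n + 1) + (p.cost n + 6) := by
      simp only [cost]; ring
    omega

end Code

end RealRAM

/-! ## The program -/

namespace EnergyGame

variable {n : ℕ} (G : EnergyGame (Fin n))

/-- A number larger than the absolute values of all weights. -/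
noncomputable def bound : ℝ := 1 + ∑ e ∈ G.edges, |G.weight e|

theorem one_le_bound : 1 ≤ G.bound := by
  have : 0 ≤ ∑ e ∈ G.edges, |G.weight e| := Finset.sum_nonneg fun _ _ => abs_nonneg _
  unfold bound; linarith

theorem abs_weight_lt {e : Fin n × Fin n} (he : e ∈ G.edges) : |G.weight e| < G.bound := by
  have := Finset.single_le_sum (f := fun e => |G.weight e|) (fun _ _ => abs_nonneg _) he
  unfold bound; linarith

/-- A bound on all numbers in the computation. -/
noncomputable def limit : ℝ := 4 * ((n : ℝ) + 1) * (G.bound + 2)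

end EnergyGame

/-! ### Computing the signs and sizes of the modified weights -/

namespace RealRAM

open EnergyGame Code

/-- Sequential composition. -/
infixr:60 " ;; " => Code.seq

variable {n S : ℕ} {M : ℝ} {G : EnergyGame (Fin n)} {m m' : Mem} {p q : Fin n → ℝ}

/-- The input and the constants of the program are in their places. -/
structure Env (G : EnergyGame (Fin n)) (m : Mem) : Prop where
  v0 : m.var 0 = n
  v1 : m.var 1 = 1
  v2 : m.var 2 = 0
  v3 : m.var 3 = 2
  v4 : m.var 4 = 3
  mx : ∀ a : Fin n, m.nat 0 a = if a ∈ G.maxNodes then 1 else 0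
  adj : ∀ a b : Fin n, m.nat 1 (n * a + b) = if (a, b) ∈ G.edges then 1 else 0
  weight : ∀ a b : Fin n, (a, b) ∈ G.edges → m.real 0 (n * a + b) = G.weight (a, b)
  abs_lt : ∀ a b : Fin n, |m.real 0 (n * a + b)| < G.bound
  bound : m.real 3 0 = G.bound
  two : m.real 4 0 = 2
  zero : m.real 7 0 = 0
  one : m.real 8 0 = 1

/-- The program does not write the input and the constants. -/
def keepsEnv (c : Code) : Bool :=
  !c.wv 0 && !c.wv 1 && !c.wv 2 && !c.wv 3 && !c.wv 4 && !c.wn 0 && !c.wn 1 &&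
    !c.wr 0 && !c.wr 3 && !c.wr 4 && !c.wr 7 && !c.wr 8

/-- The side condition is a Boolean computation, so `rfl` proves it for the concrete programs below.
-/
theorem Env.frame {c : Code} (h : Env G m) (hf : c.Frame m m') (hc : keepsEnv c = true) :
    Env G m' := by
  simp only [keepsEnv, Bool.and_eq_true, Bool.not_eq_true'] at hc
  obtain ⟨⟨⟨⟨⟨⟨⟨⟨⟨⟨⟨h0, h1⟩, h2⟩, h3⟩, h4⟩, n0⟩, n1⟩, r0⟩, r3⟩, r4⟩, r7⟩, r8⟩ := hc
  constructor
  · rw [hf.var 0 h0, h.v0]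
  · rw [hf.var 1 h1, h.v1]
  · rw [hf.var 2 h2, h.v2]
  · rw [hf.var 3 h3, h.v3]
  · rw [hf.var 4 h4, h.v4]
  · rw [hf.nat 0 n0]; exact h.mx
  · rw [hf.nat 1 n1]; exact h.adj
  · rw [hf.real 0 r0]; exact h.weight
  · rw [hf.real 0 r0]; exact h.abs_lt
  · rw [hf.real 3 r3, h.bound]
  · rw [hf.real 4 r4, h.two]
  · rw [hf.real 7 r7, h.zero]
  · rw [hf.real 8 r8, h.one]

theorem index_inj {a b a' b' : ℕ} (hb : b < n) (hb' : b' < n) (h : n * a + b = n * a' + b') :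
    a = a' ∧ b = b' := by
  have h1 := congrArg (· % n) h
  simp only [Nat.mul_add_mod, Nat.mod_eq_of_lt hb, Nat.mod_eq_of_lt hb'] at h1
  have h2 := congrArg (· / n) h
  have hn : 0 < n := by omega
  simp only [Nat.mul_add_div hn, Nat.div_eq_of_lt hb, Nat.div_eq_of_lt hb'] at h2
  exact ⟨by omega, h1⟩

theorem index_lt {a b : ℕ} (ha : a < n) (hb : b < n) : n * a + b < n * n := by
  have := Nat.mul_le_mul_left n (Nat.succ_le_of_lt ha)
  rw [Nat.mul_succ] at this
  omega

/-- Variable `7` becomes the address of the matrix entry given by the variables `5` and `6`. -/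
def indexCode : Code := .op (.mul 7 0 5) ;; .op (.add 7 7 6)

/-- Write the sign of the modified weight of an edge. -/
def signCode : Code :=
  .ite (.le 9 2) .skip
    (.ite (.rle 5 7 7 2)
      (.ite (.rle 7 2 5 7)
        (.ite (.rle 6 7 7 2) (.ite (.rle 7 2 6 7) (.op (.const 9 2)) (.op (.const 9 1)))
          (.op (.const 9 3)))
        (.op (.const 9 1)))
      (.op (.const 9 3)))

/-- Compute the modified weight of an edge and load its adjacency. -/
def costCode : Code :=
  .op (.radd 5 7 0 7 1 6) ;; .op (.rsub 5 7 5 7 1 5) ;; .op (.radd 6 7 8 2 2 6) ;;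
    .op (.rsub 6 7 6 7 2 5) ;; .op (.load 9 1 7)

/-- Store the sign of an edge, and turn its modified weight into an absolute value. -/
def absCode : Code :=
  .op (.store 3 7 9) ;;
    .ite (.le 9 1) (.op (.rsub 5 7 7 2 5 7) ;; .op (.rsub 6 7 7 2 6 7)) .skip

/-- Compute the signs and the sizes of the modified weights of all edges. -/
def signsCode : Code := .rep 5 (.rep 6 (indexCode ;; costCode ;; signCode ;; absCode))

/-- The cell of the edge `(a, b)` is filled. -/
structure SignCell (G : EnergyGame (Fin n)) (p q : Fin n → ℝ) (m : Mem) (a b : Fin n) : Prop where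
  sign : (a, b) ∈ G.edges → (m.nat 3 (n * a + b) : ℤ) = (G.pattern p q).s a b + 2
  none : (a, b) ∉ G.edges → m.nat 3 (n * a + b) = 0
  cost : (a, b) ∈ G.edges → (m.real 5 (n * a + b), m.real 6 (n * a + b)) = G.absCost p q a b
  le₁ : |m.real 5 (n * a + b)| ≤ (n + 1) * G.bound
  le₂ : |m.real 6 (n * a + b)| ≤ 2 * n + 1

theorem indexCode_spec (hS : n * n ≤ S) (h0 : m.var 0 = n) (h5 : m.var 5 < n) (h6 : m.var 6 < n) :
    indexCode.wp n S M (fun m' => m'.var 7 = n * m.var 5 + m.var 6) m := by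
  have h := index_lt h5 h6
  simp [indexCode, wp, Instr.ok, Instr.exec, h0]
  constructor <;> omega

/-- Signs are stored as 1, 2, 3, which leaves 0 for absent edges. Variable `2` serves both as the
constant 0 and as the address of the cells that hold real constants. -/
theorem lexSign_add_two_code (m : Mem) (h2 : m.var 2 = 0) (hz : m.real 7 0 = 0) :
    signCode.wp n S M (fun m' =>
      m'.var 9 = if m.var 9 = 0 then 0 else
        (lexSign (m.real 5 (m.var 7)) (m.real 6 (m.var 7)) + 2).toNat) m := by
  simp only [signCode, wp, Test.Holds, h2, hz, Instr.ok, Instr.exec, true_and]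
  refine ⟨fun h => by rw [if_pos (by omega)]; omega, fun h => ?_⟩
  simp only [if_neg (show ¬ m.var 9 = 0 by omega), Mem.setVar_var, if_true]
  unfold lexSign
  refine ⟨fun h1 => ⟨fun h2 => ⟨fun h3 => ⟨fun h4 => ?_, fun h4 => ?_⟩, fun h3 => ?_⟩, fun h2 => ?_⟩,
    fun h1 => ?_⟩
  · rw [if_neg (by linarith), if_neg (by linarith), if_neg (by linarith), if_neg (by linarith)]; rfl
  · rw [if_neg (by linarith), if_neg (by linarith), if_pos (by linarith)]; rfl
  · rw [if_neg (by linarith), if_neg (by linarith), if_neg (by linarith), if_pos (by linarith)]; rfl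
  · rw [if_pos (by linarith)]; rfl
  · rw [if_neg (by linarith), if_pos (by linarith)]; rfl

theorem costCode_spec {j : ℕ} {w a₁ b₁ a₂ b₂ : ℝ} (h7 : m.var 7 = j) (h2 : m.var 2 = 0)
    (hone : m.real 8 0 = 1) (hw : m.real 0 j = w) (hb1 : m.real 1 (m.var 6) = b₁)
    (ha1 : m.real 1 (m.var 5) = a₁) (hb2 : m.real 2 (m.var 6) = b₂) (ha2 : m.real 2 (m.var 5) = a₂)
    (l1 : |w + b₁| ≤ M) (l2 : |w + b₁ - a₁| ≤ M) (l3 : |1 + b₂| ≤ M) (l4 : |1 + b₂ - a₂| ≤ M) :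
    costCode.wp n S M (fun m' => m'.real 5 j = w + b₁ - a₁ ∧ m'.real 6 j = 1 + b₂ - a₂ ∧
      m'.var 9 = m.nat 1 j ∧ (∀ i, i ≠ j → m'.real 5 i = m.real 5 i ∧ m'.real 6 i = m.real 6 i)) m := by
  simp [costCode, wp, Instr.ok, Instr.exec, h7, h2, hone, hw, hb1, ha1, hb2, ha2, l1, l2, l3, l4]
  intro i hi
  simp [hi]

theorem absCode_spec {j : ℕ} (h7 : m.var 7 = j) (h1 : m.var 1 = 1) (h2 : m.var 2 = 0)
    (hz : m.real 7 0 = 0) (l1 : |m.real 5 j| ≤ M) (l2 : |m.real 6 j| ≤ M) :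
    absCode.wp n S M (fun m' => m'.nat 3 j = m.var 9 ∧
      m'.real 5 j = (if m.var 9 ≤ 1 then -m.real 5 j else m.real 5 j) ∧
      m'.real 6 j = (if m.var 9 ≤ 1 then -m.real 6 j else m.real 6 j) ∧
      (∀ i, i ≠ j → m'.nat 3 i = m.nat 3 i ∧ m'.real 5 i = m.real 5 i ∧
        m'.real 6 i = m.real 6 i)) m := by
  simp [absCode, wp, Instr.ok, Instr.exec, Test.Holds, h7, h1, h2, hz, l1, l2]
  constructor <;> intro h <;> grind

/-- The potentials are in their places and within their bounds. -/
structure Pot (G : EnergyGame (Fin n)) (p q : Fin n → ℝ) (m : Mem) : Prop where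
  eq₁ : ∀ a : Fin n, m.real 1 a = p a
  eq₂ : ∀ a : Fin n, m.real 2 a = q a
  p_nonneg : ∀ a, 0 ≤ p a
  q_nonneg : ∀ a, 0 ≤ q a
  p_le : ∀ a, p a ≤ n * G.bound
  q_le : ∀ a, q a ≤ n * 2

theorem signsCode_spec (hS : n * n ≤ S) (he : Env G m) (hp : Pot G p q m) :
    signsCode.wp n S G.limit (fun m' => ∀ a b, SignCell G p q m' a b) m := by
  have hB := G.one_le_bound
  have hnn : (0 : ℝ) ≤ n := Nat.cast_nonneg n
  have hnB : 0 ≤ (n : ℝ) * G.bound := by positivity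
  have hlim : G.limit = 4 * (n * G.bound) + 8 * n + 4 * G.bound + 8 := by
    unfold EnergyGame.limit; ring
  refine wp_rep (fun k m' => ∀ a b, a.1 < k → SignCell G p q m' a b) (by simp) ?_ ?_
  swap
  · intro m' _ h a b
    obtain ⟨h1, h2, h3, h4, h5⟩ := h a b a.2
    exact ⟨h1, h2, h3, h4, h5⟩
  intro k hk m₁ hf₁ hv₁ hi₁
  -- The filled cells are all rows before `k` and the first `l` entries of row `k`.
  refine wp_rep (fun l m' => ∀ a b, a.1 < k ∨ (a.1 = k ∧ b.1 < l) → SignCell G p q m' a b) ?_ ?_ ?_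
  · intro a b h
    obtain ⟨h1, h2, h3, h4, h5⟩ := hi₁ a b (by omega)
    exact ⟨h1, h2, h3, h4, h5⟩
  swap
  · intro m' _ h a b hab
    obtain ⟨h1, h2, h3, h4, h5⟩ := h a b (by omega)
    exact ⟨h1, h2, h3, h4, h5⟩
  intro l hl m₂ hf₂ hv₂ hi₂
  have he₂ := (he.frame hf₁ rfl).frame hf₂ rfl
  have hr1 : m₂.real 1 = m.real 1 := (hf₂.real 1 rfl).trans (hf₁.real 1 rfl)
  have hr2 : m₂.real 2 = m.real 2 := (hf₂.real 2 rfl).trans (hf₁.real 2 rfl)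
  have hv5 : m₂.var 5 = k := (hf₂.var 5 rfl).trans hv₁
  let a : Fin n := ⟨k, hk⟩
  let b : Fin n := ⟨l, hl⟩
  refine wp_seq _ (indexCode_spec hS he₂.v0 (by omega) (by omega)) fun m₃ hf₃ h7 => ?_
  have he₃ := he₂.frame hf₃ rfl
  have ha1 : m₃.real 1 k = p a := by rw [hf₃.real 1 rfl, hr1]; exact hp.eq₁ a
  have hb1 : m₃.real 1 l = p b := by rw [hf₃.real 1 rfl, hr1]; exact hp.eq₁ b
  have ha2 : m₃.real 2 k = q a := by rw [hf₃.real 2 rfl, hr2]; exact hp.eq₂ a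
  have hb2 : m₃.real 2 l = q b := by rw [hf₃.real 2 rfl, hr2]; exact hp.eq₂ b
  have h5 : m₃.var 5 = k := (hf₃.var 5 rfl).trans hv5
  have h6 : m₃.var 6 = l := (hf₃.var 6 rfl).trans hv₂
  rw [hv5, hv₂] at h7
  have h2 := he₃.v2
  have hw := abs_lt.1 (he₃.abs_lt a b)
  have hpa := hp.p_nonneg a
  have hpb := hp.p_nonneg b
  have hqa := hp.q_nonneg a
  have hqb := hp.q_nonneg b
  have hpa' := hp.p_le a
  have hpb' := hp.p_le b
  have hqa' := hp.q_le a
  have hqb' := hp.q_le b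
  have hone := he₃.one
  have hzero := he₃.zero
  have hadj := he₃.adj a b
  have hwt := he₃.weight a b
  refine wp_seq _ (costCode_spec (b₁ := p b) (a₁ := p a) (b₂ := q b) (a₂ := q a) h7 h2
    hone rfl (by rw [h6]; exact hb1) (by rw [h5]; exact ha1)
    (by rw [h6]; exact hb2) (by rw [h5]; exact ha2) ?_ ?_ ?_ ?_) fun m₄ hf₄ h4 => ?_
  iterate 4
    rw [abs_le]
    constructor <;> linarith
  obtain ⟨h45, h46, h49, h4o⟩ := h4
  have he₄ := he₃.frame hf₄ rfl
  refine wp_seq _ (lexSign_add_two_code m₄ he₄.v2 he₄.zero) fun m₅ hf₅ h59 => ?_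
  have he₅ := he₄.frame hf₅ rfl
  have h57 : m₅.var 7 = n * k + l := by rw [hf₅.var 7 rfl, hf₄.var 7 rfl, h7]
  rw [h49, hf₄.var 7 rfl, h7, h45, h46, hadj] at h59
  rw [← hf₅.real 5 rfl] at h45 h4o
  rw [← hf₅.real 6 rfl] at h46 h4o
  refine wp_conseq (absCode_spec h57 he₅.v1 he₅.v2 he₅.zero ?_ ?_) fun m₆ hf₆ h6' => ?_
  iterate 2
    first | rw [h45] | rw [h46]
    rw [abs_le]
    constructor <;> linarith
  obtain ⟨h63, h65, h66, h6o⟩ := h6'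
  intro a' b' hab
  by_cases hne : a'.1 < k ∨ (a'.1 = k ∧ b'.1 < l)
  · have hidx : n * a'.1 + b'.1 ≠ n * k + l := by
      intro h
      have := index_inj b'.2 hl h
      omega
    obtain ⟨e1, e2, e3⟩ := h6o _ hidx
    obtain ⟨e4, e5⟩ := h4o _ hidx
    have e6 : m₅.nat 3 = m₂.nat 3 := by
      rw [hf₅.nat 3 rfl, hf₄.nat 3 rfl, hf₃.nat 3 rfl]
    rw [e6] at e1
    rw [e4, hf₃.real 5 rfl] at e2
    rw [e5, hf₃.real 6 rfl] at e3
    obtain ⟨c1, c2, c3, c4, c5⟩ := hi₂ a' b' hne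
    constructor
    · simpa [e1] using c1
    · simpa [e1] using c2
    · simpa [e2, e3] using c3
    · simpa [e2] using c4
    · simpa [e3] using c5
  · obtain rfl : a' = a := Fin.ext (by simp only [a]; omega)
    obtain rfl : b' = b := Fin.ext (by simp only [b]; omega)
    rw [h45] at h65
    rw [h46] at h66
    -- The sign is at least -1, so `toNat` of the sign plus 2 loses nothing.
    have hrange : (G.pattern p q).s a b = -1 ∨ (G.pattern p q).s a b = 0 ∨
        (G.pattern p q).s a b = 1 := by
      simp only [pattern, lexSign]; split_ifs <;> simp
    have hs : (a, b) ∈ G.edges → m₅.var 9 = ((G.pattern p q).s a b + 2).toNat := by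
      intro hab'
      rw [h59, if_pos hab', if_neg one_ne_zero, hwt hab']
      rfl
    constructor
    · intro hab'
      simp only [Mem.setVar_nat]
      rw [show n * a.1 + b.1 = n * k + l from rfl, h63, hs hab']
      omega
    · intro hab'
      simp only [Mem.setVar_nat]
      rw [show n * a.1 + b.1 = n * k + l from rfl, h63, h59, if_neg hab', if_pos rfl]
    · intro hab'
      simp only [Mem.setVar_real]
      rw [show n * a.1 + b.1 = n * k + l from rfl, h65, h66, hs hab', absCost, ← hwt hab']
      split_ifs <;> first | rfl | omega
    · simp only [Mem.setVar_real]
      rw [show n * a.1 + b.1 = n * k + l from rfl, h65]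
      split_ifs <;> rw [abs_le] <;> constructor <;> linarith
    · simp only [Mem.setVar_real]
      rw [show n * a.1 + b.1 = n * k + l from rfl, h66]
      split_ifs <;> rw [abs_le] <;> constructor <;> linarith

end RealRAM

/-! ### The set `low` as a least fixed point -/

namespace SignGame

variable {V : Type*}

/-- The nodes from which Min forces a negative edge or a zero edge into `X`. -/
def pre (g : SignGame V) (X : Set V) : Set V :=
  {a | (g.mx a → ∀ b, g.E a b → g.s a b < 0 ∨ (g.s a b = 0 ∧ b ∈ X)) ∧
    (¬ g.mx a → ∃ b, g.E a b ∧ (g.s a b < 0 ∨ (g.s a b = 0 ∧ b ∈ X)))}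

theorem pre_mono (g : SignGame V) {X Y : Set V} (h : X ⊆ Y) : g.pre X ⊆ g.pre Y := by
  rintro a ⟨h1, h2⟩
  refine ⟨fun hm b hb => (h1 hm b hb).imp_right fun h' => ⟨h'.1, h h'.2⟩, fun hm => ?_⟩
  obtain ⟨b, hb, h'⟩ := h2 hm
  exact ⟨b, hb, h'.imp_right fun h' => ⟨h'.1, h h'.2⟩⟩

theorem pre_low_subset (g : SignGame V) : g.pre g.low ⊆ g.low := by
  rintro a ⟨h1, h2⟩
  by_cases hm : g.mx a
  · exact mem_low_mx hm (h1 hm)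
  · obtain ⟨b, hb, h⟩ := h2 hm
    exact mem_low_mn hm hb h

/-- Together with `pre_low_subset` this makes `low` the least set closed under `pre`. -/
theorem low_subset_of_pre_subset (g : SignGame V) {X : Set V} (h : g.pre X ⊆ X) : g.low ⊆ X := by
  intro a ha
  induction ha with
  | base h' => exact h'.elim
  | mx _ hm h1 _ ih =>
    refine h ⟨fun _ b hb => ?_, fun h => absurd hm h⟩
    rcases (h1 b hb).lt_or_eq with h' | h'
    · exact .inl h'
    · exact .inr ⟨h', ih b hb h'⟩
  | neg _ hm h1 h2 => exact h ⟨fun h => absurd h hm, fun _ => ⟨_, h1, .inl h2⟩⟩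
  | zero _ hm h1 h2 _ ih => exact h ⟨fun h => absurd h hm, fun _ => ⟨_, h1, .inr ⟨h2, ih⟩⟩⟩

/-- The nodes from which Min forces a negative edge within a number of rounds. -/
def reach (g : SignGame V) : ℕ → Set V
  | 0 => ∅
  | r + 1 => g.pre (reach g r)

theorem reach_subset_succ (g : SignGame V) (r : ℕ) : g.reach r ⊆ g.reach (r + 1) := by
  induction r with
  | zero => exact Set.empty_subset _
  | succ r ih => exact g.pre_mono ih

/-- The iterates grow from the empty set. As soon as two consecutive ones agree they are closed
under `pre` and contain `low`; otherwise each round gains a node and the last iterate is everything.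
-/
theorem low_subset_reach [Fintype V] (g : SignGame V) : g.low ⊆ g.reach (Fintype.card V) := by
  have h : ∀ r, g.low ⊆ g.reach r ∨ r ≤ (g.reach r).ncard := by
    intro r
    induction r with
    | zero => exact .inr (Nat.zero_le _)
    | succ r ih =>
      rcases ih with h | h
      · exact .inl (h.trans (g.reach_subset_succ r))
      by_cases he : g.reach (r + 1) = g.reach r
      · left
        rw [he]
        exact g.low_subset_of_pre_subset he.le
      · right
        have := Set.ncard_lt_ncard ((g.reach_subset_succ r).ssubset_of_ne (Ne.symm he))
          (Set.toFinite _)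
        omega
  rcases h (Fintype.card V) with h | h
  · exact h
  · have : g.reach (Fintype.card V) = Set.univ :=
      Set.eq_of_subset_of_ncard_le (Set.subset_univ _)
        (by rw [Set.ncard_univ, Nat.card_eq_fintype_card]; exact h) (Set.toFinite _)
    rw [this]
    exact Set.subset_univ _

end SignGame

/-! ### Computing `low` -/

namespace RealRAM

open EnergyGame Code SignGame

variable {n S : ℕ} {M : ℝ} {G : EnergyGame (Fin n)} {m m' : Mem} {p q : Fin n → ℝ}

/-- Record an edge that suits Min. -/
def goodCode : Code := .ite (.le 17 2) (.op (.const 10 1)) .skip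

/-- Record an edge that does not suit Min. -/
def badCode : Code := .ite (.le 17 2) .skip (.op (.const 10 0))

/-- Update the flag `10` of a node by one of its edges. -/
def edgeCode : Code :=
  .op (.load 9 3 7) ;; .op (.load 12 4 6) ;;
    .ite (.le 9 2) .skip (.ite (.le 9 1) goodCode
      (.ite (.le 4 9) badCode (.ite (.le 1 12) goodCode badCode)))

/-- Compute whether Min forces a negative edge or a zero edge into the set in array `4`. -/
def memberCode : Code :=
  .op (.load 17 0 5) ;; .op (.load 10 0 5) ;; .rep 6 (indexCode ;; edgeCode)

/-- Compute the set of the nodes from which Min forces the first non-zero edge to be negative. -/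
def lowCode : Code :=
  .rep 5 (.op (.store 4 5 2)) ;;
    .rep 8 (.rep 5 (memberCode ;; .ite (.le 1 10) (.op (.store 4 5 1)) .skip))

/-- The set in array `4`. -/
def lowSet (n : ℕ) (m : Mem) : Set (Fin n) := {a | m.nat 4 a = 1}

theorem edgeCode_spec {c y : ℕ} (h1 : m.var 1 = 1) (h2 : m.var 2 = 0) (h4 : m.var 4 = 3)
    (hc : m.nat 3 (m.var 7) = c) (hy : m.nat 4 (m.var 6) = y) :
    edgeCode.wp n S M (fun m' => m'.var 10 =
      if c = 0 then m.var 10 else if c ≤ 1 ∨ (c < 3 ∧ 1 ≤ y) then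
        (if m.var 17 = 0 then 1 else m.var 10) else
        (if m.var 17 = 0 then m.var 10 else 0)) m := by
  simp [edgeCode, goodCode, badCode, wp, Instr.ok, Instr.exec, Test.Holds, h1, h2, h4, hc, hy]
  grind

/-- The signs and sizes of all edges are in their places. -/
def Signs (G : EnergyGame (Fin n)) (p q : Fin n → ℝ) (m : Mem) : Prop :=
  ∀ a b, SignCell G p q m a b

theorem Signs.frame {c : Code} (h : Signs G p q m) (hf : c.Frame m m')
    (hc : (!c.wn 3 && !c.wr 5 && !c.wr 6) = true) : Signs G p q m' := by
  simp only [Bool.and_eq_true, Bool.not_eq_true'] at hc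
  intro a b
  obtain ⟨h1, h2, h3, h4, h5⟩ := h a b
  rw [← hf.nat 3 hc.1.1] at h1 h2
  rw [← hf.real 5 hc.1.2] at h3 h4
  rw [← hf.real 6 hc.2] at h3 h5
  exact ⟨h1, h2, h3, h4, h5⟩

theorem pattern_s_cases (G : EnergyGame (Fin n)) (p q : Fin n → ℝ) (a b : Fin n) :
    (G.pattern p q).s a b = -1 ∨ (G.pattern p q).s a b = 0 ∨ (G.pattern p q).s a b = 1 := by
  simp only [pattern, lexSign]; split_ifs <;> simp

/-- The flag starts as the owner bit: 1 is neutral for the conjunction over edges at Max's nodes, 0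
for the disjunction at Min's nodes. -/
theorem memberCode_spec (hS : n * n ≤ S) (he : Env G m) (hs : Signs G p q m)
    (h4 : ∀ a : Fin n, m.nat 4 a ≤ 1) {a : Fin n} (ha : m.var 5 = a) :
    memberCode.wp n S M (fun m' => m'.var 10 ≤ 1 ∧
      (m'.var 10 = 1 ↔ a ∈ (G.pattern p q).pre (lowSet n m))) m := by
  have hmx := he.mx a
  refine ⟨trivial, trivial, ?_⟩
  generalize hm₁ : (Instr.load 10 0 5).exec ((Instr.load 17 0 5).exec m) = m₁
  have h17 : m₁.var 17 = if a ∈ G.maxNodes then 1 else 0 := by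
    rw [← hm₁]; simp [Instr.exec, ha, hmx]
  have h10 : m₁.var 10 = if a ∈ G.maxNodes then 1 else 0 := by
    rw [← hm₁]; simp [Instr.exec, ha, hmx]
  have h5 : m₁.var 5 = a := by rw [← hm₁]; simp [Instr.exec, ha]
  have hf : Code.Frame (.op (.load 17 0 5) ;; .op (.load 10 0 5)) m m₁ := by
    rw [← hm₁]
    exact ((Frame.op _ _).seq_left).trans ((Frame.op _ _).seq_right)
  have he₁ := he.frame hf rfl
  have hs₁ := hs.frame hf rfl
  have h4₁ := hf.nat 4 rfl
  clear hm₁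
  refine wp_rep (fun l m' => m'.var 10 ≤ 1 ∧
    (a ∈ G.maxNodes → (m'.var 10 = 1 ↔ ∀ b : Fin n, b < l → (a, b) ∈ G.edges →
      (G.pattern p q).s a b < 0 ∨ ((G.pattern p q).s a b = 0 ∧ b ∈ lowSet n m))) ∧
    (a ∉ G.maxNodes → (m'.var 10 = 1 ↔ ∃ b : Fin n, b < l ∧ (a, b) ∈ G.edges ∧
      ((G.pattern p q).s a b < 0 ∨ ((G.pattern p q).s a b = 0 ∧ b ∈ lowSet n m))))) ?_ ?_ ?_
  · simp only [Mem.setVar_var]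
    rw [if_neg (by decide), h10]
    refine ⟨by split_ifs <;> omega, fun h => ?_, fun h => ?_⟩ <;> simp [h]
  · intro l hl m₂ hf₂ hv₂ hi₂
    have he₂ := he₁.frame hf₂ rfl
    have hs₂ := hs₁.frame hf₂ rfl
    have h5₂ : m₂.var 5 = a := (hf₂.var 5 rfl).trans h5
    refine wp_seq _ (indexCode_spec hS he₂.v0 (by omega) (by omega)) fun m₃ hf₃ h7 => ?_
    have he₃ := he₂.frame hf₃ rfl
    have hs₃ := hs₂.frame hf₃ rfl a ⟨l, hl⟩
    rw [h5₂, hv₂] at h7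
    refine wp_conseq (edgeCode_spec he₃.v1 he₃.v2 he₃.v4 rfl rfl) fun m₄ hf₄ h10' => ?_
    have e4 : m₃.nat 4 = m.nat 4 := by rw [hf₃.nat 4 rfl, hf₂.nat 4 rfl, h4₁]
    have e17 : m₃.var 17 = if a ∈ G.maxNodes then 1 else 0 := by
      rw [hf₃.var 17 rfl, hf₂.var 17 rfl, h17]
    have e10 : m₃.var 10 = m₂.var 10 := hf₃.var 10 rfl
    have e6 : m₃.var 6 = l := (hf₃.var 6 rfl).trans hv₂
    rw [h7, e4, e17, e10, e6] at h10'
    have hy := h4 ⟨l, hl⟩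
    have hmem : (⟨l, hl⟩ : Fin n) ∈ lowSet n m ↔ m.nat 4 l = 1 := Iff.rfl
    have hsc := pattern_s_cases G p q a ⟨l, hl⟩
    have c1 := hs₃.sign
    have c2 := hs₃.none
    simp only at c1 c2 hy
    simp only [Mem.setVar_var]
    rw [if_neg (by decide)]
    have hgood : (a, ⟨l, hl⟩) ∈ G.edges →
        ((m₃.nat 3 (n * a + l) ≤ 1 ∨ (m₃.nat 3 (n * a + l) < 3 ∧ 1 ≤ m.nat 4 l)) ↔
        ((G.pattern p q).s a ⟨l, hl⟩ < 0 ∨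
          ((G.pattern p q).s a ⟨l, hl⟩ = 0 ∧ (⟨l, hl⟩ : Fin n) ∈ lowSet n m))) := by
      intro h
      have := c1 h
      rw [hmem]
      omega
    have hall : ∀ P : Fin n → Prop,
        (∀ b : Fin n, b < l + 1 → P b) ↔ (∀ b : Fin n, b < l → P b) ∧ P ⟨l, hl⟩ := by
      intro P
      refine ⟨fun h => ⟨fun b hb => h b (by omega), h ⟨l, hl⟩ (by simp)⟩, fun h b hb => ?_⟩
      rcases Nat.lt_succ_iff_lt_or_eq.1 hb with h' | h'
      · exact h.1 b h'
      · obtain rfl : b = ⟨l, hl⟩ := Fin.ext h'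
        exact h.2
    have hex : ∀ P : Fin n → Prop,
        (∃ b : Fin n, b < l + 1 ∧ P b) ↔ (∃ b : Fin n, b < l ∧ P b) ∨ P ⟨l, hl⟩ := by
      intro P
      refine ⟨fun ⟨b, hb, hP⟩ => ?_, fun h => ?_⟩
      · rcases Nat.lt_succ_iff_lt_or_eq.1 hb with h' | h'
        · exact .inl ⟨b, h', hP⟩
        · obtain rfl : b = ⟨l, hl⟩ := Fin.ext h'
          exact .inr hP
      · rcases h with ⟨b, hb, hP⟩ | hP
        · exact ⟨b, by omega, hP⟩
        · exact ⟨⟨l, hl⟩, by simp, hP⟩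
    rw [hall, hex]
    obtain ⟨i1, i2, i3⟩ := hi₂
    by_cases hE : (a, ⟨l, hl⟩) ∈ G.edges
    · have hc := c1 hE
      have hne : m₃.nat 3 (n * a + l) ≠ 0 := by omega
      have hg := hgood hE
      rw [if_neg hne] at h10'
      by_cases hm : a ∈ G.maxNodes
      · simp only [hm, if_true, one_ne_zero, if_false] at h10'
        have := i2 hm
        refine ⟨by split_ifs at h10' <;> omega, fun _ => ?_, fun h => absurd hm h⟩
        rw [← this, ← hg]
        split_ifs at h10' with h <;> simp [h, hE, h10']
      · simp only [hm, if_true, if_false] at h10'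
        have := i3 hm
        refine ⟨by split_ifs at h10' <;> omega, fun h => absurd h hm, fun _ => ?_⟩
        rw [← this, ← hg]
        split_ifs at h10' with h <;> simp [h, hE, h10']
    · rw [if_pos (c2 hE)] at h10'
      rw [h10']
      simpa [hE] using ⟨i1, i2, i3⟩
  · intro m₂ _ ⟨i1, i2, i3⟩
    simp only [Mem.setVar_var]
    rw [if_neg (by decide)]
    refine ⟨i1, ?_⟩
    by_cases hm : a ∈ G.maxNodes
    · rw [i2 hm]
      refine ⟨fun h => ⟨fun _ b hb => h b b.2 hb, fun h' => absurd hm h'⟩, fun h b _ hb => h.1 hm b hb⟩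
    · rw [i3 hm]
      refine ⟨fun ⟨b, _, hb⟩ => ⟨fun h' => absurd h' hm, fun _ => ⟨b, hb⟩⟩, fun h => ?_⟩
      obtain ⟨b, hb⟩ := h.2 hm
      exact ⟨b, b.2, hb⟩

/-- Array `4` is updated in place, so its content is not exactly an iterate of `pre`. It suffices
that after `r` rounds it lies between `reach r` and `low`, since `reach n` already contains `low`.
-/
theorem lowCode_spec (hS : n * n ≤ S) (he : Env G m) (hs : Signs G p q m) :
    lowCode.wp n S M (fun m' => (∀ a : Fin n, m'.nat 4 a ≤ 1) ∧
      lowSet n m' = (G.pattern p q).low) m := by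
  refine wp_seq (fun m' => ∀ a : Fin n, m'.nat 4 a = 0) ?_ fun m₁ hf₁ h0 => ?_
  · refine wp_rep (fun k m' => ∀ a : Fin n, a < k → m'.nat 4 a = 0) (by simp) ?_
      fun m' _ h a => h a a.2
    intro k hk m' hf hv h
    refine ⟨trivial, fun a ha => ?_⟩
    have h2 : m'.var 2 = 0 := (hf.var 2 rfl).trans he.v2
    simp only [Instr.exec, Mem.setVar_nat, Mem.setNat_nat, if_true, hv, h2]
    split_ifs with h'
    · rfl
    · exact h a (by omega)
  have he₁ := he.frame hf₁ rfl
  have hs₁ := hs.frame hf₁ rfl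
  refine wp_rep (fun r m' => (∀ a : Fin n, m'.nat 4 a ≤ 1) ∧
    lowSet n m' ⊆ (G.pattern p q).low ∧ (G.pattern p q).reach r ⊆ lowSet n m') ?_ ?_ ?_
  · refine ⟨fun a => by simp [h0 a], fun a ha => ?_, Set.empty_subset _⟩
    simp [lowSet, h0 a] at ha
  · intro r hr m₂ hf₂ hv₂ ⟨i1, i2, i3⟩
    have he₂ := he₁.frame hf₂ rfl
    have hs₂ := hs₁.frame hf₂ rfl
    refine wp_rep (fun k m' => (∀ a : Fin n, m'.nat 4 a ≤ 1) ∧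
      lowSet n m' ⊆ (G.pattern p q).low ∧ (G.pattern p q).reach r ⊆ lowSet n m' ∧
      ∀ a : Fin n, a < k → a ∈ (G.pattern p q).reach (r + 1) → a ∈ lowSet n m')
      ⟨i1, i2, i3, by simp⟩ ?_ ?_
    swap
    · exact fun m' _ ⟨j1, j2, j3, j4⟩ => ⟨j1, j2, fun a ha => j4 a a.2 ha⟩
    intro k hk m₃ hf₃ hv₃ ⟨j1, j2, j3, j4⟩
    have he₃ := he₂.frame hf₃ rfl
    have hs₃ := hs₂.frame hf₃ rfl
    refine wp_seq _ (memberCode_spec (a := ⟨k, hk⟩) hS he₃ hs₃ j1 hv₃) fun m₄ hf₄ h4 => ?_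
    have he₄ := he₃.frame hf₄ rfl
    have e4 : m₄.nat 4 = m₃.nat 4 := hf₄.nat 4 rfl
    have hl : lowSet n m₄ = lowSet n m₃ := by simp only [lowSet, e4]
    rw [← hl] at j2 j3 j4 h4
    have h5 : m₄.var 5 = k := (hf₄.var 5 rfl).trans hv₃
    refine ⟨fun ht => ⟨trivial, ?_⟩, fun ht => ?_⟩
    · simp only [Test.Holds, he₄.v1] at ht
      have hmem := h4.2.1 (by omega)
      have hset : ∀ a : Fin n, (((Instr.store 4 5 1).exec m₄).setVar 5 (k + 1)).nat 4 a =
          if a = ⟨k, hk⟩ then 1 else m₄.nat 4 a := by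
        intro a
        simp only [Instr.exec, Mem.setVar_nat, Mem.setNat_nat, if_true, h5, he₄.v1, Fin.ext_iff]
      have hsub : ∀ a, a ∈ lowSet n m₄ →
          a ∈ lowSet n (((Instr.store 4 5 1).exec m₄).setVar 5 (k + 1)) := by
        intro a ha
        change _ = 1
        rw [hset]
        split_ifs
        · rfl
        · exact ha
      refine ⟨fun a => ?_, fun a ha => ?_, fun a ha => hsub a (j3 ha), fun a ha hr => ?_⟩
      · rw [hset, e4]
        split_ifs
        · exact le_rfl
        · exact j1 a
      · have ha' := (hset a).symm.trans ha
        split_ifs at ha' with h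
        · subst h
          exact (G.pattern p q).pre_low_subset ((G.pattern p q).pre_mono j2 hmem)
        · exact j2 ha'
      · by_cases h : a = ⟨k, hk⟩
        · change _ = 1
          rw [hset, if_pos h]
        · have hak : a.1 ≠ k := fun h' => h (Fin.ext h')
          exact hsub a (j4 a (by omega) hr)
    · simp only [Test.Holds, he₄.v1] at ht
      have hmem : ¬ _ := fun h => ht (h4.2.2 h).ge
      refine ⟨fun a => by simpa [e4] using j1 a, j2, j3, fun a ha hr => ?_⟩
      by_cases h : a = ⟨k, hk⟩
      · subst h
        exact absurd ((G.pattern p q).pre_mono j3 hr) hmem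
      · have hak : a.1 ≠ k := fun h' => h (Fin.ext h')
        exact j4 a (by omega) hr
  · rintro m' _ ⟨i1, i2, i3⟩
    refine ⟨i1, Set.Subset.antisymm i2 ?_⟩
    have := (G.pattern p q).low_subset_reach
    rw [Fintype.card_fin] at this
    exact this.trans i3

end RealRAM

/-! ### Selecting the smallest approaching edge and shifting the potentials -/

namespace RealRAM

open EnergyGame Code SignGame

variable {n S : ℕ} {M : ℝ} {G : EnergyGame (Fin n)} {m m' : Mem} {p q : Fin n → ℝ}

/-- Decide whether an edge approaches zero. -/
def appCode : Code :=
  .op (.load 9 3 7) ;; .op (.load 11 4 5) ;; .op (.load 12 4 6) ;; .op (.const 10 0) ;;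
    .ite (.le 9 2) .skip (.ite (.le 9 1)
      (.ite (.le 1 11) (.ite (.le 12 2) (.op (.const 10 1)) .skip) .skip)
      (.ite (.le 4 9) (.ite (.le 11 2) (.ite (.le 1 12) (.op (.const 10 1)) .skip) .skip) .skip))

/-- Select the current edge. -/
def setCode : Code := .op (.add 14 7 2) ;; .op (.const 13 1)

/-- Select the current edge if it is smaller than the selected one. -/
def updateCode : Code :=
  .ite (.le 1 13)
    (.ite (.rle 5 14 5 7) (.ite (.rle 5 7 5 14) (.ite (.rle 6 14 6 7) .skip setCode) .skip) setCode)
    setCode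

/-- Select a smallest approaching edge. -/
def selectCode : Code :=
  .op (.const 13 0) ;;
    .rep 5 (.rep 6 (indexCode ;; appCode ;; .ite (.le 1 10) updateCode .skip))

theorem appCode_spec {c x y : ℕ} (h1 : m.var 1 = 1) (h2 : m.var 2 = 0) (h4 : m.var 4 = 3)
    (hc : m.nat 3 (m.var 7) = c) (hx : m.nat 4 (m.var 5) = x) (hy : m.nat 4 (m.var 6) = y) :
    appCode.wp n S M (fun m' => m'.var 10 =
      if (c = 1 ∧ 1 ≤ x ∧ y = 0) ∨ (3 ≤ c ∧ x = 0 ∧ 1 ≤ y) then 1 else 0) m := by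
  simp [appCode, wp, Instr.ok, Instr.exec, Test.Holds, h1, h2, h4, hc, hx, hy]
  repeat' first | apply And.intro | intro
  all_goals omega

/-- The lexicographic order. -/
def LexLe (d e : ℝ × ℝ) : Prop := d.1 < e.1 ∨ (d.1 = e.1 ∧ d.2 ≤ e.2)

theorem LexLe.refl (d : ℝ × ℝ) : LexLe d d := .inr ⟨rfl, le_rfl⟩

theorem LexLe.trans {d e f : ℝ × ℝ} (h1 : LexLe d e) (h2 : LexLe e f) : LexLe d f := by
  rcases h1 with h1 | h1 <;> rcases h2 with h2 | h2
  · exact .inl (h1.trans h2)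
  · exact .inl (h2.1 ▸ h1)
  · exact .inl (h1.1 ▸ h2)
  · exact .inr ⟨h1.1.trans h2.1, h1.2.trans h2.2⟩

theorem updateCode_spec {i j : ℕ} (h1 : m.var 1 = 1) (h2 : m.var 2 = 0) (hj : m.var 7 = j)
    (hi : m.var 14 = i) (h13 : m.var 13 ≤ 1) (hS : j ≤ S) :
    updateCode.wp n S M (fun m' => m'.var 13 = 1 ∧
      ((m.var 13 = 1 ∧ m'.var 14 = i ∧
        LexLe (m.real 5 i, m.real 6 i) (m.real 5 j, m.real 6 j)) ∨
       (m'.var 14 = j ∧ (m.var 13 = 1 →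
        LexLe (m.real 5 j, m.real 6 j) (m.real 5 i, m.real 6 i))))) m := by
  simp [updateCode, setCode, wp, Instr.ok, Instr.exec, Test.Holds, h1, h2, hj, hi, LexLe, hS]
  grind

/-- Variable `13` tells whether there are approaching edges, and variable `14` is the address of a
smallest one. -/
def Selected (G : EnergyGame (Fin n)) (p q : Fin n → ℝ) (P : Fin n → Fin n → Prop) (m : Mem) :
    Prop :=
  (m.var 13 = 0 ∧ ∀ a b, P a b → (a, b) ∉ (G.pattern p q).app) ∨
  (m.var 13 = 1 ∧ ∃ e ∈ (G.pattern p q).app, m.var 14 = n * e.1 + e.2 ∧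
    ∀ a b, P a b → (a, b) ∈ (G.pattern p q).app →
      LexLe (G.absCost p q e.1 e.2) (G.absCost p q a b))

theorem Selected.congr {P P' : Fin n → Fin n → Prop} (h : Selected G p q P m)
    (hP : ∀ a b, P' a b → P a b) (h13 : m'.var 13 = m.var 13) (h14 : m'.var 14 = m.var 14) :
    Selected G p q P' m' := by
  unfold Selected at *
  rw [h13, h14]
  rcases h with ⟨h1, h2⟩ | ⟨h1, e, he, h2, h3⟩
  · exact .inl ⟨h1, fun a b hab => h2 a b (hP a b hab)⟩
  · exact .inr ⟨h1, e, he, h2, fun a b hab => h3 a b (hP a b hab)⟩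

/-- This is a running minimum over the edges scanned so far; when the selection is replaced,
transitivity of `LexLe` carries minimality over. -/
theorem selectCode_spec (hS : n * n ≤ S) (he : Env G m) (hs : Signs G p q m)
    (h4 : ∀ a : Fin n, m.nat 4 a ≤ 1) (hl : lowSet n m = (G.pattern p q).low) :
    selectCode.wp n S M (Selected G p q fun _ _ => True) m := by
  refine ⟨trivial, ?_⟩
  have hf : Code.Frame (.op (.const 13 0)) m ((Instr.const 13 0).exec m) := .op _ _
  have h13 : ((Instr.const 13 0).exec m).var 13 = 0 := by simp [Instr.exec]
  generalize (Instr.const 13 0).exec m = m₁ at *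
  have he₁ := he.frame hf rfl
  have hs₁ := hs.frame hf rfl
  refine wp_rep (fun k => Selected G p q fun a _ => a < k) (.inl (by simp [h13])) ?_ ?_
  swap
  · exact fun m' _ h => h.congr (fun a _ _ => a.2) (by simp) (by simp)
  intro k hk m₂ hf₂ hv₂ hi₂
  have he₂ := he₁.frame hf₂ rfl
  have hs₂ := hs₁.frame hf₂ rfl
  refine wp_rep (fun l => Selected G p q fun a b => a < k ∨ (a.1 = k ∧ b < l)) ?_ ?_ ?_
  · exact hi₂.congr (fun a _ h => by omega) (by simp) (by simp)
  swap
  · exact fun m' _ h => h.congr (fun a b _ => by omega) (by simp) (by simp)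
  intro l hl' m₃ hf₃ hv₃ hi₃
  have he₃ := he₂.frame hf₃ rfl
  have hs₃ := hs₂.frame hf₃ rfl
  have h5₃ : m₃.var 5 = k := (hf₃.var 5 rfl).trans hv₂
  have e4₃ : m₃.nat 4 = m.nat 4 := by rw [hf₃.nat 4 rfl, hf₂.nat 4 rfl, hf.nat 4 rfl]
  refine wp_seq _ (indexCode_spec hS he₃.v0 (by omega) (by omega)) fun m₄ hf₄ h7 => ?_
  rw [h5₃, hv₃] at h7
  have he₄ := he₃.frame hf₄ rfl
  have hs₄ := hs₃.frame hf₄ rfl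
  have e4₄ : m₄.nat 4 = m.nat 4 := by rw [hf₄.nat 4 rfl, e4₃]
  have e5₄ : m₄.var 5 = k := (hf₄.var 5 rfl).trans h5₃
  have e6₄ : m₄.var 6 = l := (hf₄.var 6 rfl).trans hv₃
  refine wp_seq _ (appCode_spec he₄.v1 he₄.v2 he₄.v4 rfl rfl rfl) fun m₅ hf₅ h10 => ?_
  rw [h7, e4₄, e5₄, e6₄] at h10
  have he₅ := he₄.frame hf₅ rfl
  have hs₅ := hs₄.frame hf₅ rfl
  let a : Fin n := ⟨k, hk⟩
  let b : Fin n := ⟨l, hl'⟩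
  have hsel : Selected G p q (fun a b => a < k ∨ (a.1 = k ∧ b < l)) m₅ :=
    hi₃.congr (fun _ _ h => h) ((hf₅.var 13 rfl).trans (hf₄.var 13 rfl))
      ((hf₅.var 14 rfl).trans (hf₄.var 14 rfl))
  have happ : (m₄.nat 3 (n * k + l) = 1 ∧ 1 ≤ m.nat 4 k ∧ m.nat 4 l = 0 ∨
      3 ≤ m₄.nat 3 (n * k + l) ∧ m.nat 4 k = 0 ∧ 1 ≤ m.nat 4 l) ↔
      (a, b) ∈ (G.pattern p q).app := by
    have ha := h4 a
    have hb := h4 b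
    have hal : a ∈ (G.pattern p q).low ↔ m.nat 4 k = 1 := by rw [← hl]; rfl
    have hbl : b ∈ (G.pattern p q).low ↔ m.nat 4 l = 1 := by rw [← hl]; rfl
    have c1 := (hs₄ a b).sign
    have c2 := (hs₄ a b).none
    have hc := pattern_s_cases G p q a b
    simp only [a, b] at ha hb c1 c2 hc
    change _ ↔ ((a, b) ∈ G.edges ∧ _)
    simp only [hal, hbl]
    by_cases hE : (a, b) ∈ G.edges
    · have c3 := c1 hE
      simp only [a, b] at *
      simp only [hE, true_and]
      omega
    · have c3 := c2 hE
      simp only [hE, false_and, iff_false]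
      omega
  have hnew : ∀ P : Fin n → Fin n → Prop, P a b →
      (∀ a' b' : Fin n, (a' < k ∨ (a'.1 = k ∧ b' < l)) → P a' b') →
      ∀ a' b' : Fin n, (a' < k ∨ (a'.1 = k ∧ b' < l + 1)) → P a' b' := by
    intro P h1 h2 a' b' h3
    by_cases h : a'.1 < k ∨ (a'.1 = k ∧ b'.1 < l)
    · exact h2 a' b' h
    · obtain rfl : a' = a := Fin.ext (by simp only [a]; omega)
      obtain rfl : b' = b := Fin.ext (by simp only [b]; omega)
      exact h1
  classical
  rw [if_congr happ rfl rfl] at h10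
  refine ⟨fun ht => ?_, fun ht => ?_⟩
  · simp only [Test.Holds, he₅.v1] at ht
    have hab : (a, b) ∈ (G.pattern p q).app := by
      by_contra hc
      rw [if_neg hc] at h10
      omega
    have h7₅ : m₅.var 7 = n * k + l := (hf₅.var 7 rfl).trans h7
    have hlt := index_lt hk hl'
    refine wp_conseq (updateCode_spec he₅.v1 he₅.v2 h7₅ rfl ?_ (by omega)) fun m₆ hf₆ h6 => ?_
    · rcases hsel with h | h <;> omega
    have hcost := (hs₅ a b).cost hab.1
    simp only [a, b] at hcost
    rw [hcost] at h6
    refine .inr ⟨by simpa using h6.1, ?_⟩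
    simp only [Mem.setVar_var]
    rw [if_neg (by decide)]
    rcases hsel with ⟨h13', hnone⟩ | ⟨h13', e, hea, h14, hmin⟩
    · rcases h6.2 with h | h
      · omega
      · refine ⟨(a, b), hab, h.1, hnew _ (fun _ => .refl _) fun a' b' h1 h2 => ?_⟩
        exact absurd h2 (hnone a' b' h1)
    · have hcost' := (hs₅ e.1 e.2).cost hea.1
      rw [h14, hcost'] at h6
      rcases h6.2 with h | h
      · exact ⟨e, hea, h.2.1, hnew _ (fun _ => h.2.2) hmin⟩
      · exact ⟨(a, b), hab, h.1, hnew _ (fun _ => .refl _) fun a' b' h1 h2 =>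
          (h.2 h13').trans (hmin a' b' h1 h2)⟩
  · simp only [Test.Holds, he₅.v1] at ht
    have hab : (a, b) ∉ (G.pattern p q).app := by
      intro hc
      rw [if_pos hc] at h10
      omega
    rcases hsel with ⟨h13', hnone⟩ | ⟨h13', e, hea, h14, hmin⟩
    · exact .inl ⟨by simpa using h13', hnew _ hab hnone⟩
    · exact .inr ⟨by simpa using h13', e, hea, by simpa using h14, hnew _ (fun h => absurd h hab) hmin⟩

/-- Raise the potentials in array `ar` of the nodes outside the set in array `4`, relative to the
others, by the number with the selected address in array `dr`. -/
def shiftCode (ar dr : ℕ) : Code :=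
  .rep 5 (.op (.load 11 4 5) ;; .ite (.le 11 2)
    (.ite (.rle 7 2 dr 14) (.op (.radd ar 5 ar 5 dr 14)) .skip)
    (.ite (.rle dr 14 7 2) (.op (.rsub ar 5 ar 5 dr 14)) .skip))

/-- The second component of a lexicographically positive pair may be negative, so `d` can have
either sign. Only the side that has to be raised is touched: the complement if `d` is positive, the
set itself if `d` is negative. This keeps potentials non-negative. -/
theorem shiftCode_spec {ar dr : ℕ} (har : (ar = 1 ∧ dr = 5) ∨ (ar = 2 ∧ dr = 6)) {p : Fin n → ℝ}
    {d R : ℝ} (he : Env G m) (h4 : ∀ a : Fin n, m.nat 4 a ≤ 1) (hd : m.real dr (m.var 14) = d)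
    (hp : ∀ a : Fin n, m.real ar a = p a) (h0 : ∀ a, 0 ≤ p a) (hR : ∀ a, p a ≤ R)
    (hM : R + |d| ≤ M) :
    (shiftCode ar dr).wp n S M (fun m' => ∃ p' : Fin n → ℝ, (∀ a : Fin n, m'.real ar a = p' a) ∧
      (∀ a, 0 ≤ p' a) ∧ (∀ a, p' a ≤ R + |d|) ∧ Shift (lowSet n m) d p p') m := by
  classical
  let p' : Fin n → ℝ := fun a => p a + if a ∈ lowSet n m then max (-d) 0 else max d 0
  have hp'0 : ∀ a, 0 ≤ p' a := by
    intro a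
    have := h0 a
    simp only [p']
    split_ifs
    · have := le_max_right (-d) 0; linarith
    · have := le_max_right d 0; linarith
  have hp'R : ∀ a, p' a ≤ R + |d| := by
    intro a
    have := hR a
    have h2 : max (-d) 0 ≤ |d| := max_le (neg_le_abs d) (abs_nonneg d)
    have h3 : max d 0 ≤ |d| := max_le (le_abs_self d) (abs_nonneg d)
    simp only [p']
    split_ifs <;> linarith
  have hshift : Shift (lowSet n m) d p p' := by
    constructor
    · intro a b hab
      simp only [p']
      by_cases h : a ∈ lowSet n m
      · rw [if_pos h, if_pos (hab.1 h)]; ring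
      · rw [if_neg h, if_neg fun h' => h (hab.2 h')]; ring
    · intro a b ha hb
      simp only [p']
      rw [if_pos ha, if_neg hb]
      rcases le_total 0 d with h | h
      · rw [max_eq_left h, max_eq_right (by linarith)]; ring
      · rw [max_eq_right h, max_eq_left (by linarith)]; ring
  refine wp_rep (fun k m' => ∀ a : Fin n, m'.real ar a = if a < k then p' a else p a) ?_ ?_ ?_
  · intro a; simp [hp]
  · intro k hk m₁ hf₁ hv₁ hi₁
    have he₁ := he.frame hf₁ (by rcases har with ⟨rfl, rfl⟩ | ⟨rfl, rfl⟩ <;> rfl)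
    have e4 : m₁.nat 4 = m.nat 4 :=
      hf₁.nat 4 (by rcases har with ⟨rfl, rfl⟩ | ⟨rfl, rfl⟩ <;> rfl)
    have e14 : m₁.var 14 = m.var 14 :=
      hf₁.var 14 (by rcases har with ⟨rfl, rfl⟩ | ⟨rfl, rfl⟩ <;> rfl)
    have edr : m₁.real dr = m.real dr :=
      hf₁.real dr (by rcases har with ⟨rfl, rfl⟩ | ⟨rfl, rfl⟩ <;> rfl)
    have hk1 := hi₁ ⟨k, hk⟩
    simp only [lt_irrefl, if_false] at hk1
    have hmem : (⟨k, hk⟩ : Fin n) ∈ lowSet n m ↔ m.nat 4 k = 1 := Iff.rfl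
    have h4k := h4 ⟨k, hk⟩
    simp only at h4k
    have hpk : ∀ r, r = p' ⟨k, hk⟩ → ∀ a : Fin n,
        ((m₁.setReal ar k r).real ar a = if a.1 < k + 1 then p' a else p a) := by
      rintro r rfl a
      simp only [Mem.setReal_real, if_true]
      by_cases h : a.1 = k
      · obtain rfl : a = ⟨k, hk⟩ := Fin.ext h
        simp
      · rw [if_neg h, hi₁ a]
        simp only [show a.1 < k + 1 ↔ a.1 < k by omega]
    have hpk' : p' ⟨k, hk⟩ = p ⟨k, hk⟩ → ∀ a : Fin n,
        (m₁.real ar a = if a.1 < k + 1 then p' a else p a) := by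
      intro hr a
      rw [hi₁ a]
      by_cases h : a.1 = k
      · obtain rfl : a = ⟨k, hk⟩ := Fin.ext h
        simp [hr]
      · simp only [show a.1 < k + 1 ↔ a.1 < k by omega]
    have habs := hp'R ⟨k, hk⟩
    have habs0 := hp'0 ⟨k, hk⟩
    have h2₁ := he₁.v2
    have hz₁ := he₁.zero
    simp only [← edr] at hd
    simp only [wp, Instr.ok, Instr.exec, Test.Holds, true_and]
    generalize hm₂ : m₁.setVar 11 (m₁.nat 4 (m₁.var 5)) = m₂
    have w11 : m₂.var 11 = m.nat 4 k := by simp [← hm₂, hv₁, e4]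
    have w2 : m₂.var 2 = 0 := by simp [← hm₂, h2₁]
    have w5 : m₂.var 5 = k := by simp [← hm₂, hv₁]
    have w14 : m₂.var 14 = m.var 14 := by simp [← hm₂, e14]
    have wr : m₂.real = m₁.real := by simp [← hm₂]
    have ws : ∀ r, ((m₂.setReal ar k r).setVar 5 (k + 1)).real = (m₁.setReal ar k r).real := by
      intro r; simp [← hm₂]; rfl
    simp only [w11, w2, w5, w14, wr, hz₁, hd, hk1, ws, Mem.setVar_real]
    refine ⟨fun hx => ⟨fun h => ?_, fun h => ?_⟩, fun hx => ⟨fun h => ?_, fun h => ?_⟩⟩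
    · have hval : p ⟨k, hk⟩ + d = p' ⟨k, hk⟩ := by
        simp only [p', hmem]
        rw [if_neg (by omega), max_eq_left h]
      exact ⟨by rw [hval, abs_of_nonneg habs0]; linarith, hpk _ hval⟩
    · refine hpk' ?_
      simp only [p', hmem]
      rw [if_neg (by omega), max_eq_right (by linarith), add_zero]
    · have hval : p ⟨k, hk⟩ - d = p' ⟨k, hk⟩ := by
        simp only [p', hmem]
        rw [if_pos (by omega), max_eq_left (by linarith)]
        ring
      exact ⟨by rw [hval, abs_of_nonneg habs0]; linarith, hpk _ hval⟩
    · refine hpk' ?_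
      simp only [p', hmem]
      rw [if_pos (by omega), max_eq_right (by linarith), add_zero]
  · intro m' _ h
    refine ⟨p', fun a => ?_, hp'0, hp'R, hshift⟩
    have := h a
    rw [if_pos a.2] at this
    exact this

end RealRAM

/-! ### Compressing the potentials -/

namespace RealRAM

open EnergyGame Code SignGame

variable {n S : ℕ} {M : ℝ} {G : EnergyGame (Fin n)} {m m' : Mem} {φ : Fin n → ℝ} {ar br : ℕ}

/-- Select the current node. -/
def setNodeCode : Code := .op (.add 16 5 2) ;; .op (.const 13 1)

/-- Select a node of smallest potential above the current threshold. -/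
def findCode (ar : ℕ) : Code :=
  .op (.const 13 0) ;; .rep 5 (.ite (.rle ar 5 9 2) .skip
    (.ite (.le 1 13) (.ite (.rle ar 5 ar 16) setNodeCode .skip) setNodeCode))

/-- Lower the potentials above the threshold such that the gap at the threshold is not larger than
the number in array `br`, and move the threshold to the other side of the gap. -/
def squeezeCode (ar br : ℕ) : Code :=
  .op (.rsub 10 2 ar 16 9 2) ;;
    .ite (.rle 10 2 br 2) .skip (.op (.rsub 10 2 10 2 br 2) ;;
      .rep 5 (.ite (.rle ar 5 9 2) .skip (.op (.rsub ar 5 ar 5 10 2)))) ;;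
    .op (.rcopy 9 2 ar 16)

/-- Reduce all gaps between potentials. -/
def compressCode (ar br : ℕ) : Code :=
  .op (.rcopy 9 2 7 2) ;; .rep 8 (findCode ar ;; .ite (.le 1 13) (squeezeCode ar br) .skip)

theorem findCode_spec {c : ℝ} (hS : n ≤ S) (he : Env G m) (hφ : ∀ a : Fin n, m.real ar a = φ a)
    (hc : m.real 9 0 = c) :
    (findCode ar).wp n S M (fun m' => (m'.var 13 = 0 ∧ ∀ a, φ a ≤ c) ∨
      (m'.var 13 = 1 ∧ ∃ i : Fin n, m'.var 16 = i ∧ c < φ i ∧ ∀ a, c < φ a → φ i ≤ φ a)) m := by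
  refine ⟨trivial, ?_⟩
  have hf : Code.Frame (.op (.const 13 0)) m ((Instr.const 13 0).exec m) := .op _ _
  have h13 : ((Instr.const 13 0).exec m).var 13 = 0 := by simp [Instr.exec]
  generalize (Instr.const 13 0).exec m = m₁ at *
  have he₁ := he.frame hf rfl
  have er := hf.real ar rfl
  have er9 := hf.real 9 rfl
  refine wp_rep (fun k m' => (m'.var 13 = 0 ∧ ∀ a : Fin n, a < k → φ a ≤ c) ∨
      (m'.var 13 = 1 ∧ ∃ i : Fin n, m'.var 16 = i ∧ c < φ i ∧ ∀ a : Fin n, a < k → c < φ a →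
        φ i ≤ φ a)) (.inl (by simp [h13])) ?_ ?_
  swap
  · rintro m' - (⟨h1, h2⟩ | ⟨h1, i, h2, h3, h4⟩)
    · exact .inl ⟨by simpa using h1, fun a => h2 a a.2⟩
    · exact .inr ⟨by simpa using h1, i, by simpa using h2, h3, fun a => h4 a a.2⟩
  intro k hk m₂ hf₂ hv₂ hi₂
  have he₂ := he₁.frame hf₂ rfl
  have h9 : m₂.real 9 0 = c := by rw [hf₂.real 9 rfl, er9, hc]
  have har : ∀ a : Fin n, m₂.real ar a = φ a := by
    intro a; rw [hf₂.real ar rfl, er, hφ]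
  let a : Fin n := ⟨k, hk⟩
  have hk' : m₂.real ar k = φ a := har a
  have hlt : ∀ P : Fin n → Prop, (∀ b : Fin n, b < k → P b) → P a → ∀ b : Fin n, b < k + 1 → P b := by
    intro P h1 h2 b hb
    by_cases h : b = a
    · exact h ▸ h2
    · have : b.1 ≠ k := fun h' => h (Fin.ext h')
      exact h1 b (by omega)
  refine ⟨fun ht => ?_, fun ht => ?_⟩ <;>
    simp only [Test.Holds, hv₂, he₂.v2, h9, hk'] at ht
  · rcases hi₂ with ⟨h1, h2⟩ | ⟨h1, i, h2, h3, h4⟩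
    · exact .inl ⟨by simpa using h1, hlt _ h2 ht⟩
    · exact .inr ⟨by simpa using h1, i, by simpa using h2, h3, hlt _ h4 fun h => by linarith⟩
  · have hnew : (∀ b : Fin n, b < k → c < φ b → φ a ≤ φ b) →
        setNodeCode.wp n S M (fun m' => ((m'.setVar 5 (k + 1)).var 13 = 0 ∧
          ∀ a : Fin n, a < k + 1 → φ a ≤ c) ∨ ((m'.setVar 5 (k + 1)).var 13 = 1 ∧ ∃ i : Fin n,
          (m'.setVar 5 (k + 1)).var 16 = i ∧ c < φ i ∧ ∀ a : Fin n, a < k + 1 → c < φ a →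
          φ i ≤ φ a)) m₂ := by
      intro h
      refine ⟨?_, trivial, .inr ⟨by simp [Instr.exec], a, ?_, not_le.1 ht, hlt _ h fun _ => le_rfl⟩⟩
      · simp only [Instr.ok, hv₂, he₂.v2]; omega
      · simp [Instr.exec, hv₂, he₂.v2, a]
    refine ⟨fun h13 => ⟨fun hle => hnew ?_, fun hle => ?_⟩, fun h13 => hnew ?_⟩ <;>
      simp only [Test.Holds, he₂.v1] at h13
    · rcases hi₂ with ⟨h1, h2⟩ | ⟨h1, i, h2, h3, h4⟩
      · omega
      · simp only [Test.Holds, hv₂, h2, har, hk'] at hle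
        exact fun b hb hcb => hle.trans (h4 b hb hcb)
    · rcases hi₂ with ⟨h1, h2⟩ | ⟨h1, i, h2, h3, h4⟩
      · omega
      · simp only [Test.Holds, hv₂, h2, har, hk'] at hle
        exact .inr ⟨by simpa using h1, i, by simpa using h2, h3, hlt _ h4 fun _ => by linarith⟩
    · rcases hi₂ with ⟨h1, h2⟩ | ⟨h1, _⟩
      · exact fun b hb hcb => absurd (h2 b hb) (not_le.2 hcb)
      · omega

/-- With `max _ 0` as the amount, one formula covers both a gap that is cut and a gap that is
already at most `B`. -/
theorem squeezeCode_spec {c B : ℝ} {i : Fin n} (har : (ar = 1 ∧ br = 3) ∨ (ar = 2 ∧ br = 4))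
    (he : Env G m) (hφ : ∀ a : Fin n, m.real ar a = φ a) (hc : m.real 9 0 = c)
    (hB : m.real br 0 = B) (hB0 : 0 ≤ B) (h16 : m.var 16 = i) (hc0 : 0 ≤ c) (hci : c < φ i)
    (hmin : ∀ a, c < φ a → φ i ≤ φ a) (hM : ∀ a, φ a ≤ M) :
    (squeezeCode ar br).wp n S M (fun m' =>
      (∀ a : Fin n, m'.real ar a = φ a - if c < φ a then max (φ i - c - B) 0 else 0) ∧
      m'.real 9 0 = φ i - max (φ i - c - B) 0) m := by
  have h2 := he.v2
  have hMi := hM i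
  have hne : ar ≠ 10 ∧ ar ≠ 9 ∧ br ≠ 10 ∧ br ≠ ar := by omega
  refine wp_seq (fun m' => m'.real 10 0 = φ i - c) ?_ fun m₁ hf₁ h10 => ?_
  · simp only [wp, Instr.ok, Instr.exec, h2, h16, hφ, hc, Mem.setReal_real, if_true, and_true]
    rw [abs_le]; constructor <;> linarith
  have he₁ := he.frame hf₁ rfl
  have h16₁ : m₁.var 16 = i := (hf₁.var 16 rfl).trans h16
  have hc₁ : m₁.real 9 0 = c := by rw [hf₁.real 9 rfl, hc]
  have hB₁ : m₁.real br 0 = B := by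
    rw [hf₁.real br (by rcases har with ⟨rfl, rfl⟩ | ⟨rfl, rfl⟩ <;> rfl), hB]
  have hφ₁ : ∀ a : Fin n, m₁.real ar a = φ a := by
    intro a; rw [hf₁.real ar (by rcases har with ⟨rfl, rfl⟩ | ⟨rfl, rfl⟩ <;> rfl), hφ]
  refine wp_seq (fun m' => ∀ a : Fin n,
    m'.real ar a = φ a - if c < φ a then max (φ i - c - B) 0 else 0) ?_ fun m₂ hf₂ h => ?_
  · refine ⟨fun ht => ?_, fun ht => ?_⟩ <;> simp only [Test.Holds, he₁.v2, h10, hB₁] at ht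
    · intro a
      rw [max_eq_right (by linarith), ite_self, sub_zero]
      exact hφ₁ a
    · refine wp_seq (fun m' => m'.real 10 0 = φ i - c - B) ?_ fun m₂ hf₂ h10₂ => ?_
      · simp only [wp, Instr.ok, Instr.exec, he₁.v2, h10, hB₁, Mem.setReal_real, if_true, and_true]
        rw [abs_le]; constructor <;> linarith
      have he₂ := he₁.frame hf₂ rfl
      have hc₂ : m₂.real 9 0 = c := by rw [hf₂.real 9 rfl, hc₁]
      have hφ₂ : ∀ a : Fin n, m₂.real ar a = φ a := by
        intro a; rw [hf₂.real ar (by rcases har with ⟨rfl, rfl⟩ | ⟨rfl, rfl⟩ <;> rfl), hφ₁]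
      refine wp_rep (fun k m' => ∀ a : Fin n, m'.real ar a =
        φ a - if a < k ∧ c < φ a then max (φ i - c - B) 0 else 0) ?_ ?_ ?_
      · intro a; simp [hφ₂]
      swap
      · intro m' _ h a
        simpa using h a
      intro k hk m₃ hf₃ hv₃ hi₃
      have he₃ := he₂.frame hf₃ (by rcases har with ⟨rfl, rfl⟩ | ⟨rfl, rfl⟩ <;> rfl)
      have hc₃ : m₃.real 9 0 = c := by
        rw [hf₃.real 9 (by rcases har with ⟨rfl, rfl⟩ | ⟨rfl, rfl⟩ <;> rfl), hc₂]
      have h10₃ : m₃.real 10 0 = φ i - c - B := by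
        rw [hf₃.real 10 (by rcases har with ⟨rfl, rfl⟩ | ⟨rfl, rfl⟩ <;> rfl), h10₂]
      have hk' := hi₃ ⟨k, hk⟩
      simp only [lt_irrefl, false_and, if_false, sub_zero] at hk'
      have hmk := hM ⟨k, hk⟩
      have hmink := hmin ⟨k, hk⟩
      have hold : ∀ a : Fin n, a.1 ≠ k → m₃.real ar a =
          φ a - if a.1 < k + 1 ∧ c < φ a then max (φ i - c - B) 0 else 0 := by
        intro a ha
        rw [hi₃ a]
        simp only [show a.1 < k + 1 ↔ a.1 < k by omega]
      refine ⟨fun ht => ?_, fun ht => ⟨?_, ?_⟩⟩ <;>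
        simp only [Test.Holds, hv₃, he₃.v2, hc₃, hk'] at ht
      · intro a
        by_cases ha : a.1 = k
        · obtain rfl : a = ⟨k, hk⟩ := Fin.ext ha
          simp only [Mem.setVar_real, hk']
          rw [if_neg fun h => not_lt.2 ht h.2, sub_zero]
        · exact hold a ha
      · have := hmink (by linarith)
        simp only [Instr.ok, hv₃, he₃.v2, hk', h10₃]
        rw [abs_le]; constructor <;> linarith
      · intro a
        simp only [Instr.exec, hv₃, he₃.v2, h10₃, hk', Mem.setVar_real, Mem.setReal_real, if_true]
        by_cases ha : a.1 = k
        · obtain rfl : a = ⟨k, hk⟩ := Fin.ext ha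
          rw [if_pos rfl, if_pos ⟨Nat.lt_succ_self _, not_le.1 ht⟩, max_eq_left (by linarith)]
        · rw [if_neg ha]
          exact hold a ha
  · have h2₂ : m₂.var 2 = 0 :=
      (hf₂.var 2 (by rcases har with ⟨rfl, rfl⟩ | ⟨rfl, rfl⟩ <;> rfl)).trans he₁.v2
    have h16₂ : m₂.var 16 = i :=
      (hf₂.var 16 (by rcases har with ⟨rfl, rfl⟩ | ⟨rfl, rfl⟩ <;> rfl)).trans h16₁
    refine ⟨trivial, fun a => ?_, ?_⟩
    · simp only [Instr.exec, Mem.setReal_real, if_neg hne.2.1]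
      exact h a
    · simp only [Instr.exec, h2₂, h16₂, Mem.setReal_real, if_true]
      rw [h i, if_pos hci]

/-- Only differences across the threshold change. They are at least the gap `φ i - c`, and if the
gap is cut at all, both the old and the new difference are at least `B`. -/
theorem compat_squeeze {c B : ℝ} {i : Fin n} (hmin : ∀ a, c < φ a → φ i ≤ φ a) :
    Compat B φ fun a => φ a - if c < φ a then max (φ i - c - B) 0 else 0 := by
  intro a b
  by_cases ha : c < φ a <;> by_cases hb : c < φ b
  · left; simp only [if_pos ha, if_pos hb]; ring
  · have := hmin a ha
    rcases le_total (φ i - c - B) 0 with h | h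
    · left; simp [max_eq_right h]
    · right; right
      simp only [if_pos ha, if_neg hb, max_eq_left h]
      constructor <;> linarith
  · have := hmin b hb
    rcases le_total (φ i - c - B) 0 with h | h
    · left; simp [max_eq_right h]
    · right; left
      simp only [if_pos hb, if_neg ha, max_eq_left h]
      constructor <;> linarith
  · left; simp [if_neg ha, if_neg hb]

theorem compressCode_spec {B : ℝ} (har : (ar = 1 ∧ br = 3) ∨ (ar = 2 ∧ br = 4)) (hS : n ≤ S)
    (he : Env G m) (hφ : ∀ a : Fin n, m.real ar a = φ a) (hB : m.real br 0 = B) (hB0 : 0 < B)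
    (h0 : ∀ a, 0 ≤ φ a) (hM : ∀ a, φ a ≤ M) :
    (compressCode ar br).wp n S M (fun m' => ∃ p : Fin n → ℝ, (∀ a : Fin n, m'.real ar a = p a) ∧
      (∀ a, 0 ≤ p a) ∧ (∀ a, p a ≤ n * B) ∧ Compat B φ p) m := by
  classical
  refine wp_seq (fun m' => m'.real 9 0 = 0) ?_ fun m₁ hf₁ h9 => ?_
  · simp [wp, Instr.ok, Instr.exec, he.v2, he.zero]
  have he₁ := he.frame hf₁ rfl
  have hB₁ : m₁.real br 0 = B := by
    rw [hf₁.real br (by rcases har with ⟨rfl, rfl⟩ | ⟨rfl, rfl⟩ <;> rfl), hB]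
  have hφ₁ : ∀ a : Fin n, m₁.real ar a = φ a := by
    intro a; rw [hf₁.real ar (by rcases har with ⟨rfl, rfl⟩ | ⟨rfl, rfl⟩ <;> rfl), hφ]
  -- After `r` rounds the threshold is at most `r * B` and at least `r` nodes are not above it.
  -- After `n` rounds no node is left above, so all potentials are at most `n * B`.
  refine wp_rep (fun r m' => ∃ (p : Fin n → ℝ) (c : ℝ), (∀ a : Fin n, m'.real ar a = p a) ∧
    m'.real 9 0 = c ∧ 0 ≤ c ∧ c ≤ r * B ∧ (∀ a, 0 ≤ p a) ∧ (∀ a, p a ≤ M) ∧ Compat B φ p ∧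
    (Finset.univ.filter fun a => c < p a).card + r ≤ n) ?_ ?_ ?_
  · refine ⟨φ, 0, hφ₁, h9, le_rfl, by simp, h0, hM, .refl _ _, ?_⟩
    have := Finset.card_filter_le (Finset.univ : Finset (Fin n)) fun a => 0 < φ a
    simpa using this
  swap
  · rintro m' - ⟨p, c, h1, -, -, h2, h3, -, h4, h5⟩
    refine ⟨p, h1, h3, fun a => ?_, h4⟩
    have : (Finset.univ.filter fun a => c < p a) = ∅ := Finset.card_eq_zero.1 (by omega)
    by_contra hlt
    have ha : a ∈ (Finset.univ.filter fun a => c < p a) := by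
      simp only [Finset.mem_filter, Finset.mem_univ, true_and]; linarith
    rw [this] at ha
    simp at ha
  rintro r hr m₂ hf₂ hv₂ ⟨p, c, h1, h2, h3, h4, h5, h6, h7, h8⟩
  have he₂ := he₁.frame hf₂ (by rcases har with ⟨rfl, rfl⟩ | ⟨rfl, rfl⟩ <;> rfl)
  have hB₂ : m₂.real br 0 = B := by
    rw [hf₂.real br (by rcases har with ⟨rfl, rfl⟩ | ⟨rfl, rfl⟩ <;> rfl), hB₁]
  refine wp_seq _ (findCode_spec hS he₂ h1 h2) fun m₃ hf₃ h13 => ?_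
  have he₃ := he₂.frame hf₃ rfl
  have h1₃ : ∀ a : Fin n, m₃.real ar a = p a := by intro a; rw [hf₃.real ar rfl, h1]
  have h2₃ : m₃.real 9 0 = c := by rw [hf₃.real 9 rfl, h2]
  have hB₃ : m₃.real br 0 = B := by rw [hf₃.real br rfl, hB₂]
  refine ⟨fun ht => ?_, fun ht => ?_⟩ <;> simp only [Test.Holds, he₃.v1] at ht
  · rcases h13 with ⟨h, -⟩ | ⟨-, i, hi, hci, hmin⟩
    · omega
    refine wp_conseq (squeezeCode_spec har he₃ h1₃ h2₃ hB₃ hB0.le hi h3 hci hmin h6)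
      fun m₄ hf₄ ⟨k1, k2⟩ => ?_
    have hd0 : 0 ≤ max (p i - c - B) 0 := le_max_right _ _
    have hd1 : max (p i - c - B) 0 ≤ p i - c := max_le (by linarith) (by linarith)
    have hd2 : p i - c - B ≤ max (p i - c - B) 0 := le_max_left _ _
    refine ⟨_, _, k1, k2, by linarith, by push_cast; linarith, fun a => ?_, fun a => ?_,
      h7.trans hB0 (compat_squeeze hmin), ?_⟩
    · split_ifs with h
      · have := hmin a h; linarith
      · linarith [h5 a]
    · have := h6 a
      split_ifs <;> linarith
    · have hss : (Finset.univ.filter fun a => p i - max (p i - c - B) 0 <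
          p a - if c < p a then max (p i - c - B) 0 else 0) ⊂
          Finset.univ.filter fun a => c < p a := by
        rw [Finset.ssubset_iff_of_subset]
        · exact ⟨i, by simp [hci], by simp [hci]⟩
        · intro a
          simp only [Finset.mem_filter, Finset.mem_univ, true_and]
          intro h
          by_contra hc
          rw [if_neg hc] at h
          linarith
      have := Finset.card_lt_card hss
      omega
  · rcases h13 with ⟨-, h⟩ | ⟨h, -⟩
    · refine ⟨p, c, h1₃, h2₃, h3, by push_cast; linarith, h5, h6, h7, ?_⟩
      have : (Finset.univ.filter fun a => c < p a) = ∅ := by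
        ext a; simpa using h a
      rw [this]
      simp only [Finset.card_empty]
      omega
    · omega

end RealRAM

/-! ### One round of the algorithm, and the output -/

namespace RealRAM

open EnergyGame Code SignGame

variable {n S : ℕ} {M : ℝ} {G : EnergyGame (Fin n)} {m m' : Mem} {p q : Fin n → ℝ}

/-- One step of the algorithm, without the search for the selected edge. -/
def moveCode : Code :=
  shiftCode 1 5 ;; shiftCode 2 6 ;; compressCode 1 3 ;; compressCode 2 4

/-- One step of the algorithm. Variable `15` becomes zero if no edge approaches zero. -/
def bodyCode : Code :=
  signsCode ;; lowCode ;; selectCode ;; .ite (.le 1 13) moveCode (.op (.const 15 0))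

/-- Write the complement of the set in array `4` to array `2`. -/
def outputCode : Code :=
  .rep 5 (.op (.load 11 4 5) ;; .op (.sub 11 1 11) ;; .op (.store 2 5 11))

/-- Compute the constants. -/
def initCode : Code :=
  .op (.const 3 2) ;; .op (.const 4 3) ;; .op (.const 15 1) ;; .op (.rone 8 2) ;;
    .op (.radd 4 2 8 2 8 2) ;; .op (.rcopy 3 2 8 2) ;;
    .rep 5 (.rep 6 (indexCode ;;
      .ite (.rle 7 2 0 7) (.op (.radd 3 2 3 2 0 7)) (.op (.rsub 3 2 3 2 0 7))))

/-- The potentials between shifting and compressing are the witnesses `p₁`, `q₁` of `Step`. They may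
exceed the bounds in `Pot` but not `limit`; compressing restores `Pot`. -/
theorem moveCode_spec (hS : n * n ≤ S) (he : Env G m) (hs : Signs G p q m) (hp : Pot G p q m)
    (h4 : ∀ a : Fin n, m.nat 4 a ≤ 1) (hl : lowSet n m = (G.pattern p q).low)
    {e : Fin n × Fin n} (hea : e ∈ (G.pattern p q).app) (h14 : m.var 14 = n * e.1 + e.2)
    (hmin : ∀ a b, (a, b) ∈ (G.pattern p q).app →
      LexLe (G.absCost p q e.1 e.2) (G.absCost p q a b)) :
    moveCode.wp n S G.limit (fun m' => ∃ p' q', Pot G p' q' m' ∧ G.Step p q p' q') m := by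
  have hn : 0 < n := e.1.pos
  have hnS : n ≤ S := (Nat.le_mul_of_pos_left n hn).trans hS
  have hB := G.one_le_bound
  have hlim : G.limit = 4 * (n * G.bound) + 8 * n + 4 * G.bound + 8 := by
    unfold EnergyGame.limit; ring
  have hnn : (0 : ℝ) ≤ n := Nat.cast_nonneg n
  have hnB : 0 ≤ (n : ℝ) * G.bound := by positivity
  have hcell := hs e.1 e.2
  have hc := hcell.cost hea.1
  have hc1 : m.real 5 (m.var 14) = (G.absCost p q e.1 e.2).1 := by rw [h14, ← hc]
  have hc2 : m.real 6 (m.var 14) = (G.absCost p q e.1 e.2).2 := by rw [h14, ← hc]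
  have l1 := hcell.le₁
  have l2 := hcell.le₂
  rw [← h14, hc1] at l1
  rw [← h14, hc2] at l2
  refine wp_seq _ (shiftCode_spec (.inl ⟨rfl, rfl⟩) he h4 hc1 hp.eq₁ hp.p_nonneg hp.p_le ?_)
    fun m₁ hf₁ ⟨p₁, hp₁, p0, pl, psh⟩ => ?_
  · linarith
  have he₁ := he.frame hf₁ rfl
  have e2 : m₁.real 2 = m.real 2 := hf₁.real 2 rfl
  refine wp_seq _ (shiftCode_spec (p := q) (d := (G.absCost p q e.1 e.2).2) (R := n * 2)
    (.inr ⟨rfl, rfl⟩) he₁ ?_ ?_ ?_ hp.q_nonneg hp.q_le ?_)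
    fun m₂ hf₂ ⟨q₁, hq₁, q0, ql, qsh⟩ => ?_
  · rw [hf₁.nat 4 rfl]; exact h4
  · rw [hf₁.real 6 rfl, hf₁.var 14 rfl, hc2]
  · rw [e2]; exact hp.eq₂
  · linarith
  have he₂ := he₁.frame hf₂ rfl
  have hl₁ : lowSet n m₁ = (G.pattern p q).low := by
    rw [← hl]; unfold lowSet; rw [hf₁.nat 4 rfl]
  rw [hl] at psh
  rw [hl₁] at qsh
  refine wp_seq _ (compressCode_spec (φ := p₁) (B := G.bound) (.inl ⟨rfl, rfl⟩) hnS he₂ ?_ he₂.bound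
    (by linarith) p0 fun a => (pl a).trans ?_) fun m₃ hf₃ ⟨p', hp', p0', pl', pc⟩ => ?_
  · rw [hf₂.real 1 rfl]; exact hp₁
  · linarith
  have he₃ := he₂.frame hf₃ rfl
  refine wp_conseq (compressCode_spec (φ := q₁) (B := 2) (.inr ⟨rfl, rfl⟩) hnS he₃ ?_ he₃.two
    (by norm_num) q0 fun a => (ql a).trans ?_) fun m₄ hf₄ ⟨q', hq', q0', ql', qc⟩ => ?_
  · rw [hf₃.real 2 rfl]; exact hq₁
  · linarith
  refine ⟨p', q', ⟨?_, hq', p0', q0', pl', ql'⟩, ⟨⟨G.bound, e, p₁, q₁, hea, ?_, psh, qsh, pc, qc,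
    fun e he => G.abs_weight_lt he⟩⟩⟩
  · rw [hf₄.real 1 rfl]; exact hp'
  · exact fun e' he' => hmin e'.1 e'.2 he'

theorem bodyCode_spec (hS : n * n ≤ S) (he : Env G m) (hp : Pot G p q m) :
    bodyCode.wp n S G.limit (fun m' =>
      (m'.var 15 = m.var 15 ∧ ∃ p' q', Pot G p' q' m' ∧ G.Step p q p' q') ∨
      (m'.var 15 = 0 ∧ (G.pattern p q).app = ∅ ∧ (∀ a : Fin n, m'.nat 4 a ≤ 1) ∧
        lowSet n m' = (G.pattern p q).low)) m := by
  refine wp_seq _ (signsCode_spec hS he hp) fun m₁ hf₁ hs => ?_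
  have he₁ := he.frame hf₁ rfl
  refine wp_seq _ (lowCode_spec hS he₁ hs) fun m₂ hf₂ ⟨h4, hl⟩ => ?_
  have he₂ := he₁.frame hf₂ rfl
  have hs₂ : Signs G p q m₂ := Signs.frame hs hf₂ rfl
  refine wp_seq _ (selectCode_spec hS he₂ hs₂ h4 hl) fun m₃ hf₃ h => ?_
  have he₃ := he₂.frame hf₃ rfl
  have hs₃ : Signs G p q m₃ := hs₂.frame hf₃ rfl
  have hl₃ : lowSet n m₃ = (G.pattern p q).low := by
    rw [← hl]; unfold lowSet; rw [hf₃.nat 4 rfl]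
  rw [← hf₃.nat 4 rfl] at h4
  refine ⟨fun ht => ?_, fun ht => ⟨trivial, .inr ?_⟩⟩ <;> simp only [Test.Holds, he₃.v1] at ht
  · rcases h with ⟨h, -⟩ | ⟨-, e, hea, h14, hmin⟩
    · omega
    have hp₃ : Pot G p q m₃ := by
      refine ⟨?_, ?_, hp.p_nonneg, hp.q_nonneg, hp.p_le, hp.q_le⟩
      · rw [hf₃.real 1 rfl, hf₂.real 1 rfl, hf₁.real 1 rfl]; exact hp.eq₁
      · rw [hf₃.real 2 rfl, hf₂.real 2 rfl, hf₁.real 2 rfl]; exact hp.eq₂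
    refine wp_conseq (moveCode_spec hS he₃ hs₃ hp₃ h4 hl₃ hea h14
      fun a b => hmin a b trivial) fun m₄ hf₄ h => .inl ⟨?_, h⟩
    rw [hf₄.var 15 rfl, hf₃.var 15 rfl, hf₂.var 15 rfl, hf₁.var 15 rfl]
  · rcases h with ⟨-, h⟩ | ⟨h, -⟩
    · refine ⟨by simp [Instr.exec], ?_, h4, hl₃⟩
      exact Set.eq_empty_of_forall_notMem fun e => h e.1 e.2 trivial
    · omega

theorem outputCode_spec (h1 : m.var 1 = 1) (h4 : ∀ a : Fin n, m.nat 4 a ≤ 1) :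
    outputCode.wp n S M (fun m' => ∀ a : Fin n, (a ∉ lowSet n m → m'.nat 2 a = 1) ∧
      (a ∈ lowSet n m → m'.nat 2 a = 0)) m := by
  refine wp_rep (fun k m' => ∀ a : Fin n, a < k → m'.nat 2 a = 1 - m.nat 4 a) (by simp) ?_ ?_
  · intro k hk m₁ hf₁ hv₁ hi₁
    refine ⟨trivial, trivial, trivial, fun a ha => ?_⟩
    have h1' : m₁.var 1 = 1 := (hf₁.var 1 rfl).trans h1
    have e4 : m₁.nat 4 = m.nat 4 := hf₁.nat 4 rfl
    simp only [Instr.exec, Mem.setVar_nat, Mem.setNat_nat, Mem.setVar_var, if_true]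
    simp only [show (5 : ℕ) ≠ 11 by decide, show (1 : ℕ) ≠ 11 by decide, if_false, hv₁, h1', e4]
    split_ifs with h
    · rw [h]
    · exact hi₁ a (by omega)
  · intro m' _ h a
    have h2 := h a a.2
    have h3 := h4 a
    have h5 : a ∈ lowSet n m ↔ m.nat 4 a = 1 := Iff.rfl
    simp only [Mem.setVar_nat, h2, h5]
    omega

end RealRAM

/-! ### Reading the input and computing the constants -/

namespace RealRAM

open EnergyGame Code SignGame

variable {n S : ℕ} {M : ℝ} {G : EnergyGame (Fin n)} {m m' : Mem} {p q : Fin n → ℝ}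

/-- The input, and the constant one in variable `1`. -/
structure Start (G : EnergyGame (Fin n)) (m : Mem) : Prop where
  v0 : m.var 0 = n
  v1 : m.var 1 = 1
  var : ∀ x, 1 < x → m.var x = 0
  mx : ∀ a : Fin n, m.nat 0 a = if a ∈ G.maxNodes then 1 else 0
  adj : ∀ a b : Fin n, m.nat 1 (n * a + b) = if (a, b) ∈ G.edges then 1 else 0
  cell : ∀ a b : Fin n, m.real 0 (n * a + b) = if (a, b) ∈ G.edges then G.weight (a, b) else 0
  real : ∀ a i, a ≠ 0 → m.real a i = 0

theorem index_eq (a b : Fin n) (h : n * a.1 + b.1 < n * n) :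
    finProdFinEquiv.symm (⟨n * a.1 + b.1, h⟩ : Fin (n * n)) = (a, b) := by
  rw [Equiv.symm_apply_eq]
  ext
  simp [finProdFinEquiv_apply_val, Nat.add_comm]

theorem start_input (G : EnergyGame (Fin n)) : Start G ((Instr.const 1 1).exec G.input) where
  v0 := by simp [Instr.exec, EnergyGame.input]
  v1 := by simp [Instr.exec]
  var x hx := by
    simp only [Instr.exec, Mem.setVar_var, EnergyGame.input]
    rw [if_neg (by omega), if_neg (by omega)]
  mx a := by simp [Instr.exec, EnergyGame.input]
  adj a b := by
    have h := index_lt a.2 b.2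
    simp only [Instr.exec, Mem.setVar_nat, EnergyGame.input]
    rw [if_neg one_ne_zero, if_pos trivial, dif_pos h, index_eq]
  cell a b := by
    have h := index_lt a.2 b.2
    simp only [Instr.exec, Mem.setVar_real, EnergyGame.input]
    rw [if_pos trivial, dif_pos h, index_eq]
  real a i ha := by
    simp only [Instr.exec, Mem.setVar_real, EnergyGame.input]
    rw [if_neg ha]

theorem Start.abs_cell (h : Start G m) (a b : Fin n) : |m.real 0 (n * a + b)| < G.bound := by
  have := G.one_le_bound
  rw [h.cell]
  split_ifs with he
  · exact G.abs_weight_lt he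
  · rw [abs_zero]; linarith

/-- Cells of absent edges hold zero, so the program may sum over the whole matrix. -/
theorem Start.sum_abs_cell (h : Start G m) :
    1 + ∑ a ∈ Finset.range n, ∑ b ∈ Finset.range n, |m.real 0 (n * a + b)| = G.bound := by
  simp only [Finset.sum_range, h.cell]
  rw [← Fintype.sum_prod_type' fun a b => |if (a, b) ∈ G.edges then G.weight (a, b) else 0|]
  unfold EnergyGame.bound
  congr 1
  rw [← Finset.sum_filter_add_sum_filter_not _ (· ∈ G.edges)]
  rw [Finset.sum_eq_zero (s := Finset.univ.filter (· ∉ G.edges)), add_zero]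
  · simp only [Finset.filter_mem_eq_inter, Finset.univ_inter]
    exact Finset.sum_congr rfl fun e he => by rw [if_pos he]
  · intro e he
    rw [if_neg (Finset.mem_filter.1 he).2, abs_zero]

/-- All partial sums of absolute values are at most `G.bound`, and the constant 2 is at most
`G.bound + 1`; so no intermediate value exceeds `M`. -/
theorem initCode_spec (hS : n * n ≤ S) (h : Start G m) (hM : G.bound + 1 ≤ M) :
    initCode.wp n S M (fun m' => Env G m' ∧ Pot G 0 0 m' ∧ m'.var 15 = 1) m := by
  have hB := G.one_le_bound
  set f : ℕ → ℕ → ℝ := fun a b => |m.real 0 (n * a + b)| with hf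
  have hf0 : ∀ a b, 0 ≤ f a b := fun a b => abs_nonneg _
  have hsum : 1 + ∑ a ∈ Finset.range n, ∑ b ∈ Finset.range n, f a b = G.bound := h.sum_abs_cell
  refine ⟨trivial, trivial, trivial, trivial, ?_, trivial, ?_⟩
  · have h2 := h.var 2 (by decide)
    simp only [Instr.ok, Instr.exec, Mem.setVar_var, Mem.setReal_real, Mem.setReal_var]
    norm_num
    linarith
  generalize hm₁ : (Instr.rcopy 3 2 8 2).exec _ = m₁
  have e2 : m₁.var 2 = 0 := by simp [← hm₁, Instr.exec, h.var]
  have e0 : m₁.var 0 = n := by simp [← hm₁, Instr.exec, h.v0]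
  have e1 : m₁.var 1 = 1 := by simp [← hm₁, Instr.exec, h.v1]
  have e3 : m₁.var 3 = 2 := by simp [← hm₁, Instr.exec]
  have e4 : m₁.var 4 = 3 := by simp [← hm₁, Instr.exec]
  have e15 : m₁.var 15 = 1 := by simp [← hm₁, Instr.exec]
  have n0 : m₁.nat = m.nat := by simp [← hm₁, Instr.exec]
  have r0 : m₁.real 0 = m.real 0 := by funext i; simp [← hm₁, Instr.exec]
  have r1 : m₁.real 1 = m.real 1 := by funext i; simp [← hm₁, Instr.exec]
  have r2 : m₁.real 2 = m.real 2 := by funext i; simp [← hm₁, Instr.exec]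
  have r7 : m₁.real 7 = m.real 7 := by funext i; simp [← hm₁, Instr.exec]
  have r3 : m₁.real 3 0 = 1 := by simp [← hm₁, Instr.exec, h.var]
  have r4 : m₁.real 4 0 = 2 := by simp [← hm₁, Instr.exec, h.var]; norm_num
  have r8 : m₁.real 8 0 = 1 := by simp [← hm₁, Instr.exec, h.var]
  clear hm₁
  refine wp_conseq (Q := fun m' => m'.real 3 0 = G.bound) ?_ fun m' hf' hb => ?_
  · refine wp_rep (fun k m' => m'.real 3 0 =
      1 + ∑ a ∈ Finset.range k, ∑ b ∈ Finset.range n, f a b) (by simpa using r3) ?_ ?_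
    swap
    · exact fun m' _ h => h.trans hsum
    intro k hk m₂ hf₂ hv₂ hi₂
    refine wp_rep (fun l m' => m'.real 3 0 = 1 + (∑ a ∈ Finset.range k, ∑ b ∈ Finset.range n, f a b)
      + ∑ b ∈ Finset.range l, f k b) (by simpa using hi₂) ?_ ?_
    swap
    · intro m' _ h
      simp only [Mem.setVar_real, Finset.sum_range_succ, h]
      ring
    intro l hl m₃ hf₃ hv₃ hi₃
    have v0 : m₃.var 0 = n := by rw [hf₃.var 0 rfl, hf₂.var 0 rfl, e0]
    have v5 : m₃.var 5 = k := by rw [hf₃.var 5 rfl, hv₂]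
    refine wp_seq _ (indexCode_spec hS v0 (by omega) (by omega)) fun m₄ hf₄ h7 => ?_
    rw [v5, hv₃] at h7
    have v2 : m₄.var 2 = 0 := by rw [hf₄.var 2 rfl, hf₃.var 2 rfl, hf₂.var 2 rfl, e2]
    have hr : m₄.real 3 0 = m₃.real 3 0 := by rw [hf₄.real 3 rfl]
    have hr0 : m₄.real 0 = m.real 0 := by
      rw [hf₄.real 0 rfl, hf₃.real 0 rfl, hf₂.real 0 rfl, r0]
    have hr7 : m₄.real 7 0 = 0 := by
      rw [hf₄.real 7 rfl, hf₃.real 7 rfl, hf₂.real 7 rfl, r7, h.real 7 0 (by decide)]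
    have hs0 : 0 ≤ ∑ a ∈ Finset.range k, ∑ b ∈ Finset.range n, f a b :=
      Finset.sum_nonneg fun a _ => Finset.sum_nonneg fun b _ => hf0 a b
    have hs1 : 0 ≤ ∑ b ∈ Finset.range l, f k b := Finset.sum_nonneg fun b _ => hf0 k b
    have hs2 : ∑ b ∈ Finset.range (l + 1), f k b ≤ ∑ b ∈ Finset.range n, f k b :=
      Finset.sum_le_sum_of_subset_of_nonneg (Finset.range_mono hl) fun b _ _ => hf0 k b
    have hs3 : ∑ a ∈ Finset.range (k + 1), ∑ b ∈ Finset.range n, f a b ≤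
        ∑ a ∈ Finset.range n, ∑ b ∈ Finset.range n, f a b :=
      Finset.sum_le_sum_of_subset_of_nonneg (Finset.range_mono hk) fun a _ _ =>
        Finset.sum_nonneg fun b _ => hf0 a b
    rw [Finset.sum_range_succ] at hs2 hs3
    have hfkl := hf0 k l
    refine ⟨fun ht => ⟨?_, ?_⟩, fun ht => ⟨?_, ?_⟩⟩ <;>
      simp only [Test.Holds, v2, h7, hr0, hr7] at ht <;>
      simp only [Instr.ok, Instr.exec, v2, h7, hr, hr0, hi₃, Mem.setVar_real, Mem.setReal_real,
        if_true, Finset.sum_range_succ]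
    · have : f k l = m.real 0 (n * k + l) := abs_of_nonneg ht
      rw [← this, abs_of_nonneg (by linarith)]; linarith
    · have : f k l = m.real 0 (n * k + l) := abs_of_nonneg ht
      rw [this]; ring
    · have : f k l = -m.real 0 (n * k + l) := abs_of_neg (not_le.1 ht)
      rw [abs_le]; constructor <;> linarith
    · have : f k l = -m.real 0 (n * k + l) := abs_of_neg (not_le.1 ht)
      rw [this]; ring
  · have s0 : m'.real 0 = m.real 0 := by rw [hf'.real 0 rfl, r0]
    refine ⟨⟨?_, ?_, ?_, ?_, ?_, ?_, ?_, ?_, ?_, hb, ?_, ?_, ?_⟩, ⟨?_, ?_, ?_, ?_, ?_, ?_⟩, ?_⟩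
    · rw [hf'.var 0 rfl, e0]
    · rw [hf'.var 1 rfl, e1]
    · rw [hf'.var 2 rfl, e2]
    · rw [hf'.var 3 rfl, e3]
    · rw [hf'.var 4 rfl, e4]
    · rw [hf'.nat 0 rfl, n0]; exact h.mx
    · rw [hf'.nat 1 rfl, n0]; exact h.adj
    · intro a b hab; rw [s0, h.cell, if_pos hab]
    · rw [s0]; exact h.abs_cell
    · rw [hf'.real 4 rfl, r4]
    · rw [hf'.real 7 rfl, r7, h.real 7 0 (by decide)]
    · rw [hf'.real 8 rfl, r8]
    · intro a; rw [hf'.real 1 rfl, r1, h.real 1 _ (by decide)]; rfl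
    · intro a; rw [hf'.real 2 rfl, r2, h.real 2 _ (by decide)]; rfl
    · intro a; exact le_rfl
    · intro a; exact le_rfl
    · intro a; simp only [Pi.zero_apply]; positivity
    · intro a; simp only [Pi.zero_apply]; positivity
    · rw [hf'.var 15 rfl, e15]

end RealRAM

/-! ### The main loop and the whole program -/

namespace RealRAM

open EnergyGame Code SignGame

variable {n S : ℕ} {M : ℝ} {G : EnergyGame (Fin n)} {m m' : Mem} {p q : Fin n → ℝ}

/-- The main loop. -/
def mainLoop : Prog := .loop (.le 1 15) bodyCode.toProg

/-- The whole program. -/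
def mainProg : Prog :=
  .seq (.op (.const 1 1)) (.seq initCode.toProg (.seq mainLoop outputCode.toProg))

/-- A bound on the number of rounds of the main loop. -/
def rounds (n : ℕ) : ℕ := 2 * ((n + 1) ^ 2 * 2 ^ (n / 2 + 1) * (n ^ 2 + 1))

/-- Induction on the number `r` of rounds left. The whole history of `k` steps is carried along
because the bound concerns sequences of steps: with no rounds left, the history would be longer than
`step_length_le` permits. -/
theorem mainLoop_exec {H : AddSubgroup ℝ} (hS : n * n ≤ S) (hS50 : 50 ≤ S) (hn : n < S)
    (h1 : 1 ∈ H) (r : ℕ) : ∀ (k : ℕ) (p q : ℕ → Fin n → ℝ) (m : Mem), k + r = rounds n →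
    (∀ i < k, G.Step (p i) (q i) (p (i + 1)) (q (i + 1))) → Safe S H G.limit m → Env G m →
    Pot G (p k) (q k) m → m.var 15 = 1 →
    ∃ m' t, t ≤ r * (bodyCode.cost n + 1) + 1 ∧ Exec (Safe S H G.limit) mainLoop m m' t ∧
      Env G m' ∧ ∃ p' q', (G.pattern p' q').app = ∅ ∧ (∀ a : Fin n, m'.nat 4 a ≤ 1) ∧
        lowSet n m' = (G.pattern p' q').low := by
  have hM : 1 ≤ G.limit := by
    have h := G.one_le_bound
    have hn : (0 : ℝ) ≤ n := Nat.cast_nonneg n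
    have : 0 ≤ (n : ℝ) * G.bound := by positivity
    unfold EnergyGame.limit
    linarith
  induction r with
  | zero =>
    intro k p q m hk hst
    have := G.step_length_le p q k hst
    rw [Fintype.card_fin] at this
    unfold rounds at hk
    omega
  | succ r ih =>
    intro k p q m hk hst hs he hp h15
    obtain ⟨m₁, s, hsc, hex, hf, hb⟩ := exec_of_wp hS50 hn h1 hM bodyCode rfl hs he.v0 he.v1
      (wp_frame _ _ (bodyCode_spec hS he hp))
    have he₁ := he.frame hf rfl
    have ht : (Test.le 1 15).Holds m := by simp [Test.Holds, he.v1, h15]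
    rcases hb with ⟨h15', p', q', hp', hst'⟩ | ⟨h15', hres⟩
    · have hst₁ : ∀ i < k + 1, G.Step (Function.update p (k + 1) p' i)
          (Function.update q (k + 1) q' i) (Function.update p (k + 1) p' (i + 1))
          (Function.update q (k + 1) q' (i + 1)) := by
        intro i hi
        rw [Function.update_of_ne (by omega), Function.update_of_ne (by omega)]
        by_cases hik : i = k
        · subst hik
          simpa using hst'
        · rw [Function.update_of_ne (by omega), Function.update_of_ne (by omega)]
          exact hst i (by omega)
      obtain ⟨m₂, t, htc, hex', hres⟩ := ih (k + 1) (Function.update p (k + 1) p')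
        (Function.update q (k + 1) q') m₁ (by omega) hst₁ (hex.safe hs) he₁
        (by simpa using hp') (h15'.trans h15)
      refine ⟨m₂, _, ?_, .loop_step ht hex hex', hres⟩
      rw [Nat.succ_mul]
      omega
    · refine ⟨m₁, _, ?_, .loop_step ht hex (.loop_done ?_), he₁, _, _, hres⟩
      · rw [Nat.succ_mul]
        omega
      · simp [Test.Holds, he₁.v1, h15']

/-- The bound on integers and addresses. -/
def space (n : ℕ) : ℕ := (n + 1) ^ 2 + 50

/-- The group of the real numbers in the computation. -/
def numbers (G : EnergyGame (Fin n)) : AddSubgroup ℝ :=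
  AddSubgroup.closure (insert 1 (G.weight '' G.edges))

theorem safe_input (G : EnergyGame (Fin n)) : Safe (space n) (numbers G) G.limit G.input := by
  have hB := G.one_le_bound
  have hn : (0 : ℝ) ≤ n := Nat.cast_nonneg n
  have hnB : 0 ≤ (n : ℝ) * G.bound := by positivity
  have hlim : G.bound ≤ G.limit := by
    unfold EnergyGame.limit
    linarith
  have hS : n * n + n + 50 ≤ space n := by unfold space; nlinarith
  constructor
  · intro x
    simp only [EnergyGame.input]
    split_ifs <;> omega
  · intro a i
    simp only [EnergyGame.input]
    split_ifs <;> omega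
  · intro x hx
    simp only [EnergyGame.input]
    rw [if_neg (by omega)]
  · intro a i h
    simp only [EnergyGame.input]
    by_cases h0 : a = 0
    · rw [if_pos h0, dif_neg (by omega)]
    by_cases h1 : a = 1
    · rw [if_neg h0, if_pos h1, dif_neg (by omega)]
    · rw [if_neg h0, if_neg h1]
  · intro a i h
    simp only [EnergyGame.input]
    by_cases h0 : a = 0
    · rw [if_pos h0, dif_neg (by omega)]
    · rw [if_neg h0]
  · intro a i
    simp only [EnergyGame.input]
    split_ifs with h1 h2 h3
    · exact AddSubgroup.subset_closure (.inr ⟨_, h3, rfl⟩)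
    all_goals exact zero_mem _
  · intro a i
    simp only [EnergyGame.input]
    split_ifs with h1 h2 h3
    · exact (G.abs_weight_lt h3).le.trans hlim
    all_goals rw [abs_zero]; linarith

/-- A bound on the running time. -/
def time (n : ℕ) : ℕ :=
  rounds n * (bodyCode.cost n + 1) + initCode.cost n + outputCode.cost n + 5

theorem mainProg_exec (G : EnergyGame (Fin n)) : ∃ m' t, t ≤ time n ∧
    Exec (Safe (space n) (numbers G) G.limit) mainProg G.input m' t ∧
    ∀ v : Fin n, (G.WinsMax v → m'.nat 2 v = 1) ∧ (¬ G.WinsMax v → m'.nat 2 v = 0) := by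
  have hB := G.one_le_bound
  have hn : (0 : ℝ) ≤ n := Nat.cast_nonneg n
  have hnB : 0 ≤ (n : ℝ) * G.bound := by positivity
  have hM : G.bound + 1 ≤ G.limit := by
    unfold EnergyGame.limit
    linarith
  have hS : n * n + n + 50 ≤ space n := by unfold space; nlinarith
  have h1 : 1 ∈ numbers G := AddSubgroup.subset_closure (.inl rfl)
  have hs := safe_input G
  have hst := start_input G
  have hs₁ : Safe (space n) (numbers G) G.limit ((Instr.const 1 1).exec G.input) :=
    hs.setVar (by omega) (by omega)
  have hex := Exec.op (I := Safe (space n) (numbers G) G.limit) (.const 1 1) G.input hs₁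
  obtain ⟨m₂, t₂, ht₂, hex₂, he₂, hp₂, h15⟩ := exec_of_wp (S := space n) (by omega) (by omega) h1
    (by linarith) initCode rfl hs₁ hst.v0 hst.v1 (initCode_spec (by omega) hst hM)
  have hs₂ := hex₂.safe hs₁
  obtain ⟨m₃, t₃, ht₃, hex₃, he₃, p', q', happ, h4, hl⟩ := mainLoop_exec (S := space n) (by omega)
    (by omega) (by omega) h1 (rounds n) 0 (fun _ => 0) (fun _ => 0) m₂ (by omega) (by simp) hs₂ he₂
    hp₂ h15
  obtain ⟨m₄, t₄, ht₄, hex₄, hout⟩ := exec_of_wp (S := space n) (by omega) (by omega) h1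
    (by linarith) outputCode rfl (hex₃.safe hs₂) he₃.v0 he₃.v1 (outputCode_spec he₃.v1 h4)
  refine ⟨m₄, _, ?_, .seq hex (.seq hex₂ (.seq hex₃ hex₄)), fun v => ?_⟩
  · unfold time
    omega
  · rw [winsMax_iff happ, ← hl, not_not]
    exact hout v

end RealRAM

/-! ### Polynomial bounds on time and space -/

namespace RealRAM

open EnergyGame Code

/-- Bounded by a polynomial. -/
def PolyBounded (f : ℕ → ℕ) : Prop := ∃ C d : ℕ, ∀ n, f n ≤ C * (n + 1) ^ d

namespace PolyBounded

variable {f g : ℕ → ℕ}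

theorem const (k : ℕ) : PolyBounded fun _ => k := ⟨k, 0, fun n => by simp⟩

theorem id : PolyBounded fun n => n := ⟨1, 1, fun n => by simp⟩

theorem add (hf : PolyBounded f) (hg : PolyBounded g) : PolyBounded fun n => f n + g n := by
  obtain ⟨C, d, h⟩ := hf
  obtain ⟨C', d', h'⟩ := hg
  refine ⟨C + C', max d d', fun n => ?_⟩
  rw [Nat.add_mul]
  have hn : 0 < n + 1 := n.succ_pos
  exact Nat.add_le_add
    ((h n).trans (Nat.mul_le_mul_left _ (Nat.pow_le_pow_right hn (le_max_left _ _))))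
    ((h' n).trans (Nat.mul_le_mul_left _ (Nat.pow_le_pow_right hn (le_max_right _ _))))

theorem mul (hf : PolyBounded f) (hg : PolyBounded g) : PolyBounded fun n => f n * g n := by
  obtain ⟨C, d, h⟩ := hf
  obtain ⟨C', d', h'⟩ := hg
  refine ⟨C * C', d + d', fun n => (Nat.mul_le_mul (h n) (h' n)).trans_eq ?_⟩
  rw [pow_add]
  ring

theorem pow (hf : PolyBounded f) (k : ℕ) : PolyBounded fun n => f n ^ k := by
  induction k with
  | zero => simpa using const 1
  | succ k ih => simpa only [pow_succ] using ih.mul hf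

theorem cost (p : Code) : PolyBounded fun n => p.cost n := by
  induction p with
  | skip => exact const 1
  | op i => exact const 1
  | seq p q hp hq => exact (const 1).add (hp.add hq)
  | ite t p q hp hq => exact (const 1).add (hp.add hq)
  | rep i p hp => exact (id.add (const 2)).mul (hp.add (const 6))

end PolyBounded

/-- The polynomial factor of the running time. -/
def timeFactor (n : ℕ) : ℕ :=
  4 * ((n + 1) ^ 2 * (n ^ 2 + 1)) * (bodyCode.cost n + 1) + initCode.cost n + outputCode.cost n + 5

theorem polyBounded_timeFactor : PolyBounded timeFactor :=
  have h := PolyBounded.const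
  have hn := PolyBounded.id
  ((((h 4).mul (((hn.add (h 1)).pow 2).mul ((hn.pow 2).add (h 1)))).mul
    ((PolyBounded.cost bodyCode).add (h 1))).add (PolyBounded.cost initCode)).add
    (PolyBounded.cost outputCode) |>.add (h 5)

theorem time_le (n : ℕ) : time n ≤ timeFactor n * 2 ^ (n / 2) := by
  have h1 : 1 ≤ 2 ^ (n / 2) := Nat.one_le_two_pow
  -- One factor 2 comes from the two dual counts, the other from the exponent `n / 2 + 1`.
  have h2 : rounds n * (bodyCode.cost n + 1) =
      4 * ((n + 1) ^ 2 * (n ^ 2 + 1)) * (bodyCode.cost n + 1) * 2 ^ (n / 2) := by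
    unfold rounds
    rw [pow_succ]
    ring
  unfold time timeFactor
  rw [h2, Nat.add_mul, Nat.add_mul, Nat.add_mul]
  have := Nat.mul_le_mul_left (initCode.cost n) h1
  have := Nat.mul_le_mul_left (outputCode.cost n) h1
  omega

/-- `Safe` admits names and addresses up to and including `S`, but `FitsIn` only those below `T`;
hence the strict inequality. -/
theorem Safe.fitsIn {S T : ℕ} {H : AddSubgroup ℝ} {M : ℝ} {m : Mem} (h : Safe S H M m)
    (hT : S < T) : m.FitsIn T :=
  ⟨fun x => (h.var_le x).trans hT.le, fun a i => (h.nat_le a i).trans hT.le,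
    fun x hx => h.var_zero x (by omega),
    fun a i hi => ⟨h.nat_zero a i (by omega), h.real_zero a i (by omega)⟩⟩

/-- It turns the sum in `bound` into a product, so that bit-lengths add up. -/
theorem one_add_sum_le_prod {ι : Type*} (s : Finset ι) (f : ι → ℝ) (hf : ∀ i ∈ s, 0 ≤ f i) :
    1 + ∑ i ∈ s, f i ≤ ∏ i ∈ s, (1 + f i) := by
  classical
  induction s using Finset.induction_on with
  | empty => simp
  | insert a s ha ih =>
    rw [Finset.sum_insert ha, Finset.prod_insert ha]
    have h0 := hf a (Finset.mem_insert_self _ _)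
    have hs : ∀ i ∈ s, 0 ≤ f i := fun i hi => hf i (Finset.mem_insert_of_mem hi)
    have h1 := Finset.sum_nonneg hs
    nlinarith [mul_le_mul_of_nonneg_left (ih hs) h0, ih hs, mul_nonneg h0 h1]

/-! ### Bit-lengths for rational weights -/

section Rational

variable {n : ℕ} {G : EnergyGame (Fin n)} {q : Fin n × Fin n → ℚ}

/-- The product of all denominators clears those of the generators, and integrality passes to sums
and negatives. -/
theorem numbers_integral (hq : ∀ e ∈ G.edges, G.weight e = (q e : ℝ)) {r : ℝ}
    (hr : r ∈ numbers G) : ∃ k : ℤ, r * (∏ e ∈ G.edges, (q e).den : ℕ) = k := by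
  induction hr using AddSubgroup.closure_induction with
  | mem x hx =>
    rcases hx with rfl | ⟨e, he, rfl⟩
    · exact ⟨_, by rw [one_mul, ← Int.cast_natCast]⟩
    · obtain ⟨c, hc⟩ := Finset.dvd_prod_of_mem (fun e => (q e).den) he
      refine ⟨(q e).num * c, ?_⟩
      rw [hq e he, hc]
      have : ((q e : ℚ) : ℝ) * ((q e).den : ℝ) = (q e).num := by
        exact_mod_cast Rat.mul_den_eq_num (q e)
      push_cast
      rw [← mul_assoc, this]
  | zero => exact ⟨0, by simp⟩
  | add x y _ _ hx hy =>
    obtain ⟨k, hk⟩ := hx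
    obtain ⟨l, hl⟩ := hy
    exact ⟨k + l, by rw [add_mul, hk, hl]; push_cast; rfl⟩
  | neg x _ hx =>
    obtain ⟨k, hk⟩ := hx
    exact ⟨-k, by rw [neg_mul, hk]; push_cast; rfl⟩

theorem prod_den_le (s : Finset (Fin n × Fin n)) :
    ∏ e ∈ s, (q e).den ≤ 2 ^ ∑ e ∈ s, ratBits (q e) := by
  rw [← Finset.prod_pow_eq_pow_sum]
  refine Finset.prod_le_prod' fun e _ => (Nat.lt_size_self _).le.trans ?_
  exact Nat.pow_le_pow_right (by decide) (Nat.le_add_left _ _)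

/-- Each factor `1 + |q e|` is at most one plus the absolute numerator, hence at most `2 ^ ratBits
(q e)`. -/
theorem bound_le (hq : ∀ e ∈ G.edges, G.weight e = (q e : ℝ)) :
    G.bound ≤ 2 ^ ∑ e ∈ G.edges, ratBits (q e) := by
  unfold EnergyGame.bound
  refine (one_add_sum_le_prod _ _ fun _ _ => abs_nonneg _).trans ?_
  rw [← Finset.prod_pow_eq_pow_sum]
  refine Finset.prod_le_prod (fun e _ => by positivity) fun e he => ?_
  rw [hq e he]
  have h1 : |((q e : ℚ) : ℝ)| ≤ ((q e).num.natAbs : ℝ) := by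
    have h : |q e| ≤ ((q e).num.natAbs : ℚ) := by
      rw [Nat.cast_natAbs, Int.cast_abs]
      conv_lhs => rw [← Rat.num_div_den (q e)]
      rw [abs_div, Nat.abs_cast]
      exact div_le_self (abs_nonneg _) (by exact_mod_cast (q e).pos)
    exact_mod_cast h
  have h2 : (q e).num.natAbs + 1 ≤ 2 ^ ratBits (q e) :=
    (Nat.lt_size_self _).trans_le (Nat.pow_le_pow_right (by decide) (Nat.le_add_right _ _))
  have h3 : ((q e).num.natAbs : ℝ) + 1 ≤ 2 ^ ratBits (q e) := by exact_mod_cast h2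
  linarith

/-- Write `r = k / Q` with the common denominator `Q ≤ 2 ^ W`. Then `|k| = |r| * Q` is at most `2 ^
(4 + n + 2 * W)`, and cancelling common factors only makes both parts smaller. -/
theorem exists_rat (hq : ∀ e ∈ G.edges, G.weight e = (q e : ℝ)) {r : ℝ} (hr : r ∈ numbers G)
    (hr' : |r| ≤ G.limit) : ∃ x : ℚ, r = (x : ℝ) ∧
      ratBits x ≤ 6 * (n + (∑ e ∈ G.edges, ratBits (q e)) + 1) := by
  obtain ⟨k, hk⟩ := numbers_integral hq hr
  have hQ := prod_den_le (q := q) G.edges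
  have hbound := bound_le hq
  have hQ0 : 0 < ∏ e ∈ G.edges, (q e).den := Finset.prod_pos fun e _ => (q e).pos
  generalize ∏ e ∈ G.edges, (q e).den = Q at *
  generalize ∑ e ∈ G.edges, ratBits (q e) = W at *
  have hQr : (0 : ℝ) < Q := by exact_mod_cast hQ0
  refine ⟨Rat.divInt k Q, ?_, ?_⟩
  · rw [Rat.divInt_eq_div]
    push_cast
    rw [eq_div_iff hQr.ne', hk]
  have hQz : (Q : ℤ) ≠ 0 := by exact_mod_cast hQ0.ne'
  have hden : (Rat.divInt k Q).den ≤ 2 ^ W :=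
    (Nat.le_of_dvd hQ0 (by exact_mod_cast Rat.den_dvd k Q)).trans hQ
  have hnum : (Rat.divInt k Q).num.natAbs ≤ k.natAbs := by
    rcases eq_or_ne k 0 with rfl | hk0
    · simp
    · exact Nat.le_of_dvd (Int.natAbs_pos.2 hk0) (Int.natAbs_dvd_natAbs.2 (Rat.num_dvd k hQz))
  have hlim : G.limit ≤ 2 ^ (4 + n + W) := by
    have h1 : ((n : ℝ) + 1) ≤ 2 ^ n := by exact_mod_cast Nat.lt_two_pow_self (n := n)
    have h2 : (1 : ℝ) ≤ 2 ^ W := one_le_pow₀ (by norm_num)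
    calc G.limit ≤ 4 * 2 ^ n * (2 ^ W + 2) := by
          unfold EnergyGame.limit
          have := G.one_le_bound
          gcongr
      _ ≤ 4 * 2 ^ n * (4 * 2 ^ W) := by gcongr; linarith
      _ = 2 ^ (4 + n + W) := by rw [pow_add, pow_add]; ring
  have hkb : k.natAbs ≤ 2 ^ (4 + n + W + W) := by
    have h : (k.natAbs : ℝ) ≤ 2 ^ (4 + n + W + W) := by
      rw [Nat.cast_natAbs, Int.cast_abs, ← hk, abs_mul, Nat.abs_cast, pow_add _ (4 + n + W)]
      have : (Q : ℝ) ≤ 2 ^ W := by exact_mod_cast hQ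
      exact mul_le_mul (hr'.trans hlim) this hQr.le (by positivity)
    exact_mod_cast h
  have h1 : (Rat.divInt k Q).num.natAbs.size ≤ 4 + n + W + W + 1 :=
    Nat.size_le.2 ((hnum.trans hkb).trans_lt (Nat.pow_lt_pow_right (by decide) (by omega)))
  have h2 : (Rat.divInt k Q).den.size ≤ W + 1 :=
    Nat.size_le.2 (hden.trans_lt (Nat.pow_lt_pow_right (by decide) (by omega)))
  unfold ratBits
  omega

end Rational

theorem natPow_half_le (n : ℕ) : ((2 ^ (n / 2) : ℕ) : ℝ) ≤ (2 : ℝ) ^ ((n : ℝ) / 2) := by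
  rw [Nat.cast_pow, ← Real.rpow_natCast]
  refine Real.rpow_le_rpow_of_exponent_le (by norm_num) ?_
  exact_mod_cast Nat.cast_div_le (α := ℝ) (m := n) (n := 2)

end RealRAM

/-- One program, with constants `C` and `d`, for all energy games with arbitrary real weights:
within `C (n+1)^d 2^(n/2)` steps it halts, having written the indicator of the set of the nodes
that are winning for Max to integer array `2`; all the time it uses `C (n+1)^d` space, and if the
weights are rational, the bit-lengths of all its numbers are polynomial in that of the input. -/
theorem theorem3 :
    ∃ (P : RealRAM.Prog) (C d : ℕ), ∀ (n : ℕ) (G : EnergyGame (Fin n)),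
      ∃ T : ℕ,
        (T : ℝ) ≤ C * ((n : ℝ) + 1) ^ d * (2 : ℝ) ^ ((n : ℝ) / 2) ∧
        (RealRAM.run P G.input T).todo = [] ∧
        (∀ v : Fin n, (G.WinsMax v → (RealRAM.run P G.input T).mem.nat 2 v = 1) ∧
          (¬ G.WinsMax v → (RealRAM.run P G.input T).mem.nat 2 v = 0)) ∧
        (∀ s ≤ T, (RealRAM.run P G.input s).mem.FitsIn (C * (n + 1) ^ d)) ∧
        (∀ q : Fin n × Fin n → ℚ, (∀ e ∈ G.edges, G.weight e = (q e : ℝ)) →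
          ∀ s ≤ T, ∀ a i : ℕ, ∃ r : ℚ, (RealRAM.run P G.input s).mem.real a i = (r : ℝ) ∧
            RealRAM.ratBits r ≤ C * (n + (∑ e ∈ G.edges, RealRAM.ratBits (q e)) + 1) ^ d) := by
  obtain ⟨K, d, hK⟩ := RealRAM.polyBounded_timeFactor
  -- The polynomial `space n` has degree 2 and is at most `51 * (n + 1) ^ 2`; one more makes the
  -- inequality for `Safe.fitsIn` strict.
  refine ⟨RealRAM.mainProg, K + 52, d + 2, fun n G => ?_⟩
  obtain ⟨m', T, hT, hex, hout⟩ := RealRAM.mainProg_exec G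
  obtain ⟨hrun, hsafe⟩ := hex.steps (RealRAM.safe_input G) []
  have hrun' : RealRAM.run RealRAM.mainProg G.input T = ⟨[], m'⟩ := hrun
  refine ⟨T, ?_, by rw [hrun'], by rw [hrun']; exact hout, fun s hs => ?_, fun q hq s hs a i => ?_⟩
  · have h1 : T ≤ (K + 52) * (n + 1) ^ (d + 2) * 2 ^ (n / 2) :=
      (hT.trans (RealRAM.time_le n)).trans (Nat.mul_le_mul_right _ ((hK n).trans
        (Nat.mul_le_mul (by omega) (Nat.pow_le_pow_right n.succ_pos (by omega)))))
    have h2 : (T : ℝ) ≤ ((K + 52 : ℕ) : ℝ) * ((n : ℝ) + 1) ^ (d + 2) * ((2 ^ (n / 2) : ℕ) : ℝ) := by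
      exact_mod_cast h1
    exact h2.trans (mul_le_mul_of_nonneg_left (RealRAM.natPow_half_le n) (by positivity))
  · refine (hsafe s hs).fitsIn ?_
    have h1 : (n + 1) ^ 2 ≤ (n + 1) ^ (d + 2) := Nat.pow_le_pow_right n.succ_pos (by omega)
    have h2 : 1 ≤ (n + 1) ^ (d + 2) := Nat.one_le_pow _ _ n.succ_pos
    unfold RealRAM.space
    nlinarith
  · obtain ⟨r, hr, hb⟩ := RealRAM.exists_rat hq ((hsafe s hs).real_mem a i)
      ((hsafe s hs).real_le a i)
    refine ⟨r, hr, hb.trans (Nat.mul_le_mul (by omega) ?_)⟩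
    exact Nat.le_self_pow (by omega) _
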